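/- Setting. Let $m\ge 1$ be a fixed integer. For dimension $d$ and sample size $n$ let $x_1,\dots,x_n$ be i.i.d. random vectors in $\mathbb R^d$ with mean $\mu$ and covariance matrix $\Sigma=\sum_{s=1}^d\lambda_s h_sh_s^T=H\Lambda H^T$, where $\lambda_1\ge\cdots\ge\lambda_d\ge 0$, $\Lambda=\mathrm{diag}(\lambda_1,\dots,\lambda_d)$ and $H=(h_1,\dots,h_d)$ is orthogonal; all these objects may depend on $d$ (and on $n$). Write $x_i-\mu=H\Lambda^{1/2}(z_{i1},\dots,z_{id})^T$, where $(z_{i1},\dots,z_{id})$ has mean zero and identity covariance matrix. Put $\Sigma_2=\sum_{s=m+1}^d\lambda_sh_sh_s^T$, $A_2=I_d-\sum_{s=1}^m h_sh_s^T$ and $x_{i,2}=(x_{i(1),2},\dots,x_{i(d),2})^T=A_2(x_i-\mu)$. Let $\sigma_{(a)}$ be the variance of the $a$-th coordinate of $x_i$, $\sigma_{(a),2}=\mathrm{Var}(x_{i(a),2})$ and $\theta_{(a),2}=\mathrm{Var}(x_{i(a),2}^2)$. Let $X=(x_1,\dots,x_n)$, let $\overline X$ be the $d\times n$ matrix all of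 whose columns are the sample mean, and let $S_D=(n-1)^{-1}(X-\overline X)^T(X-\overline X)$, with eigenvalues $\hat\lambda_1\ge\hat\lambda_2\ge\cdots$ and corresponding orthonormal eigenvectors $\hat u_1,\hat u_2,\dots$. Put $\hat h_j=\{(n-1)\hat\lambda_j\}^{-1/2}(X-\overline X)\hat u_j$, the signs being chosen so that $h_j^T\hat h_j\ge 0$ for $j\le m$, and let $$\tilde\lambda_j=\hat\lambda_j-\frac{\mathrm{tr}(S_D)-\sum_{s=1}^j\hat\lambda_s}{n-j-1},\qquad \tilde h_j=(\tilde h_{j(1)},\dots,\tilde h_{j(d)})^T=\{(n-1)\tilde\lambda_j\}^{-1/2}(X-\overline X)\hat u_j .$$ Assumptions, all asymptotic bounds being uniform over the coordinates $a\le d$, $s\le d$: (A-i) The $z_{is}$ have finite fourth moments; $E(z_{is_1}^2z_{is_2}^2)=1$ for $s_1\ne s_2$; $E(z_{is_1}z_{is_2}z_{is_3})=0$ for $s_1\notin\{s_2,s_3\}$; $E(z_{is_1}z_{is_2}z_{is_3}z_{is_4})=0$ for $s_1\notin\{s_2,s_3,s_4\}$; and $\limsup\max_{s\le d}\mathrm{Var}(z_{is}^2)<\infty$.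 (A-ii) There are fixed constants $t_1,t_2>0$ such that $\limsup\max_{a\le d,\,j\le m}E\exp(t_1|x_{i(a),2}z_{ij}|/\sigma_{(a),2}^{1/2})<\infty$ and $\limsup\max_{a\le d}E\exp(t_2x_{i(a),2}^2/\theta_{(a),2}^{1/2})<\infty$. (C-i) $\liminf(\lambda_j/\lambda_{j'}-1)>0$ for $1\le j<j'\le m$, $\liminf\lambda_m^2/\mathrm{tr}(\Sigma_2^2)>0$, and $\lambda_{m+1}^2/\mathrm{tr}(\Sigma_2^2)\to 0$. (C-ii) $\liminf\min_a\sigma_{(a),2}>0$, $\limsup\max_a\sigma_{(a)}<\infty$, $\liminf\min_a\theta_{(a),2}>0$ and $\limsup\max_a\theta_{(a),2}<\infty$. Statement. Assume (A-i), (A-ii), (C-i) and (C-ii). If $d\to\infty$ and $n\to\infty$ with $(\log d)/n\to 0$, then for every $j=1,\dots,m$, uniformly in the coordinate $j'=1,\dots,d$, $\tilde h_{j(j')}=h_{j(j')}+O_P\big((\lambda_j^{-1}n^{-1}\log d)^{1/2}\big)$, that is, $$\max_{1\le j'\le d}\big|\tilde h_{j(j')}-h_{j(j')}\big|=O_P\Big(\big(\lambda_j^{-1}n^{-1}\log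 d\big)^{1/2}\Big).$$ -/

import Mathlib

open MeasureTheory ProbabilityTheory Filter Matrix

universe u

noncomputable section

/-- `A = ∑_{s=1}^p lam s • v s (v s)ᵀ` with `lam 1 ≥ ⋯ ≥ lam p` and `v 1, …, v p` orthonormal.
Indices run from `1` to `p`; the values of `lam` and `v` at other indices play no role. -/
def IsSpectralDecomp {p : ℕ} (A : Matrix (Fin p) (Fin p) ℝ) (lam : ℕ → ℝ)
    (v : ℕ → Fin p → ℝ) : Prop :=
  AntitoneOn lam (Set.Icc 1 p) ∧
  (∀ s ∈ Set.Icc 1 p, ∀ t ∈ Set.Icc 1 p, v s ⬝ᵥ v t = if s = t then 1 else 0) ∧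
  A = ∑ s ∈ Finset.Icc 1 p, lam s • vecMulVec (v s) (v s)

/-- An i.i.d. sample `x 0, …, x (n-1)` from a `d`-dimensional distribution with mean `mu` and
covariance matrix `Sig`, an ordered eigen-decomposition `(lam, h)` of `Sig`, and a sphered data
matrix `z` (mean zero, identity covariance) with `x i - mu = H Λ^{1/2} z i`.
Eigenvalues, eigenvectors and the entries of `z i` are numbered from `1` to `d`. -/
structure SampleModel (d n : ℕ) where
  /-- the underlying probability space -/
  Ω : Type u
  /-- its σ-algebra -/
  mΩ : MeasurableSpace Ω
  /-- its probability measure -/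
  P : Measure Ω
  isProb : IsProbabilityMeasure P
  /-- the observations -/
  x : Fin n → Ω → Fin d → ℝ
  /-- the mean -/
  mu : Fin d → ℝ
  /-- the covariance matrix -/
  Sig : Matrix (Fin d) (Fin d) ℝ
  /-- the population eigenvalues -/
  lam : ℕ → ℝ
  /-- the population eigenvectors (PC directions) -/
  h : ℕ → Fin d → ℝ
  /-- the sphered data, `z i s` for observation `i` and component `s` -/
  z : Fin n → ℕ → Ω → ℝ
  measurable_x : ∀ i, Measurable (x i)
  indep_x : iIndepFun x P
  identDistrib_x : ∀ i i', IdentDistrib (x i) (x i') P P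
  memLp_x : ∀ i a, MemLp (fun ω => x i ω a) 2 P
  mean_x : ∀ i a, ∫ ω, x i ω a ∂P = mu a
  cov_x : ∀ i a b, ∫ ω, (x i ω a - mu a) * (x i ω b - mu b) ∂P = Sig a b
  spectral : IsSpectralDecomp Sig lam h
  memLp_z : ∀ i, ∀ s ∈ Set.Icc 1 d, MemLp (z i s) 2 P
  mean_z : ∀ i, ∀ s ∈ Set.Icc 1 d, ∫ ω, z i s ω ∂P = 0
  cov_z : ∀ i, ∀ s ∈ Set.Icc 1 d, ∀ t ∈ Set.Icc 1 d,
    ∫ ω, z i s ω * z i t ω ∂P = if s = t then 1 else 0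
  sphering : ∀ i ω a,
    x i ω a - mu a = ∑ s ∈ Finset.Icc 1 d, Real.sqrt (lam s) * z i s ω * h s a

namespace SampleModel

variable {d n : ℕ} (S : SampleModel.{u} d n)

instance : MeasurableSpace S.Ω := S.mΩ

instance : IsProbabilityMeasure S.P := S.isProb

/-- The noise part `Σ₂ = ∑_{s=m+1}^d λ_s h_s h_sᵀ` of the covariance matrix. -/
def noiseCov (m : ℕ) : Matrix (Fin d) (Fin d) ℝ :=
  ∑ s ∈ Finset.Icc (m + 1) d, S.lam s • vecMulVec (S.h s) (S.h s)

/-- The projection `A₂ = I - ∑_{s=1}^m h_s h_sᵀ`. -/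
def noiseProj (m : ℕ) : Matrix (Fin d) (Fin d) ℝ :=
  1 - ∑ s ∈ Finset.Icc 1 m, vecMulVec (S.h s) (S.h s)

/-- The noise part `x_{i,2} = A₂ (x_i - mu)` of the `i`-th (centred) observation. -/
def noise (m : ℕ) (i : Fin n) (ω : S.Ω) : Fin d → ℝ :=
  S.noiseProj m *ᵥ (S.x i ω - S.mu)

/-- `σ_(a) = Var (x_{i(a)})`. -/
def sigma (i : Fin n) (a : Fin d) : ℝ := variance (fun ω => S.x i ω a) S.P

/-- `σ_(a),2 = Var (x_{i(a),2})`. -/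
def sigmaNoise (m : ℕ) (i : Fin n) (a : Fin d) : ℝ :=
  variance (fun ω => S.noise m i ω a) S.P

/-- `θ_(a),2 = Var (x_{i(a),2}²)`. -/
def thetaNoise (m : ℕ) (i : Fin n) (a : Fin d) : ℝ :=
  variance (fun ω => (S.noise m i ω a) ^ 2) S.P

/-- The `d × n` centred data matrix, whose columns are `x_i - x̄`. -/
def centered (ω : S.Ω) : Matrix (Fin d) (Fin n) ℝ :=
  Matrix.of fun a i => S.x i ω a - (∑ l, S.x l ω a) / (n : ℝ)

/-- The `n × n` dual sample covariance matrix `S_D`. -/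
def dualCov (ω : S.Ω) : Matrix (Fin n) (Fin n) ℝ :=
  ((n : ℝ) - 1)⁻¹ • ((S.centered ω)ᵀ * S.centered ω)

/-- The noise-reduction estimator `λ̃_j`, from the sample eigenvalues `lamHat 1 ≥ lamHat 2 ≥ ⋯`. -/
def nrEigenvalue (ω : S.Ω) (lamHat : ℕ → ℝ) (j : ℕ) : ℝ :=
  lamHat j -
    ((S.dualCov ω).trace - ∑ s ∈ Finset.Icc 1 j, lamHat s) / ((n : ℝ) - (j : ℝ) - 1)

/-- The sample PC direction `ĥ_j = {(n-1) λ̂_j}^{-1/2} (X - X̄) û_j`. -/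
def pcDirection (ω : S.Ω) (lamHat : ℕ → ℝ) (uHat : ℕ → Fin n → ℝ) (j : ℕ) : Fin d → ℝ :=
  (Real.sqrt (((n : ℝ) - 1) * lamHat j))⁻¹ • (S.centered ω *ᵥ uHat j)

/-- The noise-reduction PC direction `h̃_j = {(n-1) λ̃_j}^{-1/2} (X - X̄) û_j`. -/
def nrDirection (ω : S.Ω) (lamHat : ℕ → ℝ) (uHat : ℕ → Fin n → ℝ) (j : ℕ) : Fin d → ℝ :=
  (Real.sqrt (((n : ℝ) - 1) * S.nrEigenvalue ω lamHat j))⁻¹ • (S.centered ω *ᵥ uHat j)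

end SampleModel

/-! In the conditions below, `liminf > 0` (`limsup < ∞`) is written as an eventual positive lower
bound (an eventual upper bound), which is uniform over the coordinates. -/

section Conditions

variable {d n : ℕ → ℕ} (S : ∀ k, SampleModel.{u} (d k) (n k))

/-- Condition (A-i): the mixed moments up to order four vanish or factorize,
and the variances of `z_{is}²` are bounded. -/
def ConditionAI : Prop :=
  (∀ k i, ∀ s ∈ Set.Icc 1 (d k), MemLp ((S k).z i s) 4 (S k).P) ∧
  (∀ k i, ∀ s₁ ∈ Set.Icc 1 (d k), ∀ s₂ ∈ Set.Icc 1 (d k), s₁ ≠ s₂ →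
    ∫ ω, (S k).z i s₁ ω ^ 2 * (S k).z i s₂ ω ^ 2 ∂(S k).P = 1) ∧
  (∀ k i, ∀ s₁ ∈ Set.Icc 1 (d k), ∀ s₂ ∈ Set.Icc 1 (d k), ∀ s₃ ∈ Set.Icc 1 (d k),
    s₁ ≠ s₂ → s₁ ≠ s₃ →
    ∫ ω, (S k).z i s₁ ω * (S k).z i s₂ ω * (S k).z i s₃ ω ∂(S k).P = 0) ∧
  (∀ k i, ∀ s₁ ∈ Set.Icc 1 (d k), ∀ s₂ ∈ Set.Icc 1 (d k), ∀ s₃ ∈ Set.Icc 1 (d k),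
    ∀ s₄ ∈ Set.Icc 1 (d k), s₁ ≠ s₂ → s₁ ≠ s₃ → s₁ ≠ s₄ →
    ∫ ω, (S k).z i s₁ ω * (S k).z i s₂ ω * (S k).z i s₃ ω * (S k).z i s₄ ω ∂(S k).P = 0) ∧
  (∃ C : ℝ, ∀ᶠ k in atTop, ∀ i, ∀ s ∈ Set.Icc 1 (d k),
    variance (fun ω => (S k).z i s ω ^ 2) (S k).P ≤ C)

/-- Condition (A-ii): sub-Gaussian type exponential moments. -/
def ConditionAII (m : ℕ) : Prop :=
  ∃ t₁ > (0 : ℝ), ∃ t₂ > (0 : ℝ), ∃ C : ℝ, ∀ᶠ k in atTop, ∀ (i : Fin (n k)) (a : Fin (d k)),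
    (∀ j ∈ Set.Icc 1 m,
      Integrable (fun ω => Real.exp (t₁ * |(S k).noise m i ω a * (S k).z i j ω| /
        Real.sqrt ((S k).sigmaNoise m i a))) (S k).P ∧
      ∫ ω, Real.exp (t₁ * |(S k).noise m i ω a * (S k).z i j ω| /
        Real.sqrt ((S k).sigmaNoise m i a)) ∂(S k).P ≤ C) ∧
    Integrable (fun ω => Real.exp (t₂ * (S k).noise m i ω a ^ 2 /
      Real.sqrt ((S k).thetaNoise m i a))) (S k).P ∧
    ∫ ω, Real.exp (t₂ * (S k).noise m i ω a ^ 2 /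
      Real.sqrt ((S k).thetaNoise m i a)) ∂(S k).P ≤ C

/-- Condition (C-i): `m` well separated spiked eigenvalues over a noise part. -/
def ConditionCI (m : ℕ) : Prop :=
  (∀ j ∈ Set.Icc 1 m, ∀ j' ∈ Set.Icc 1 m, j < j' →
    ∃ c > (0 : ℝ), ∀ᶠ k in atTop, c ≤ (S k).lam j / (S k).lam j' - 1) ∧
  (∃ c > (0 : ℝ), ∀ᶠ k in atTop,
    c ≤ (S k).lam m ^ 2 / ((S k).noiseCov m ^ 2).trace) ∧
  Tendsto (fun k => (S k).lam (m + 1) ^ 2 / ((S k).noiseCov m ^ 2).trace) atTop (nhds 0)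

/-- Condition (C-ii): bounded diagonal elements. -/
def ConditionCII (m : ℕ) : Prop :=
  ∃ c > (0 : ℝ), ∃ C : ℝ, ∀ᶠ k in atTop, ∀ (i : Fin (n k)) (a : Fin (d k)),
    c ≤ (S k).sigmaNoise m i a ∧ (S k).sigma i a ≤ C ∧
    c ≤ (S k).thetaNoise m i a ∧ (S k).thetaNoise m i a ≤ C

/-- `Y = O_P(r)` for real random variables `Y k` and deterministic `r k ≥ 0`. No measurability of
`Y k` is required: for a non-measurable set, `P` is the outer measure. -/
def IsBigOP (Y : ∀ k, (S k).Ω → ℝ) (r : ℕ → ℝ) : Prop :=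
  ∀ ε > (0 : ℝ), ∃ M > (0 : ℝ), ∀ᶠ k in atTop,
    (S k).P {ω | M * r k < |Y k ω|} ≤ ENNReal.ofReal ε

end Conditions

end

/-! ### Linear algebra: min-max, Ky Fan, nearly orthonormal families. -/

section LinearAlgebra

variable {E : Type*} [NormedAddCommGroup E] [InnerProductSpace ℝ E]

local notation "⟪" x ", " y "⟫" => inner ℝ x y

/-! Everything is read off from the dual matrix `S_D`, an operator on ℝⁿ. With scores Y_is =
h_s·(x_i − μ) = √λ_s z_is, columns Y_s = (Y_is)_i and the centring projection P, one has S_D =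
(n−1)⁻¹ ∑_s (P Y_s)(P Y_s)ᵀ. Split the sum at m. The spikes give ∑_{s≤m} λ_s y_s y_sᵀ, where y_s = P
Y_s/√((n−1)λ_s) are orthonormal up to O(n^{-1/2}). The rest is κP + M, with κ = tr Σ₂/(n−1) and M
the centred fluctuation of the noise Gram matrix. The shift κ need not be small against λ_j, but it
acts as a scalar on the range of P, so it leaves the leading eigenvectors alone, and the noise
reduction removes it from the eigenvalues.

The crux is that M lives on two scales. Relative to λ_m its operator norm is merely small, without a
rate: the off-diagonal Gram matrix G satisfies E‖G²‖_F² ≤ n⁴ tr Σ₂⁴ + O(n³)(tr Σ₂²)²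
(`sum_sq_offDiagGram_sq`), and (C-i) makes tr Σ₂⁴ negligible against (tr Σ₂²)². On the spike
directions, however, the moment conditions give ‖M y_s‖ = O(n^{-1/2}) λ_m
(`sum_sq_offDiagGram_mulVec`). The deterministic theory of `SpikedPerturbation` therefore carries a
coarse bound η and a fine bound ρ. Min-max with η separates the eigenvalues. Testing the eigenvalue
equation against y_s moves M onto y_s by symmetry, so the errors there are of order ρ. The result is
u_j = ⟨y_j, u_j⟩ y_j + O(ρ) (`norm_eigenvector_sub_le`) with |⟨y_j, u_j⟩| = 1 + O(ρ), and λ̂_j − κ =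
λ_j(1 + O(ρ)) (`abs_eigenvalue_sub_le`). Comparing the trace with the partial eigenvalue sums
recovers κ up to O(λ_j/n), hence λ̃_j = λ_j(1 + O(n^{-1/2})) (`abs_noise_reduction_sub_le`).

For a coordinate a, √λ̃_j h̃_j(a) = ∑_{s≤m} √λ_s h_s(a)⟨y_s, u_j⟩ + ⟨x_a, u_j⟩, where x_a is the
centred sample of the a-th noise coordinate over √(n−1). The coefficients √λ_s h_s(a) are at most
the standard deviation of the coordinate, so the spike sum is √λ_j h_j(a) + O(n^{-1/2}) uniformly in
a. The noise term is O(|⟨x_a, y_j⟩|) + ‖x_a‖ O(n^{-1/2}). Only here does randomness have to be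
controlled over all d coordinates: a Bernstein bound (`measure_abs_sum_noise_mul_ge_le`) and a
Chernoff bound (`measure_sum_noise_sq_ge_le`) survive a union over d and give √(log d / n) and O(1).
All other random inputs are finitely many second-moment bounds (`measure_not_isGoodSample_le`).
Division by √λ̃_j gives the rate (`abs_nrDirection_sub_le`). -/

/-- Linear combinations of `p` vectors meet the orthogonal complement of `p - 1` vectors. -/
lemma exists_combination_orthogonal (a b : ℕ → E) {p : ℕ} (hp : 1 ≤ p) :
    ∃ c : ℕ → ℝ, (∃ s ∈ Finset.Icc 1 p, c s ≠ 0) ∧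
      ∀ t ∈ Finset.Icc 1 (p - 1), ⟪b t, ∑ s ∈ Finset.Icc 1 p, c s • a s⟫ = 0 := by
  let f : (Finset.Icc 1 p → ℝ) →ₗ[ℝ] (Finset.Icc 1 (p - 1) → ℝ) :=
    LinearMap.pi fun t => ∑ s : Finset.Icc 1 p, ⟪b t, a s⟫ • LinearMap.proj s
  have hker : LinearMap.ker f ≠ ⊥ := by
    apply LinearMap.ker_ne_bot_of_finrank_lt
    simp only [Module.finrank_fintype_fun_eq_card, Fintype.card_coe, Nat.card_Icc]
    omega
  obtain ⟨c, hc, hc0⟩ := (Submodule.ne_bot_iff _).1 hker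
  obtain ⟨s, hs⟩ := Function.ne_iff.1 hc0
  refine ⟨fun i => if h : i ∈ Finset.Icc 1 p then c ⟨i, h⟩ else 0, ⟨s, s.2, ?_⟩, fun t ht => ?_⟩
  · simpa using hs
  · have h1 := congrFun (LinearMap.mem_ker.1 hc) ⟨t, ht⟩
    rw [← Finset.sum_coe_sort]
    simp only [f, LinearMap.pi_apply, LinearMap.sum_apply, LinearMap.smul_apply,
      LinearMap.proj_apply, smul_eq_mul, Pi.zero_apply] at h1
    rw [inner_sum, ← h1]
    refine Finset.sum_congr rfl fun i _ => ?_
    simp [inner_smul_right, mul_comm]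

/-- `u 1, …, u n` is orthonormal. -/
def OrthonormalUpTo (n : ℕ) (u : ℕ → E) : Prop :=
  ∀ s ∈ Finset.Icc 1 n, ∀ t ∈ Finset.Icc 1 n, ⟪u s, u t⟫ = if s = t then 1 else 0

lemma OrthonormalUpTo.orthonormal {n : ℕ} {u : ℕ → E} (hu : OrthonormalUpTo n u) :
    Orthonormal ℝ (fun s : Finset.Icc 1 n => u s) := by
  rw [orthonormal_iff_ite]
  intro i j
  rw [hu i i.2 j j.2]
  simp only [Subtype.ext_iff]

lemma OrthonormalUpTo.mono {n k : ℕ} {u : ℕ → E} (hu : OrthonormalUpTo n u) (hk : k ≤ n) :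
    OrthonormalUpTo k u := fun s hs t ht =>
  hu s (Finset.Icc_subset_Icc le_rfl hk hs) t (Finset.Icc_subset_Icc le_rfl hk ht)

lemma OrthonormalUpTo.norm_eq_one {n : ℕ} {u : ℕ → E} (hu : OrthonormalUpTo n u) {s : ℕ}
    (hs : s ∈ Finset.Icc 1 n) : ‖u s‖ = 1 := by
  have h := hu s hs s hs
  simp only [real_inner_self_eq_norm_sq, if_true] at h
  nlinarith [norm_nonneg (u s)]

/-- Bessel's inequality. -/
lemma OrthonormalUpTo.sum_sq_le {n : ℕ} {u : ℕ → E} (hu : OrthonormalUpTo n u) (x : E) :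
    ∑ s ∈ Finset.Icc 1 n, ⟪u s, x⟫ ^ 2 ≤ ‖x‖ ^ 2 := by
  have h := hu.orthonormal.sum_inner_products_le x (s := Finset.univ)
  simp only [Real.norm_eq_abs, sq_abs] at h
  rwa [Finset.sum_coe_sort (Finset.Icc 1 n) (fun s => ⟪u s, x⟫ ^ 2)] at h

/-- The expansion of an inner product in a full orthonormal family. -/
lemma OrthonormalUpTo.sum_inner_mul_inner [FiniteDimensional ℝ E] {n : ℕ} {u : ℕ → E}
    (hu : OrthonormalUpTo n u) (hn : Module.finrank ℝ E = n) (x y : E) :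
    ∑ s ∈ Finset.Icc 1 n, ⟪x, u s⟫ * ⟪u s, y⟫ = ⟪x, y⟫ := by
  have hcard : Fintype.card (Finset.Icc 1 n) = Module.finrank ℝ E := by simp [hn]
  let b := OrthonormalBasis.mk hu.orthonormal
    (hu.orthonormal.linearIndependent.span_eq_top_of_card_eq_finrank' hcard).ge
  have hb : ∀ i, b i = u i := fun i => by simp [b]
  rw [← b.sum_inner_mul_inner x y, ← Finset.sum_coe_sort]
  simp [hb]

lemma OrthonormalUpTo.sum_sq_eq [FiniteDimensional ℝ E] {n : ℕ} {u : ℕ → E}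
    (hu : OrthonormalUpTo n u) (hn : Module.finrank ℝ E = n) (x : E) :
    ∑ s ∈ Finset.Icc 1 n, ⟪u s, x⟫ ^ 2 = ‖x‖ ^ 2 := by
  rw [← real_inner_self_eq_norm_sq, ← hu.sum_inner_mul_inner hn]
  refine Finset.sum_congr rfl fun s _ => ?_
  rw [real_inner_comm x, sq]

/-- An ordered orthonormal eigen-decomposition of a symmetric operator. -/
structure IsEigenSystem (A : E →ₗ[ℝ] E) (n : ℕ) (ev : ℕ → ℝ) (u : ℕ → E) : Prop where
  symm : A.IsSymmetric
  anti : AntitoneOn ev (Finset.Icc 1 n)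
  ortho : OrthonormalUpTo n u
  eigen : ∀ s ∈ Finset.Icc 1 n, A (u s) = ev s • u s

namespace IsEigenSystem

variable [FiniteDimensional ℝ E] {A : E →ₗ[ℝ] E} {n : ℕ} {ev : ℕ → ℝ} {u : ℕ → E}

lemma inner_apply (h : IsEigenSystem A n ev u) (hn : Module.finrank ℝ E = n) (x : E) :
    ⟪x, A x⟫ = ∑ s ∈ Finset.Icc 1 n, ev s * ⟪u s, x⟫ ^ 2 := by
  rw [← h.ortho.sum_inner_mul_inner hn]
  refine Finset.sum_congr rfl fun s hs => ?_
  rw [← h.symm, h.eigen s hs, real_inner_smul_left, real_inner_comm x]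
  ring

/-- The quadratic form is at least `ev j ‖x‖²` on the span of the first `j` eigenvectors. -/
lemma le_inner_apply (h : IsEigenSystem A n ev u) (hn : Module.finrank ℝ E = n) {j : ℕ}
    (hj : j ∈ Finset.Icc 1 n) (c : ℕ → ℝ) :
    ev j * ‖∑ s ∈ Finset.Icc 1 j, c s • u s‖ ^ 2 ≤
      ⟪∑ s ∈ Finset.Icc 1 j, c s • u s, A (∑ s ∈ Finset.Icc 1 j, c s • u s)⟫ := by
  have hj' := Finset.mem_Icc.1 hj
  rw [h.inner_apply hn, ← h.ortho.sum_sq_eq hn, Finset.mul_sum]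
  refine Finset.sum_le_sum fun t ht => ?_
  rcases le_or_gt t j with htj | htj
  · have := h.anti (by exact_mod_cast ht) (by exact_mod_cast hj) htj
    gcongr
  · have h0 : ⟪u t, ∑ s ∈ Finset.Icc 1 j, c s • u s⟫ = 0 := by
      rw [inner_sum]
      refine Finset.sum_eq_zero fun s hs => ?_
      have hs' := Finset.mem_Icc.1 hs
      rw [real_inner_smul_right, h.ortho t ht s (Finset.mem_Icc.2 ⟨hs'.1, hs'.2.trans hj'.2⟩),
        if_neg (by omega), mul_zero]
    simp [h0]

/-- The quadratic form is at most `ev j ‖x‖²` on the orthogonal complement of the first `j - 1`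
eigenvectors. -/
lemma inner_apply_le (h : IsEigenSystem A n ev u) (hn : Module.finrank ℝ E = n) {j : ℕ}
    (hj : j ∈ Finset.Icc 1 n) {x : E} (hx : ∀ t ∈ Finset.Icc 1 (j - 1), ⟪u t, x⟫ = 0) :
    ⟪x, A x⟫ ≤ ev j * ‖x‖ ^ 2 := by
  rw [h.inner_apply hn, ← h.ortho.sum_sq_eq hn, Finset.mul_sum]
  refine Finset.sum_le_sum fun t ht => ?_
  rcases le_or_gt j t with htj | htj
  · have := h.anti (by exact_mod_cast hj) (by exact_mod_cast ht) htj
    gcongr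
  · rw [hx t (Finset.mem_Icc.2 ⟨(Finset.mem_Icc.1 ht).1, by omega⟩)]
    simp

/-- Ky Fan's inequality. -/
lemma sum_inner_apply_le (h : IsEigenSystem A n ev u) (hn : Module.finrank ℝ E = n) {j : ℕ}
    (hj : j ∈ Finset.Icc 1 n) {q : Fin j → E} (hq : Orthonormal ℝ q) :
    ∑ i, ⟪q i, A (q i)⟫ ≤ ∑ s ∈ Finset.Icc 1 j, ev s := by
  have hj' := Finset.mem_Icc.1 hj
  -- `w s` is the squared length of the projection of `u s` onto the span of the `q i`: it lies in
  -- [0, 1], and the total mass is j.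
  set w : ℕ → ℝ := fun s => ∑ i, ⟪u s, q i⟫ ^ 2 with hw
  have hw0 : ∀ s, 0 ≤ w s := fun s => Finset.sum_nonneg fun i _ => sq_nonneg _
  have hw1 : ∀ s ∈ Finset.Icc 1 n, w s ≤ 1 := fun s hs => by
    have := hq.sum_inner_products_le (u s) (s := Finset.univ)
    simp only [Real.norm_eq_abs, sq_abs, h.ortho.norm_eq_one hs, one_pow] at this
    simpa [hw, real_inner_comm] using this
  have hsum : ∑ s ∈ Finset.Icc 1 n, w s = j := by
    rw [hw, Finset.sum_comm]
    simp [h.ortho.sum_sq_eq hn, hq.1]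
  have heq : ∑ i, ⟪q i, A (q i)⟫ = ∑ s ∈ Finset.Icc 1 n, ev s * w s := by
    simp only [h.inner_apply hn, hw, Finset.mul_sum]
    rw [Finset.sum_comm]
  -- Subtracting `ev j` fixes the signs: the weights with s ≤ j have nonnegative coefficients and
  -- are raised to 1, the others have nonpositive coefficients and are lowered to 0. The total mass
  -- j restores the subtracted term, so the eigenvalues need not be nonnegative.
  have key : ∑ s ∈ Finset.Icc 1 n, (ev s - ev j) * w s ≤ ∑ s ∈ Finset.Icc 1 j, (ev s - ev j) := by
    have hR : ∑ s ∈ Finset.Icc 1 j, (ev s - ev j) =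
        ∑ s ∈ Finset.Icc 1 n, if s ∈ Finset.Icc 1 j then ev s - ev j else 0 := by
      rw [← Finset.sum_subset (Finset.Icc_subset_Icc le_rfl hj'.2)
        (f := fun s => if s ∈ Finset.Icc 1 j then ev s - ev j else 0) (fun s _ hs => if_neg hs)]
      exact Finset.sum_congr rfl fun s hs => (if_pos hs).symm
    rw [hR]
    refine Finset.sum_le_sum fun s hs => ?_
    split_ifs with hsj
    · have := h.anti (by exact_mod_cast hs) (by exact_mod_cast hj) (Finset.mem_Icc.1 hsj).2
      nlinarith [hw1 s hs]
    · have : j ≤ s := by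
        have := Finset.mem_Icc.1 hs
        simp only [Finset.mem_Icc, not_and, not_le] at hsj
        exact (hsj this.1).le
      have := h.anti (by exact_mod_cast hj) (by exact_mod_cast hs) this
      nlinarith [hw0 s]
  simp only [sub_mul, Finset.sum_sub_distrib, ← Finset.mul_sum, hsum] at key
  simp only [Finset.sum_const, Nat.card_Icc, nsmul_eq_mul, Nat.add_sub_cancel] at key
  rw [heq]
  linarith [mul_comm (ev j) (j : ℝ)]

end IsEigenSystem

section NearlyOrthonormal

variable {y : ℕ → E} {T : Finset ℕ} {η : ℝ}

/-- Vectors whose Gram matrix is entrywise close to the identity. -/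
def NearlyOrthonormal (T : Finset ℕ) (y : ℕ → E) (η : ℝ) : Prop :=
  ∀ s ∈ T, ∀ t ∈ T, |⟪y s, y t⟫ - if s = t then 1 else 0| ≤ η

lemma NearlyOrthonormal.subset {T' : Finset ℕ} (h : NearlyOrthonormal T y η) (hT : T' ⊆ T) :
    NearlyOrthonormal T' y η := fun s hs t ht => h s (hT hs) t (hT ht)

/-- The difference is the quadratic form of the Gram matrix minus the identity, at most η(∑|c_s|)²,
and Cauchy–Schwarz costs the cardinality. -/
lemma NearlyOrthonormal.abs_norm_sq_sub (h : NearlyOrthonormal T y η) (c : ℕ → ℝ) :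
    |‖∑ s ∈ T, c s • y s‖ ^ 2 - ∑ s ∈ T, c s ^ 2| ≤ T.card * η * ∑ s ∈ T, c s ^ 2 := by
  have h1 : ‖∑ s ∈ T, c s • y s‖ ^ 2 - ∑ s ∈ T, c s ^ 2 =
      ∑ s ∈ T, ∑ t ∈ T, c s * c t * (⟪y s, y t⟫ - if s = t then 1 else 0) := by
    rw [← real_inner_self_eq_norm_sq, sum_inner, ← Finset.sum_sub_distrib]
    refine Finset.sum_congr rfl fun s hs => ?_
    simp only [inner_sum, real_inner_smul_left, real_inner_smul_right, mul_sub,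
      Finset.sum_sub_distrib, mul_ite, mul_one, mul_zero, Finset.sum_ite_eq, if_pos hs]
    congr 1
    · exact Finset.sum_congr rfl fun t _ => by ring
    · ring
  rw [h1]
  calc _ ≤ ∑ s ∈ T, ∑ t ∈ T, |c s| * |c t| * η := by
        refine (Finset.abs_sum_le_sum_abs _ _).trans (Finset.sum_le_sum fun s hs => ?_)
        refine (Finset.abs_sum_le_sum_abs _ _).trans (Finset.sum_le_sum fun t ht => ?_)
        rw [abs_mul, abs_mul]
        exact mul_le_mul_of_nonneg_left (h s hs t ht) (by positivity)
    _ = (∑ s ∈ T, |c s|) ^ 2 * η := by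
        rw [sq, Finset.sum_mul_sum, Finset.sum_mul]
        exact Finset.sum_congr rfl fun s _ => by rw [Finset.sum_mul]
    _ ≤ (T.card * ∑ s ∈ T, c s ^ 2) * η := by
        rcases T.eq_empty_or_nonempty with rfl | ⟨s, hs⟩
        · simp
        · have hη : 0 ≤ η := (abs_nonneg _).trans (h s hs s hs)
          refine mul_le_mul_of_nonneg_right ?_ hη
          simpa using sq_sum_le_card_mul_sum_sq (s := T) (f := fun s => |c s|)
    _ = _ := by ring

/-- An approximate Bessel inequality. -/
lemma NearlyOrthonormal.sum_sq_le (h : NearlyOrthonormal T y η) (hη : 0 ≤ η) (x : E) :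
    ∑ s ∈ T, ⟪y s, x⟫ ^ 2 ≤ (1 + T.card * η) * ‖x‖ ^ 2 := by
  have hv := (abs_le.1 (h.abs_norm_sq_sub fun s => ⟪y s, x⟫)).2
  set b := ∑ s ∈ T, ⟪y s, x⟫ ^ 2 with hb
  -- Duality: the sum b of squares equals ⟨v, x⟩, while ‖v‖² ≤ (1 + card·η) b; Cauchy–Schwarz then
  -- yields b² ≤ (1 + card·η) b ‖x‖², and one factor b cancels.
  set v := ∑ s ∈ T, ⟪y s, x⟫ • y s with hvdef
  have hb0 : 0 ≤ b := Finset.sum_nonneg fun s _ => sq_nonneg _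
  have hbv : b = ⟪v, x⟫ := by
    rw [hvdef, sum_inner, hb]
    exact Finset.sum_congr rfl fun s _ => by rw [real_inner_smul_left, sq]
  have hcs : b ^ 2 ≤ ‖v‖ ^ 2 * ‖x‖ ^ 2 := by
    rw [hbv, ← mul_pow]
    exact sq_le_sq' (by linarith [neg_le_of_abs_le (abs_real_inner_le_norm v x)])
      (real_inner_le_norm v x)
  have : b * b ≤ b * ((1 + T.card * η) * ‖x‖ ^ 2) := by
    nlinarith [sq_nonneg ‖x‖]
  rcases hb0.eq_or_lt with h0 | h0
  · rw [← h0]; positivity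
  · exact le_of_mul_le_mul_left this h0

/-- The reverse inequality on the span. -/
lemma NearlyOrthonormal.le_sum_sq (h : NearlyOrthonormal T y η) (hη : T.card * η ≤ 1)
    (c : ℕ → ℝ) :
    (1 - T.card * η) * ‖∑ s ∈ T, c s • y s‖ ^ 2 ≤
      ∑ s ∈ T, ⟪y s, ∑ t ∈ T, c t • y t⟫ ^ 2 := by
  have hv := (abs_le.1 (h.abs_norm_sq_sub c)).1
  set x := ∑ t ∈ T, c t • y t with hx
  set b := ∑ s ∈ T, ⟪y s, x⟫ ^ 2 with hb
  set C := ∑ s ∈ T, c s ^ 2 with hC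
  have hb0 : 0 ≤ b := Finset.sum_nonneg fun s _ => sq_nonneg _
  -- Since ‖x‖² = ∑ c_s⟨y_s, x⟩, Cauchy–Schwarz brings in ∑ c_s², which near-orthonormality bounds
  -- by ‖x‖²/(1 − card·η).
  have hcs : (‖x‖ ^ 2) ^ 2 ≤ C * b := by
    have : ‖x‖ ^ 2 = ∑ s ∈ T, c s * ⟪y s, x⟫ := by
      rw [← real_inner_self_eq_norm_sq]
      nth_rw 1 [hx]
      rw [sum_inner]
      exact Finset.sum_congr rfl fun s _ => by rw [real_inner_smul_left]
    rw [this]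
    exact Finset.sum_mul_sq_le_sq_mul_sq _ _ _
  have h1 : (1 - T.card * η) * C ≤ ‖x‖ ^ 2 := by linarith
  rcases (sq_nonneg ‖x‖).eq_or_lt with h0 | h0
  · rw [← h0]; simpa using hb0
  · have h2 : ‖x‖ ^ 2 * ((1 - T.card * η) * ‖x‖ ^ 2) ≤ ‖x‖ ^ 2 * b := by
      calc _ = (1 - T.card * η) * (‖x‖ ^ 2) ^ 2 := by ring
        _ ≤ (1 - T.card * η) * (C * b) := mul_le_mul_of_nonneg_left hcs (by linarith)
        _ = (1 - T.card * η) * C * b := by ring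
        _ ≤ _ := mul_le_mul_of_nonneg_right h1 hb0
    exact le_of_mul_le_mul_left h2 h0

lemma NearlyOrthonormal.combination_ne_zero (h : NearlyOrthonormal T y η) (hη : T.card * η < 1)
    {c : ℕ → ℝ} (hc : ∃ s ∈ T, c s ≠ 0) : ∑ s ∈ T, c s • y s ≠ 0 := by
  intro h0
  have hv := (abs_le.1 (h.abs_norm_sq_sub c)).1
  obtain ⟨s, hs, hcs⟩ := hc
  have : 0 < ∑ s ∈ T, c s ^ 2 :=
    Finset.sum_pos' (fun _ _ => sq_nonneg _) ⟨s, hs, by positivity⟩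
  rw [h0] at hv
  simp only [norm_zero] at hv
  nlinarith

/-- An orthonormal basis of the span of `p` nearly orthonormal vectors. -/
lemma NearlyOrthonormal.exists_orthonormal {p : ℕ} (h : NearlyOrthonormal (Finset.Icc 1 p) y η)
    (hη : p * η < 1) : ∃ q : Fin p → E, Orthonormal ℝ q ∧
      (∀ i, q i ∈ Submodule.span ℝ (y '' Set.Icc 1 p)) ∧
      ∀ s ∈ Finset.Icc 1 p, ∑ i, ⟪y s, q i⟫ ^ 2 = ‖y s‖ ^ 2 := by
  set V := Submodule.span ℝ (Set.range fun s : Finset.Icc 1 p => y s) with hV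
  have hrange : (Set.range fun s : Finset.Icc 1 p => y s) = y '' Set.Icc 1 p := by
    ext x; simp
  have hli : LinearIndependent ℝ (fun s : Finset.Icc 1 p => y s) := by
    rw [Fintype.linearIndependent_iff]
    intro c hc s
    by_contra hcs
    refine h.combination_ne_zero (by simpa using hη)
      (c := fun i => if hi : i ∈ Finset.Icc 1 p then c ⟨i, hi⟩ else 0) ⟨s, s.2, by simpa using hcs⟩ ?_
    rw [← Finset.sum_coe_sort, ← hc]
    exact Finset.sum_congr rfl fun i _ => by simp
  have hfin : Module.finrank ℝ V = p := by
    rw [hV, finrank_span_eq_card hli]; simp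
  have : FiniteDimensional ℝ V := FiniteDimensional.span_of_finite ℝ (Set.finite_range _)
  let b := (stdOrthonormalBasis ℝ V).reindex (finCongr hfin)
  refine ⟨fun i => (b i : E), ?_, fun i => ?_, fun s hs => ?_⟩
  · exact b.orthonormal.comp_linearIsometry V.subtypeₗᵢ
  · rw [← hrange]; exact (b i).2
  · have hy : y s ∈ V := Submodule.subset_span ⟨⟨s, hs⟩, rfl⟩
    have := b.sum_sq_norm_inner_left ⟨y s, hy⟩
    simpa [Submodule.coe_inner] using this

end NearlyOrthonormal

end LinearAlgebra

/-! ### Deterministic perturbation theory of the spiked operator. -/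

section Perturbation

variable {E : Type*} [NormedAddCommGroup E] [InnerProductSpace ℝ E]

local notation "⟪" x ", " y "⟫" => inner ℝ x y

/-- A symmetric operator `A = ∑_{s ≤ m} lam s y_s y_sᵀ + κ P + M`, where the `y s` are nearly
orthonormal, the spikes `lam s` are separated by the relative gap `g`, `P` is an orthogonal
projection fixing the `y s`, and `M` is small: of relative operator norm `η`, and of relative size
`ρ ≤ η` in the directions `y s`. -/
structure SpikedPerturbation (m : ℕ) (A P M : E →ₗ[ℝ] E) (lam : ℕ → ℝ) (y : ℕ → E)
    (κ g η ρ : ℝ) : Prop where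
  apply_eq : ∀ u, A u = ∑ s ∈ Finset.Icc 1 m, (lam s * ⟪y s, u⟫) • y s + κ • P u + M u
  one_le : 1 ≤ m
  anti : AntitoneOn lam (Finset.Icc 1 m)
  pos : 0 < lam m
  gap : ∀ j ∈ Finset.Icc 1 m, ∀ j' ∈ Finset.Icc 1 m, j < j' → (1 + g) * lam j' ≤ lam j
  proj_symm : P.IsSymmetric
  proj_idem : ∀ u, P (P u) = P u
  proj_spike : ∀ s ∈ Finset.Icc 1 m, P (y s) = y s
  proj_noise : ∀ u, P (M u) = M u
  noise_symm : M.IsSymmetric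
  noise_le : ∀ u, ‖M u‖ ≤ η * lam m * ‖u‖
  noise_spike_le : ∀ s ∈ Finset.Icc 1 m, ‖M (y s)‖ ≤ ρ * lam m
  gram : NearlyOrthonormal (Finset.Icc 1 m) y ρ
  shift_nonneg : 0 ≤ κ
  gap_pos : 0 < g
  gap_le : g ≤ 1
  rho_nonneg : 0 ≤ ρ
  rho_le : ρ ≤ η
  small : 300 * m * η ≤ g

namespace SpikedPerturbation

variable {m : ℕ} {A P M : E →ₗ[ℝ] E} {lam : ℕ → ℝ} {y : ℕ → E} {κ g η ρ : ℝ}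

lemma lam_le (h : SpikedPerturbation m A P M lam y κ g η ρ) {s : ℕ} (hs : s ∈ Finset.Icc 1 m) :
    lam m ≤ lam s :=
  h.anti (by exact_mod_cast hs) (by simpa using h.one_le) (Finset.mem_Icc.1 hs).2

lemma lam_pos (h : SpikedPerturbation m A P M lam y κ g η ρ) {s : ℕ} (hs : s ∈ Finset.Icc 1 m) :
    0 < lam s := h.pos.trans_le (h.lam_le hs)

lemma one_le_cast (h : SpikedPerturbation m A P M lam y κ g η ρ) : (1 : ℝ) ≤ m := by
  exact_mod_cast h.one_le

lemma eta_nonneg (h : SpikedPerturbation m A P M lam y κ g η ρ) : 0 ≤ η :=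
  h.rho_nonneg.trans h.rho_le

lemma eta_le (h : SpikedPerturbation m A P M lam y κ g η ρ) : 300 * η ≤ g := by
  nlinarith [h.one_le_cast, h.eta_nonneg, h.small]

lemma mul_rho_le (h : SpikedPerturbation m A P M lam y κ g η ρ) : 300 * m * ρ ≤ g := by
  nlinarith [h.one_le_cast, h.rho_le, h.small]

lemma norm_spike_sq (h : SpikedPerturbation m A P M lam y κ g η ρ) {s : ℕ}
    (hs : s ∈ Finset.Icc 1 m) : |‖y s‖ ^ 2 - 1| ≤ ρ := by
  simpa [real_inner_self_eq_norm_sq] using h.gram s hs s hs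

lemma norm_spike_le (h : SpikedPerturbation m A P M lam y κ g η ρ) {s : ℕ}
    (hs : s ∈ Finset.Icc 1 m) : ‖y s‖ ≤ 2 := by
  have h1 := (abs_le.1 (h.norm_spike_sq hs)).2
  nlinarith [norm_nonneg (y s), h.eta_le, h.rho_le, h.gap_le]

lemma abs_norm_spike_sub (h : SpikedPerturbation m A P M lam y κ g η ρ) {s : ℕ}
    (hs : s ∈ Finset.Icc 1 m) : |‖y s‖ - 1| ≤ ρ := by
  refine le_trans ?_ (h.norm_spike_sq hs)
  have : ‖y s‖ ^ 2 - 1 = (‖y s‖ - 1) * (‖y s‖ + 1) := by ring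
  rw [this, abs_mul, abs_of_nonneg (by positivity : 0 ≤ ‖y s‖ + 1)]
  nlinarith [abs_nonneg (‖y s‖ - 1), norm_nonneg (y s)]

lemma abs_inner_noise (h : SpikedPerturbation m A P M lam y κ g η ρ) (u : E) :
    |⟪u, M u⟫| ≤ η * lam m * ‖u‖ ^ 2 := by
  calc _ ≤ ‖u‖ * ‖M u‖ := abs_real_inner_le_norm _ _
    _ ≤ ‖u‖ * (η * lam m * ‖u‖) := mul_le_mul_of_nonneg_left (h.noise_le u) (norm_nonneg _)
    _ = _ := by ring

lemma inner_proj (h : SpikedPerturbation m A P M lam y κ g η ρ) (u : E) :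
    ⟪u, P u⟫ = ‖P u‖ ^ 2 := by
  rw [← real_inner_self_eq_norm_sq, h.proj_symm, h.proj_idem]

lemma inner_proj_le (h : SpikedPerturbation m A P M lam y κ g η ρ) (u : E) :
    ⟪u, P u⟫ ≤ ‖u‖ ^ 2 := by
  have h1 := real_inner_le_norm u (P u)
  have h2 := h.inner_proj u
  nlinarith [norm_nonneg u, norm_nonneg (P u), sq_nonneg (‖u‖ - ‖P u‖)]

lemma inner_apply (h : SpikedPerturbation m A P M lam y κ g η ρ) (u : E) :
    ⟪u, A u⟫ = ∑ s ∈ Finset.Icc 1 m, lam s * ⟪y s, u⟫ ^ 2 + κ * ⟪u, P u⟫ + ⟪u, M u⟫ := by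
  rw [h.apply_eq, inner_add_right, inner_add_right, inner_sum, real_inner_smul_right]
  congr 2
  refine Finset.sum_congr rfl fun s _ => ?_
  rw [real_inner_smul_right, real_inner_comm u]
  ring

/-- All three parts of `A` take values in the range of `P`; this will place the eigenvectors with
nonzero eigenvalue there too. -/
lemma proj_apply (h : SpikedPerturbation m A P M lam y κ g η ρ) (u : E) : P (A u) = A u := by
  rw [h.apply_eq, map_add, map_add, map_sum, map_smul, h.proj_idem, h.proj_noise]
  congr 2
  exact Finset.sum_congr rfl fun s hs => by rw [map_smul, h.proj_spike s hs]

variable {n : ℕ} {ev : ℕ → ℝ} {u : ℕ → E}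

lemma norm_eigenvector (e : IsEigenSystem A n ev u) (hmn : m ≤ n) {j : ℕ}
    (hj : j ∈ Finset.Icc 1 m) : ‖u j‖ = 1 :=
  e.ortho.norm_eq_one (Finset.Icc_subset_Icc le_rfl hmn hj)

lemma abs_inner_eigenvector_le (h : SpikedPerturbation m A P M lam y κ g η ρ)
    (e : IsEigenSystem A n ev u) (hmn : m ≤ n) {j s : ℕ}
    (hj : j ∈ Finset.Icc 1 m) (hs : s ∈ Finset.Icc 1 m) : |⟪y s, u j⟫| ≤ 2 := by
  refine (abs_real_inner_le_norm _ _).trans ?_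
  rw [norm_eigenvector e hmn hj, mul_one]
  exact h.norm_spike_le hs

variable [FiniteDimensional ℝ E]

/-- Courant–Fischer: some nonzero combination of u_1, …, u_j is orthogonal to y_1, …, y_{j−1}. The
form of `A` there is at least `ev j`, while only spikes of size at most `lam j` are seen. In (m +
1)η, the m pays for the Gram defect and the 1 for `M`. -/
lemma eigenvalue_le (h : SpikedPerturbation m A P M lam y κ g η ρ)
    (e : IsEigenSystem A n ev u) (hn : Module.finrank ℝ E = n) (hmn : m ≤ n) {j : ℕ}
    (hj : j ∈ Finset.Icc 1 m) : ev j ≤ κ + (1 + (m + 1) * η) * lam j := by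
  have hj' := Finset.mem_Icc.1 hj
  have hjn : j ∈ Finset.Icc 1 n := Finset.mem_Icc.2 ⟨hj'.1, hj'.2.trans hmn⟩
  obtain ⟨c, hc, horth⟩ := exists_combination_orthogonal u y hj'.1
  have hle := e.le_inner_apply hn hjn c
  have hu0 : ∑ s ∈ Finset.Icc 1 j, c s • u s ≠ 0 :=
    NearlyOrthonormal.combination_ne_zero (η := 0)
      (fun s hs t ht => by
        rw [e.ortho.mono (hj'.2.trans hmn) s hs t ht, sub_self, abs_zero]) (by simp) hc
  set x := ∑ s ∈ Finset.Icc 1 j, c s • u s with hx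
  have hx0 : 0 < ‖x‖ ^ 2 := by positivity
  rw [h.inner_apply] at hle
  have hsum : ∑ s ∈ Finset.Icc 1 m, lam s * ⟪y s, x⟫ ^ 2 ≤ lam j * ((1 + m * η) * ‖x‖ ^ 2) := by
    have hb := h.gram.sum_sq_le h.rho_nonneg x
    simp only [Nat.card_Icc, Nat.add_sub_cancel] at hb
    have hb' : ∑ s ∈ Finset.Icc 1 m, ⟪y s, x⟫ ^ 2 ≤ (1 + m * η) * ‖x‖ ^ 2 := by
      refine hb.trans (mul_le_mul_of_nonneg_right ?_ (by positivity))
      nlinarith [h.one_le_cast, h.rho_le]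
    refine le_trans ?_ (mul_le_mul_of_nonneg_left hb' (h.lam_pos hj).le)
    rw [Finset.mul_sum]
    refine Finset.sum_le_sum fun s hs => ?_
    rcases le_or_gt j s with hsj | hsj
    · exact mul_le_mul_of_nonneg_right
        (h.anti (by exact_mod_cast hj) (by exact_mod_cast hs) hsj) (sq_nonneg _)
    · rw [horth s (Finset.mem_Icc.2 ⟨(Finset.mem_Icc.1 hs).1, by omega⟩)]; simp
  have h1 := mul_le_mul_of_nonneg_left (h.inner_proj_le x) h.shift_nonneg
  have h2 := (abs_le.1 (h.abs_inner_noise x)).2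
  have h3 : η * lam m * ‖x‖ ^ 2 ≤ η * lam j * ‖x‖ ^ 2 := by
    have := h.lam_le hj
    have := h.eta_nonneg
    gcongr
  refine le_of_mul_le_mul_right ?_ hx0
  linarith

/-- The dual choice: a nonzero combination of y_1, …, y_j orthogonal to u_1, …, u_{j−1}. As `P`
fixes it, the shift κ enters in full. -/
lemma le_eigenvalue (h : SpikedPerturbation m A P M lam y κ g η ρ)
    (e : IsEigenSystem A n ev u) (hn : Module.finrank ℝ E = n) (hmn : m ≤ n) {j : ℕ}
    (hj : j ∈ Finset.Icc 1 m) : κ + (1 - (m + 1) * η) * lam j ≤ ev j := by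
  have hj' := Finset.mem_Icc.1 hj
  have hsub : Finset.Icc 1 j ⊆ Finset.Icc 1 m := Finset.Icc_subset_Icc le_rfl hj'.2
  have hjn : j ∈ Finset.Icc 1 n := Finset.mem_Icc.2 ⟨hj'.1, hj'.2.trans hmn⟩
  obtain ⟨c, hc, horth⟩ := exists_combination_orthogonal y u hj'.1
  have hle := e.inner_apply_le hn hjn horth
  have hgr := h.gram.subset hsub
  have hcard : ((Finset.Icc 1 j).card : ℝ) * ρ ≤ m * η := by
    simp only [Nat.card_Icc, Nat.add_sub_cancel]
    exact mul_le_mul (by exact_mod_cast hj'.2) h.rho_le h.rho_nonneg (by positivity)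
  have hsm : m * η ≤ 1 / 300 := by linarith [h.small, h.gap_le]
  have hx0 := hgr.combination_ne_zero (by linarith) hc
  have hlow := hgr.le_sum_sq (by linarith) c
  have hPx : P (∑ s ∈ Finset.Icc 1 j, c s • y s) = ∑ s ∈ Finset.Icc 1 j, c s • y s := by
    rw [map_sum]
    exact Finset.sum_congr rfl fun s hs => by rw [map_smul, h.proj_spike s (hsub hs)]
  set x := ∑ s ∈ Finset.Icc 1 j, c s • y s with hx
  have hx0' : 0 < ‖x‖ ^ 2 := by positivity
  rw [h.inner_apply, hPx, real_inner_self_eq_norm_sq] at hle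
  have hsum : lam j * ((1 - m * η) * ‖x‖ ^ 2) ≤ ∑ s ∈ Finset.Icc 1 m, lam s * ⟪y s, x⟫ ^ 2 := by
    have h1 : (1 - m * η) * ‖x‖ ^ 2 ≤ ∑ s ∈ Finset.Icc 1 j, ⟪y s, x⟫ ^ 2 :=
      (mul_le_mul_of_nonneg_right (by linarith) hx0'.le).trans hlow
    refine (mul_le_mul_of_nonneg_left h1 (h.lam_pos hj).le).trans ?_
    rw [Finset.mul_sum]
    refine le_trans (Finset.sum_le_sum fun s hs => ?_)
      (Finset.sum_le_sum_of_subset_of_nonneg hsub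
        fun s hs _ => mul_nonneg (h.lam_pos hs).le (sq_nonneg ⟪y s, x⟫))
    exact mul_le_mul_of_nonneg_right (h.anti (by exact_mod_cast hsub hs) (by exact_mod_cast hj)
      (Finset.mem_Icc.1 hs).2) (sq_nonneg _)
  have h2 := (abs_le.1 (h.abs_inner_noise x)).1
  have h3 : η * lam m * ‖x‖ ^ 2 ≤ η * lam j * ‖x‖ ^ 2 := by
    have := h.lam_le hj
    have := h.eta_nonneg
    gcongr
  refine le_of_mul_le_mul_right ?_ hx0'
  linarith

/-- A coarse location, to within a hundredth of the gap. Its only role is to keep `ev j - κ` away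
from the other spikes, so the bound η without a rate suffices. -/
lemma abs_eigenvalue_sub (h : SpikedPerturbation m A P M lam y κ g η ρ)
    (e : IsEigenSystem A n ev u) (hn : Module.finrank ℝ E = n) (hmn : m ≤ n) {j : ℕ}
    (hj : j ∈ Finset.Icc 1 m) : |ev j - κ - lam j| ≤ g / 100 * lam j := by
  have h1 := h.eigenvalue_le e hn hmn hj
  have h2 := h.le_eigenvalue e hn hmn hj
  have h3 : (m + 1) * η ≤ g / 100 := by
    nlinarith [h.one_le_cast, h.eta_nonneg, h.small]
  have h4 := mul_le_mul_of_nonneg_right h3 (h.lam_pos hj).le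
  rw [abs_le]
  constructor <;> linarith

lemma eigenvalue_pos (h : SpikedPerturbation m A P M lam y κ g η ρ)
    (e : IsEigenSystem A n ev u) (hn : Module.finrank ℝ E = n) (hmn : m ≤ n) {j : ℕ}
    (hj : j ∈ Finset.Icc 1 m) : 0 < ev j := by
  have h1 := (abs_le.1 (h.abs_eigenvalue_sub e hn hmn hj)).1
  nlinarith [h.lam_pos hj, h.gap_le, h.gap_pos, h.shift_nonneg]

lemma proj_eigenvector (h : SpikedPerturbation m A P M lam y κ g η ρ)
    (e : IsEigenSystem A n ev u) (hn : Module.finrank ℝ E = n) (hmn : m ≤ n) {j : ℕ}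
    (hj : j ∈ Finset.Icc 1 m) : P (u j) = u j := by
  have hj' := Finset.mem_Icc.1 hj
  have h1 := h.proj_apply (u j)
  rw [e.eigen j (Finset.mem_Icc.2 ⟨hj'.1, hj'.2.trans hmn⟩), map_smul] at h1
  exact smul_right_injective E (h.eigenvalue_pos e hn hmn hj).ne' h1

/-- The eigenvalue equation, with the shift `κ` removed. -/
lemma eigen_eq (h : SpikedPerturbation m A P M lam y κ g η ρ)
    (e : IsEigenSystem A n ev u) (hn : Module.finrank ℝ E = n) (hmn : m ≤ n) {j : ℕ}
    (hj : j ∈ Finset.Icc 1 m) : (ev j - κ) • u j =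
      ∑ s ∈ Finset.Icc 1 m, (lam s * ⟪y s, u j⟫) • y s + M (u j) := by
  have hj' := Finset.mem_Icc.1 hj
  have h1 := h.apply_eq (u j)
  rw [e.eigen j (Finset.mem_Icc.2 ⟨hj'.1, hj'.2.trans hmn⟩),
    h.proj_eigenvector e hn hmn hj] at h1
  rw [sub_smul, h1]
  abel

/-- The eigenvalue equation in the direction `y s`. -/
lemma abs_eigen_inner (h : SpikedPerturbation m A P M lam y κ g η ρ)
    (e : IsEigenSystem A n ev u) (hn : Module.finrank ℝ E = n) (hmn : m ≤ n) {j s : ℕ}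
    (hj : j ∈ Finset.Icc 1 m) (hs : s ∈ Finset.Icc 1 m) :
    |(ev j - κ - lam s * ‖y s‖ ^ 2) * ⟪y s, u j⟫| ≤
      ρ * (∑ t ∈ Finset.Icc 1 m, |lam t * ⟪y t, u j⟫| + lam m) := by
  have h1 := congrArg (fun v => ⟪y s, v⟫) (h.eigen_eq e hn hmn hj)
  simp only [real_inner_smul_right, inner_add_right, inner_sum] at h1
  have h2 : (ev j - κ - lam s * ‖y s‖ ^ 2) * ⟪y s, u j⟫ =
      ∑ t ∈ (Finset.Icc 1 m).erase s, lam t * ⟪y t, u j⟫ * ⟪y s, y t⟫ + ⟪y s, M (u j)⟫ := by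
    rw [← Finset.add_sum_erase _ _ hs, real_inner_self_eq_norm_sq] at h1
    linear_combination h1
  rw [h2]
  refine (abs_add_le _ _).trans ?_
  rw [mul_add]
  refine add_le_add ?_ ?_
  · refine (Finset.abs_sum_le_sum_abs _ _).trans ?_
    rw [Finset.mul_sum]
    refine le_trans (Finset.sum_le_sum fun t ht => ?_)
      (Finset.sum_le_sum_of_subset_of_nonneg (Finset.erase_subset s _)
        fun t _ _ => mul_nonneg h.rho_nonneg (abs_nonneg (lam t * ⟪y t, u j⟫)))
    have ht' := Finset.mem_erase.1 ht
    have h3 := h.gram s hs t ht'.2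
    rw [if_neg ht'.1.symm, sub_zero] at h3
    rw [abs_mul, mul_comm]
    exact mul_le_mul_of_nonneg_right h3 (abs_nonneg _)
  -- Symmetry moves `M` from the eigenvector to `y s`, where its size is ρ rather than η. This is
  -- the source of the sharp rate.
  · rw [← h.noise_symm]
    refine (abs_real_inner_le_norm _ _).trans ?_
    rw [norm_eigenvector e hmn hj, mul_one]
    exact h.noise_spike_le s hs

/-- The relative gap beats the errors in `ev j` and in ‖y s‖². Ratios of spikes may be unbounded, so
the separation is measured by the larger of the two; this later controls `lam s * ⟪y s, u j⟫` as
well as `⟪y s, u j⟫` itself. -/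
lemma max_lam_le_abs_sub (h : SpikedPerturbation m A P M lam y κ g η ρ)
    (e : IsEigenSystem A n ev u) (hn : Module.finrank ℝ E = n) (hmn : m ≤ n) {j s : ℕ}
    (hj : j ∈ Finset.Icc 1 m) (hs : s ∈ Finset.Icc 1 m) (hsj : s ≠ j) :
    g / 4 * max (lam s) (lam j) ≤ |ev j - κ - lam s * ‖y s‖ ^ 2| := by
  have h1 := abs_le.1 (h.abs_eigenvalue_sub e hn hmn hj)
  have h2 := abs_le.1 (h.norm_spike_sq hs)
  have h3 : ρ ≤ g / 300 := by linarith [h.eta_le, h.rho_le]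
  have hlj := h.lam_pos hj
  have hls := h.lam_pos hs
  have hg := h.gap_pos
  have hg1 := h.gap_le
  have h5 : lam s * ‖y s‖ ^ 2 ≤ lam s * (1 + g / 300) :=
    mul_le_mul_of_nonneg_left (by linarith) hls.le
  have h6 : lam s * (1 - g / 300) ≤ lam s * ‖y s‖ ^ 2 :=
    mul_le_mul_of_nonneg_left (by linarith) hls.le
  rcases lt_or_gt_of_ne hsj with hlt | hlt
  · have h4 := h.gap s hs j hj hlt
    rw [max_eq_left (by nlinarith), abs_sub_comm]
    refine le_trans ?_ (le_abs_self _)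
    have h7 : (1 + g) * lam j ≤ lam s := h4
    have h8 : (1 + g / 100) * lam j ≤ (1 - g / 4 - g / 300) * lam s := by
      have : (1 + g / 100) ≤ (1 - g / 4 - g / 300) * (1 + g) := by nlinarith
      calc _ ≤ (1 - g / 4 - g / 300) * (1 + g) * lam j := mul_le_mul_of_nonneg_right this hlj.le
        _ = (1 - g / 4 - g / 300) * ((1 + g) * lam j) := by ring
        _ ≤ _ := mul_le_mul_of_nonneg_left h7 (by linarith)
    linarith
  · have h4 := h.gap j hj s hs hlt
    rw [max_eq_right (by nlinarith)]
    refine le_trans ?_ (le_abs_self _)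
    have h8 : (1 + g / 300) * lam s ≤ (1 - g / 4 - g / 100) * lam j := by
      have : (1 + g / 300) ≤ (1 - g / 4 - g / 100) * (1 + g) := by nlinarith
      calc _ ≤ (1 - g / 4 - g / 100) * (1 + g) * lam s := mul_le_mul_of_nonneg_right this hls.le
        _ = (1 - g / 4 - g / 100) * ((1 + g) * lam s) := by ring
        _ ≤ _ := mul_le_mul_of_nonneg_left h4 (by linarith)
    linarith

lemma max_lam_mul_abs_inner_le (h : SpikedPerturbation m A P M lam y κ g η ρ)
    (e : IsEigenSystem A n ev u) (hn : Module.finrank ℝ E = n) (hmn : m ≤ n) {j s : ℕ}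
    (hj : j ∈ Finset.Icc 1 m) (hs : s ∈ Finset.Icc 1 m) (hsj : s ≠ j) :
    max (lam s) (lam j) * |⟪y s, u j⟫| ≤
      4 / g * ρ * (∑ t ∈ Finset.Icc 1 m, |lam t * ⟪y t, u j⟫| + lam m) := by
  have h1 := h.abs_eigen_inner e hn hmn hj hs
  rw [abs_mul] at h1
  have h2 := mul_le_mul_of_nonneg_right (h.max_lam_le_abs_sub e hn hmn hj hs hsj)
    (abs_nonneg ⟪y s, u j⟫)
  have hg := h.gap_pos
  have h3 := h2.trans h1
  calc _ = 4 / g * (g / 4 * max (lam s) (lam j) * |⟪y s, u j⟫|) := by field_simp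
    _ ≤ 4 / g * (ρ * (∑ t ∈ Finset.Icc 1 m, |lam t * ⟪y t, u j⟫| + lam m)) :=
        mul_le_mul_of_nonneg_left h3 (by positivity)
    _ = _ := by ring

/-- A bootstrap: the off-diagonal bound involves the very sum R being estimated, but with
coefficient 4mρ/g ≤ 1/2. From R ≤ 2 lam j + (R + lam m)/2, absorbing R leaves 4 lam j + lam m. -/
lemma sum_abs_le (h : SpikedPerturbation m A P M lam y κ g η ρ)
    (e : IsEigenSystem A n ev u) (hn : Module.finrank ℝ E = n) (hmn : m ≤ n) {j : ℕ}
    (hj : j ∈ Finset.Icc 1 m) :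
    ∑ t ∈ Finset.Icc 1 m, |lam t * ⟪y t, u j⟫| ≤ 5 * lam j := by
  set R := ∑ t ∈ Finset.Icc 1 m, |lam t * ⟪y t, u j⟫| with hR
  have hR0 : 0 ≤ R := Finset.sum_nonneg fun _ _ => abs_nonneg _
  have h1 : R ≤ 2 * lam j + m * (4 / g * ρ * (R + lam m)) := by
    nth_rw 1 [hR]
    rw [← Finset.add_sum_erase _ _ hj]
    refine add_le_add ?_ ?_
    · rw [abs_mul, abs_of_pos (h.lam_pos hj), mul_comm]
      exact mul_le_mul_of_nonneg_right (h.abs_inner_eigenvector_le e hmn hj hj) (h.lam_pos hj).le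
    · calc _ ≤ ∑ t ∈ (Finset.Icc 1 m).erase j, 4 / g * ρ * (R + lam m) := by
            refine Finset.sum_le_sum fun t ht => ?_
            have ht' := Finset.mem_erase.1 ht
            refine le_trans ?_ (h.max_lam_mul_abs_inner_le e hn hmn hj ht'.2 ht'.1)
            rw [abs_mul, abs_of_pos (h.lam_pos ht'.2)]
            exact mul_le_mul_of_nonneg_right (le_max_left _ _) (abs_nonneg _)
        _ ≤ _ := by
            rw [Finset.sum_const, nsmul_eq_mul]
            refine mul_le_mul_of_nonneg_right ?_ ?_
            · have := Finset.card_erase_le (s := Finset.Icc 1 m) (a := j)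
              simp only [Nat.card_Icc, Nat.add_sub_cancel] at this
              exact_mod_cast this
            · have := h.gap_pos; have := h.rho_nonneg; have := h.pos
              positivity
  have h2 : m * (4 / g * ρ) ≤ 1 / 2 := by
    have := h.mul_rho_le
    have hg := h.gap_pos
    rw [show m * (4 / g * ρ) = 4 * m * ρ / g by ring, div_le_iff₀ hg]
    have : 0 ≤ m * ρ := mul_nonneg (by positivity) h.rho_nonneg
    linarith
  have h3 : m * (4 / g * ρ * (R + lam m)) ≤ 1 / 2 * (R + lam m) := by
    rw [← mul_assoc]
    exact mul_le_mul_of_nonneg_right h2 (add_nonneg hR0 h.pos.le)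
  linarith [h.lam_le hj]

/-- Off-diagonal inner products of spike directions and eigenvectors. -/
lemma max_lam_mul_abs_inner_le' (h : SpikedPerturbation m A P M lam y κ g η ρ)
    (e : IsEigenSystem A n ev u) (hn : Module.finrank ℝ E = n) (hmn : m ≤ n) {j s : ℕ}
    (hj : j ∈ Finset.Icc 1 m) (hs : s ∈ Finset.Icc 1 m) (hsj : s ≠ j) :
    max (lam s) (lam j) * |⟪y s, u j⟫| ≤ 24 / g * ρ * lam j := by
  refine (h.max_lam_mul_abs_inner_le e hn hmn hj hs hsj).trans ?_
  have h1 := h.sum_abs_le e hn hmn hj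
  have := h.gap_pos
  have := h.rho_nonneg
  calc _ ≤ 4 / g * ρ * (5 * lam j + lam j) :=
        mul_le_mul_of_nonneg_left (add_le_add h1 (h.lam_le hj)) (by positivity)
    _ = _ := by ring

lemma abs_inner_le_of_ne (h : SpikedPerturbation m A P M lam y κ g η ρ)
    (e : IsEigenSystem A n ev u) (hn : Module.finrank ℝ E = n) (hmn : m ≤ n) {j s : ℕ}
    (hj : j ∈ Finset.Icc 1 m) (hs : s ∈ Finset.Icc 1 m) (hsj : s ≠ j) :
    |⟪y s, u j⟫| ≤ 24 / g * ρ := by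
  refine le_of_mul_le_mul_left ?_ (h.lam_pos hj)
  calc lam j * |⟪y s, u j⟫| ≤ max (lam s) (lam j) * |⟪y s, u j⟫| :=
        mul_le_mul_of_nonneg_right (le_max_right _ _) (abs_nonneg _)
    _ ≤ _ := h.max_lam_mul_abs_inner_le' e hn hmn hj hs hsj
    _ = _ := by ring

lemma abs_eigen_inner_self (h : SpikedPerturbation m A P M lam y κ g η ρ)
    (e : IsEigenSystem A n ev u) (hn : Module.finrank ℝ E = n) (hmn : m ≤ n) {j : ℕ}
    (hj : j ∈ Finset.Icc 1 m) :
    |(ev j - κ - lam j * ‖y j‖ ^ 2) * ⟪y j, u j⟫| ≤ 6 * ρ * lam j := by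
  refine (h.abs_eigen_inner e hn hmn hj hj).trans ?_
  have h1 := h.sum_abs_le e hn hmn hj
  calc _ ≤ ρ * (5 * lam j + lam j) :=
        mul_le_mul_of_nonneg_left (add_le_add h1 (h.lam_le hj)) h.rho_nonneg
    _ = _ := by ring

/-- The eigenvector is close to a multiple of the spike direction. -/
lemma norm_eigenvector_sub_le (h : SpikedPerturbation m A P M lam y κ g η ρ)
    (e : IsEigenSystem A n ev u) (hn : Module.finrank ℝ E = n) (hmn : m ≤ n) {j : ℕ}
    (hj : j ∈ Finset.Icc 1 m) :
    ‖u j - ⟪y j, u j⟫ • y j‖ ≤ 140 * m / g * ρ := by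
  set a := ⟪y j, u j⟫ with ha
  set w := u j - a • y j with hw
  have hg := h.gap_pos
  have hρ := h.rho_nonneg
  have hlj := h.lam_pos hj
  have ha2 : |a| ≤ 2 := h.abs_inner_eigenvector_le e hmn hj hj
  -- The residual w solves an equation whose right side is O(ρ lam j): the off-diagonal spikes, the
  -- defect of the eigenvalue along `y j`, and `M (y j)`. On the left, `M w` needs only the coarse
  -- bound η, since `ev j - κ` is comparable to `lam j`.
  have heq : (ev j - κ) • w - M w =
      ∑ s ∈ (Finset.Icc 1 m).erase j, (lam s * ⟪y s, u j⟫) • y s +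
        ((lam j - (ev j - κ)) * a) • y j + a • M (y j) := by
    have h1 := h.eigen_eq e hn hmn hj
    rw [← Finset.add_sum_erase _ _ hj] at h1
    rw [hw, smul_sub, h1, map_sub, map_smul, ← ha]
    module
  have hb1 : ‖∑ s ∈ (Finset.Icc 1 m).erase j, (lam s * ⟪y s, u j⟫) • y s‖ ≤
      m * (48 / g * ρ * lam j) := by
    refine (norm_sum_le _ _).trans ?_
    calc _ ≤ ∑ s ∈ (Finset.Icc 1 m).erase j, 48 / g * ρ * lam j := by
          refine Finset.sum_le_sum fun s hs => ?_
          have hs' := Finset.mem_erase.1 hs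
          have hls := h.lam_pos hs'.2
          rw [norm_smul, Real.norm_eq_abs, abs_mul, abs_of_pos hls]
          calc _ ≤ 24 / g * ρ * lam j * 2 :=
                mul_le_mul ((mul_le_mul_of_nonneg_right (le_max_left _ _) (abs_nonneg _)).trans
                  (h.max_lam_mul_abs_inner_le' e hn hmn hj hs'.2 hs'.1)) (h.norm_spike_le hs'.2)
                  (norm_nonneg _) (by positivity)
            _ = _ := by ring
      _ ≤ _ := by
          rw [Finset.sum_const, nsmul_eq_mul]
          refine mul_le_mul_of_nonneg_right ?_ (by positivity)
          have := Finset.card_erase_le (s := Finset.Icc 1 m) (a := j)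
          simp only [Nat.card_Icc, Nat.add_sub_cancel] at this
          exact_mod_cast this
  have hb2 : ‖((lam j - (ev j - κ)) * a) • y j‖ ≤ 16 * ρ * lam j := by
    have h1 := h.abs_eigen_inner_self e hn hmn hj
    rw [← ha] at h1
    have h2 : |(lam j - (ev j - κ)) * a| ≤ 8 * ρ * lam j := by
      have h3 : (lam j - (ev j - κ)) * a =
          -((ev j - κ - lam j * ‖y j‖ ^ 2) * a) - lam j * ((‖y j‖ ^ 2 - 1) * a) := by ring
      rw [h3]
      refine (abs_sub _ _).trans ?_
      rw [abs_neg, abs_mul (lam j), abs_mul (‖y j‖ ^ 2 - 1), abs_of_pos hlj]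
      have h4 : |‖y j‖ ^ 2 - 1| * |a| ≤ ρ * 2 :=
        mul_le_mul (h.norm_spike_sq hj) ha2 (abs_nonneg _) hρ
      have := mul_le_mul_of_nonneg_left h4 hlj.le
      linarith
    rw [norm_smul, Real.norm_eq_abs]
    calc _ ≤ 8 * ρ * lam j * 2 :=
          mul_le_mul h2 (h.norm_spike_le hj) (norm_nonneg _) (by positivity)
      _ = _ := by ring
  have hb3 : ‖a • M (y j)‖ ≤ 2 * ρ * lam j := by
    rw [norm_smul, Real.norm_eq_abs]
    calc _ ≤ 2 * (ρ * lam j) :=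
          mul_le_mul ha2 ((h.noise_spike_le j hj).trans
            (mul_le_mul_of_nonneg_left (h.lam_le hj) hρ)) (norm_nonneg _) (by norm_num)
      _ = _ := by ring
  have hup : ‖(ev j - κ) • w - M w‖ ≤ (m * (48 / g) + 18) * ρ * lam j := by
    rw [heq]
    refine (norm_add_le _ _).trans ((add_le_add ((norm_add_le _ _).trans
      (add_le_add hb1 hb2)) hb3).trans (le_of_eq (by ring)))
  have hlow : lam j / 2 * ‖w‖ ≤ ‖(ev j - κ) • w - M w‖ := by
    refine le_trans ?_ (norm_sub_norm_le _ _)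
    have h1 := (abs_le.1 (h.abs_eigenvalue_sub e hn hmn hj)).1
    have h2 : 99 / 100 * lam j ≤ ev j - κ := by nlinarith [h.gap_le]
    rw [norm_smul, Real.norm_eq_abs, abs_of_pos (by linarith)]
    have h3 := h.noise_le w
    have h4 : η * lam m ≤ 1 / 300 * lam j :=
      mul_le_mul (by linarith [h.eta_le, h.gap_le]) (h.lam_le hj) h.pos.le (by norm_num)
    nlinarith [norm_nonneg w]
  have hm := h.one_le_cast
  have hconst : (m * (48 / g) + 18) * 2 ≤ 140 * m / g := by
    rw [show (m * (48 / g) + 18) * 2 = (96 * m + 36 * g) / g by field_simp; ring]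
    gcongr
    linarith [h.gap_le]
  refine le_of_mul_le_mul_left ?_ hlj
  calc lam j * ‖w‖ = 2 * (lam j / 2 * ‖w‖) := by ring
    _ ≤ 2 * ((m * (48 / g) + 18) * ρ * lam j) := by linarith
    _ = (m * (48 / g) + 18) * 2 * (ρ * lam j) := by ring
    _ ≤ 140 * m / g * (ρ * lam j) := mul_le_mul_of_nonneg_right hconst (by positivity)
    _ = _ := by ring

/-- Both `u j` and `y j` have norm 1 up to O(ρ), and `u j` is nearly a multiple of `y j`, so the
multiple has modulus near 1. Its sign is settled later by the sign convention. -/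
lemma abs_abs_inner_sub_one_le (h : SpikedPerturbation m A P M lam y κ g η ρ)
    (e : IsEigenSystem A n ev u) (hn : Module.finrank ℝ E = n) (hmn : m ≤ n) {j : ℕ}
    (hj : j ∈ Finset.Icc 1 m) :
    |(|⟪y j, u j⟫|) - 1| ≤ 142 * m / g * ρ := by
  have h1 := h.norm_eigenvector_sub_le e hn hmn hj
  set a := ⟪y j, u j⟫ with ha
  have h2 := abs_norm_sub_norm_le (u j) (a • y j)
  rw [norm_eigenvector e hmn hj, norm_smul, Real.norm_eq_abs] at h2
  have ha2 : |a| ≤ 2 := h.abs_inner_eigenvector_le e hmn hj hj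
  have h3 : |a| - 1 = -(1 - |a| * ‖y j‖) - |a| * (‖y j‖ - 1) := by ring
  rw [h3]
  refine (abs_sub _ _).trans ?_
  rw [abs_neg, abs_mul, abs_abs]
  have h4 : |a| * |‖y j‖ - 1| ≤ 2 * ρ :=
    mul_le_mul ha2 (h.abs_norm_spike_sub hj) (abs_nonneg _) (by norm_num)
  have hg := h.gap_pos
  have h5 : 2 * ρ ≤ 2 * m / g * ρ := by
    refine mul_le_mul_of_nonneg_right ?_ h.rho_nonneg
    rw [le_div_iff₀ hg]
    nlinarith [h.one_le_cast, h.gap_le]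
  calc _ ≤ 140 * m / g * ρ + 2 * m / g * ρ := add_le_add (h2.trans h1) (h4.trans h5)
    _ = _ := by ring

/-- The eigenvalues, up to the shift, to first order. -/
lemma abs_eigenvalue_sub_le (h : SpikedPerturbation m A P M lam y κ g η ρ)
    (e : IsEigenSystem A n ev u) (hn : Module.finrank ℝ E = n) (hmn : m ≤ n) {j : ℕ}
    (hj : j ∈ Finset.Icc 1 m) : |ev j - κ - lam j| ≤ 13 * ρ * lam j := by
  have h1 := abs_le.1 (h.abs_abs_inner_sub_one_le e hn hmn hj)
  have h2 := h.abs_eigen_inner_self e hn hmn hj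
  set a := ⟪y j, u j⟫ with ha
  have hg := h.gap_pos
  have h3 : 142 * m / g * ρ ≤ 1 / 2 := by
    rw [div_mul_eq_mul_div, div_le_iff₀ hg]
    linarith [h.mul_rho_le, mul_nonneg (by positivity : (0 : ℝ) ≤ m) h.rho_nonneg]
  -- With the overlap bounded below, the diagonal eigenvalue equation can be divided by it.
  have ha1 : 1 / 2 ≤ |a| := by linarith
  rw [abs_mul] at h2
  have h4 : |ev j - κ - lam j * ‖y j‖ ^ 2| ≤ 12 * ρ * lam j := by
    nlinarith [abs_nonneg (ev j - κ - lam j * ‖y j‖ ^ 2)]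
  have h5 : ev j - κ - lam j = (ev j - κ - lam j * ‖y j‖ ^ 2) + lam j * (‖y j‖ ^ 2 - 1) := by ring
  rw [h5]
  refine (abs_add_le _ _).trans ?_
  rw [abs_mul, abs_of_pos (h.lam_pos hj)]
  have := mul_le_mul_of_nonneg_left (h.norm_spike_sq hj) (h.lam_pos hj).le
  linarith

end SpikedPerturbation

end Perturbation

/-! ### Removing the shift κ, and the error in a single coordinate. -/

section Residual

variable {E : Type*} [NormedAddCommGroup E] [InnerProductSpace ℝ E]

local notation "⟪" x ", " y "⟫" => inner ℝ x y

namespace SpikedPerturbation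

variable {m : ℕ} {A P M : E →ₗ[ℝ] E} {lam : ℕ → ℝ} {y : ℕ → E} {κ g η ρ : ℝ}
variable {n : ℕ} {ev : ℕ → ℝ} {u : ℕ → E}

/-- Summing ⟨u_s, A u_s⟩ and applying Bessel to the u_s keeps ‖y t‖² exactly. Adding up the
individual eigenvalue bounds would leave an error of order ρ lam 1, possibly far larger than lam j;
the exact terms instead cancel against the trace. -/
lemma sum_eigenvalue_le (h : SpikedPerturbation m A P M lam y κ g η ρ)
    (e : IsEigenSystem A n ev u) (hmn : m ≤ n) {j : ℕ} (hj : j ∈ Finset.Icc 1 m) :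
    ∑ s ∈ Finset.Icc 1 j, ev s ≤
      ∑ t ∈ Finset.Icc 1 m, lam t * ‖y t‖ ^ 2 + j * (κ + η * lam m) := by
  have hj' := Finset.mem_Icc.1 hj
  have ho := e.ortho.mono (hj'.2.trans hmn)
  have h1 : ∀ s ∈ Finset.Icc 1 j, ev s ≤
      ∑ t ∈ Finset.Icc 1 m, lam t * ⟪u s, y t⟫ ^ 2 + (κ + η * lam m) := by
    intro s hs
    have hsn : s ∈ Finset.Icc 1 n := Finset.Icc_subset_Icc le_rfl (hj'.2.trans hmn) hs
    have h2 := h.inner_apply (u s)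
    rw [e.eigen s hsn, real_inner_smul_right, real_inner_self_eq_norm_sq,
      ho.norm_eq_one hs] at h2
    have h3 := mul_le_mul_of_nonneg_left (h.inner_proj_le (u s)) h.shift_nonneg
    have h4 := (abs_le.1 (h.abs_inner_noise (u s))).2
    rw [ho.norm_eq_one hs] at h3 h4
    simp only [real_inner_comm (u s)] at h2 ⊢
    linarith
  refine (Finset.sum_le_sum h1).trans ?_
  rw [Finset.sum_add_distrib, Finset.sum_comm, Finset.sum_const, nsmul_eq_mul]
  simp only [Nat.card_Icc, Nat.add_sub_cancel]
  gcongr with t ht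
  rw [← Finset.mul_sum]
  exact mul_le_mul_of_nonneg_left (ho.sum_sq_le _) (h.lam_pos ht).le

variable [FiniteDimensional ℝ E]

/-- Ky Fan's inequality with an orthonormal basis of the span of y_1, …, y_j. Each of these y_t lies
in that span, so ∑_i ⟨y_t, q_i⟩² is exactly ‖y_t‖² and no Gram error appears. -/
lemma le_sum_eigenvalue (h : SpikedPerturbation m A P M lam y κ g η ρ)
    (e : IsEigenSystem A n ev u) (hn : Module.finrank ℝ E = n) (hmn : m ≤ n) {j : ℕ}
    (hj : j ∈ Finset.Icc 1 m) :
    ∑ t ∈ Finset.Icc 1 j, lam t * ‖y t‖ ^ 2 + j * (κ - η * lam m) ≤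
      ∑ s ∈ Finset.Icc 1 j, ev s := by
  have hj' := Finset.mem_Icc.1 hj
  have hsub : Finset.Icc 1 j ⊆ Finset.Icc 1 m := Finset.Icc_subset_Icc le_rfl hj'.2
  have hjn : j ∈ Finset.Icc 1 n := Finset.mem_Icc.2 ⟨hj'.1, hj'.2.trans hmn⟩
  have hjm : (j : ℝ) ≤ m := by exact_mod_cast hj'.2
  have hsmall : (j : ℝ) * ρ < 1 := by nlinarith [h.mul_rho_le, h.gap_le, h.rho_nonneg]
  obtain ⟨q, hq, hspan, hsq⟩ := (h.gram.subset hsub).exists_orthonormal hsmall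
  refine le_trans ?_ (e.sum_inner_apply_le hn hjn hq)
  have hP : ∀ i, P (q i) = q i := fun i => by
    have : Submodule.span ℝ (y '' Set.Icc 1 j) ≤ LinearMap.eqLocus P LinearMap.id := by
      rw [Submodule.span_le]
      rintro _ ⟨s, hs, rfl⟩
      exact h.proj_spike s (hsub (by simpa using hs))
    exact this (hspan i)
  have h1 : ∀ i, ∑ t ∈ Finset.Icc 1 j, lam t * ⟪y t, q i⟫ ^ 2 + (κ - η * lam m) ≤
      ⟪q i, A (q i)⟫ := fun i => by
    rw [h.inner_apply, hP, real_inner_self_eq_norm_sq, hq.1 i]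
    have h4 := (abs_le.1 (h.abs_inner_noise (q i))).1
    rw [hq.1 i] at h4
    have := Finset.sum_le_sum_of_subset_of_nonneg hsub
        (f := fun t => lam t * ⟪y t, q i⟫ ^ 2)
        fun s hs _ => mul_nonneg (h.lam_pos hs).le (sq_nonneg ⟪y s, q i⟫)
    linarith
  refine le_trans (le_of_eq ?_) (Finset.sum_le_sum fun i _ => h1 i)
  rw [Finset.sum_add_distrib, Finset.sum_comm, Finset.sum_const, nsmul_eq_mul]
  simp only [Finset.card_univ, Fintype.card_fin]
  congr 1
  refine Finset.sum_congr rfl fun t ht => ?_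
  rw [← Finset.mul_sum, hsq t ht]

/-- The noise-reduction eigenvalue is close to the spike. -/
lemma abs_noise_reduction_sub_le (h : SpikedPerturbation m A P M lam y κ g η ρ)
    (e : IsEigenSystem A n ev u) (hn : Module.finrank ℝ E = n) (hmn : 4 * m + 4 ≤ n) {j : ℕ}
    (hj : j ∈ Finset.Icc 1 m) {tr D : ℝ}
    (htr : |tr - ∑ t ∈ Finset.Icc 1 m, lam t * ‖y t‖ ^ 2 - (n - 1) * κ| ≤ D * lam m) :
    |ev j - (tr - ∑ s ∈ Finset.Icc 1 j, ev s) / ((n : ℝ) - (j : ℝ) - 1) - lam j| ≤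
      (13 * ρ + 2 * (5 * m + D) / n) * lam j := by
  have hj' := Finset.mem_Icc.1 hj
  have hmn' : m ≤ n := by omega
  have h1 := h.sum_eigenvalue_le e hmn' hj
  have h2 := h.le_sum_eigenvalue e hn hmn' hj
  have h3 := abs_le.1 htr
  have hlj := h.lam_pos hj
  have hlm := h.lam_le hj
  have hm1 := h.one_le_cast
  have hjm : (j : ℝ) ≤ m := by exact_mod_cast hj'.2
  have hη1 : η ≤ 1 := by linarith [h.eta_le, h.gap_le, h.eta_nonneg]
  have hnm : (4 : ℝ) * m + 4 ≤ n := by exact_mod_cast hmn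
  have hD : 0 ≤ D := by
    have := (abs_nonneg _).trans htr
    by_contra hD
    nlinarith [h.pos]
  -- After the cancellation of the first j spikes only later ones remain, each bounded through `lam
  -- j`.
  have hsplit : ∑ t ∈ Finset.Icc 1 m, lam t * ‖y t‖ ^ 2 - ∑ t ∈ Finset.Icc 1 j, lam t * ‖y t‖ ^ 2
      ≤ 4 * m * lam j := by
    rw [← Finset.sum_sdiff (Finset.Icc_subset_Icc le_rfl hj'.2 : Finset.Icc 1 j ⊆ Finset.Icc 1 m),
      add_sub_cancel_right]
    calc _ ≤ ∑ t ∈ Finset.Icc 1 m \ Finset.Icc 1 j, 4 * lam j := by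
          refine Finset.sum_le_sum fun t ht => ?_
          have ht' := Finset.mem_sdiff.1 ht
          have htm := Finset.mem_Icc.1 ht'.1
          have htj : j ≤ t := by
            by_contra hlt
            exact ht'.2 (Finset.mem_Icc.2 ⟨htm.1, by omega⟩)
          have ha := h.anti (by exact_mod_cast hj) (by exact_mod_cast ht'.1) htj
          have hy := h.norm_spike_le ht'.1
          have : ‖y t‖ ^ 2 ≤ 4 := by nlinarith [norm_nonneg (y t)]
          nlinarith [h.lam_pos ht'.1]
      _ ≤ m * (4 * lam j) := by
          rw [Finset.sum_const, nsmul_eq_mul]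
          refine mul_le_mul_of_nonneg_right ?_ (by linarith)
          have := Finset.card_le_card (Finset.sdiff_subset (s := Finset.Icc 1 m)
            (t := Finset.Icc 1 j))
          simp only [Nat.card_Icc, Nat.add_sub_cancel] at this
          exact_mod_cast this
      _ = _ := by ring
  have hnoise : j * (η * lam m) ≤ m * lam j :=
    mul_le_mul hjm (by nlinarith [h.eta_nonneg, h.pos]) (mul_nonneg h.eta_nonneg h.pos.le)
      (by linarith)
  have hDl : D * lam m ≤ D * lam j := mul_le_mul_of_nonneg_left hlm hD
  -- The trace holds (n − 1)κ and the j leading eigenvalues hold jκ, which accounts for the divisor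
  -- n − j − 1 in the estimator.
  have hres : |tr - ∑ s ∈ Finset.Icc 1 j, ev s - (n - j - 1) * κ| ≤ (5 * m + D) * lam j := by
    rw [abs_le]
    constructor
    · nlinarith
    · nlinarith
  have hden : (n : ℝ) / 2 ≤ (n : ℝ) - j - 1 := by linarith
  have hn0 : (0 : ℝ) < n := by linarith
  have hden0 : (0 : ℝ) < (n : ℝ) - j - 1 := by linarith
  have hquot : |(tr - ∑ s ∈ Finset.Icc 1 j, ev s) / ((n : ℝ) - j - 1) - κ| ≤
      2 * (5 * m + D) / n * lam j := by
    have : (tr - ∑ s ∈ Finset.Icc 1 j, ev s) / ((n : ℝ) - j - 1) - κ =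
        (tr - ∑ s ∈ Finset.Icc 1 j, ev s - (n - j - 1) * κ) / ((n : ℝ) - j - 1) := by
      field_simp
    rw [this, abs_div, abs_of_pos hden0]
    calc _ ≤ (5 * m + D) * lam j / ((n : ℝ) / 2) :=
          div_le_div₀ (by positivity) hres (by positivity) hden
      _ = _ := by field_simp
  have h5 := h.abs_eigenvalue_sub_le e hn hmn' hj
  have heq : ev j - (tr - ∑ s ∈ Finset.Icc 1 j, ev s) / ((n : ℝ) - (j : ℝ) - 1) - lam j =
      (ev j - κ - lam j) - ((tr - ∑ s ∈ Finset.Icc 1 j, ev s) / ((n : ℝ) - j - 1) - κ) := by ring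
  rw [heq, add_mul]
  exact (abs_sub _ _).trans (add_le_add h5 hquot)

lemma abs_sqrt_div_sub_one_le {a b ε : ℝ} (hb : 0 < b) (ha : 0 ≤ a) (h : |a - b| ≤ ε * b) :
    |Real.sqrt (a / b) - 1| ≤ ε := by
  set r := Real.sqrt (a / b) with hr
  have hr0 : 0 ≤ r := Real.sqrt_nonneg _
  have hr2 : r ^ 2 = a / b := Real.sq_sqrt (by positivity)
  have h1 : |r ^ 2 - 1| ≤ ε := by
    rw [hr2, div_sub_one hb.ne', abs_div, abs_of_pos hb, div_le_iff₀ hb]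
    exact h
  refine le_trans ?_ h1
  rw [show r ^ 2 - 1 = (r - 1) * (r + 1) by ring, abs_mul, abs_of_nonneg (by linarith : 0 ≤ r + 1)]
  nlinarith [abs_nonneg (r - 1)]

/-- The bound on one coordinate of the noise-reduction direction: the coordinate of the spike
direction `s` is `β s / √(lam s)` and the noise contributes `⟪x, u j⟫`. -/
lemma abs_coordinate_sub_le (h : SpikedPerturbation m A P M lam y κ g η ρ)
    (e : IsEigenSystem A n ev u) (hn : Module.finrank ℝ E = n) (hmn : m ≤ n) {j : ℕ}
    (hj : j ∈ Finset.Icc 1 m) (hsgn : 0 ≤ ⟪y j, u j⟫) {lt ρ' : ℝ}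
    (hlt : |lt - lam j| ≤ ρ' * lam j) (hρ' : ρ' ≤ 1 / 2) {β : ℕ → ℝ} {B : ℝ}
    (hβ : ∀ s ∈ Finset.Icc 1 m, |β s| ≤ B) {x : E} {K r : ℝ} (hx : ‖x‖ ≤ K)
    (hxy : |⟪x, y j⟫| ≤ r) :
    |(Real.sqrt lt)⁻¹ * (∑ s ∈ Finset.Icc 1 m, β s * ⟪y s, u j⟫ + ⟪x, u j⟫) -
        β j / Real.sqrt (lam j)| ≤
      2 * (B * (142 * m / g * ρ + ρ') + B * (24 * m / g * ρ) + 2 * r + K * (140 * m / g * ρ)) /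
        Real.sqrt (lam j) := by
  have hlj := h.lam_pos hj
  have hg := h.gap_pos
  have hρ := h.rho_nonneg
  have hlt2 := abs_le.1 hlt
  have hlt0 : lam j / 4 ≤ lt := by nlinarith
  have hltpos : 0 < lt := by linarith
  have hB : 0 ≤ B := (abs_nonneg _).trans (hβ j hj)
  have hK : 0 ≤ K := (norm_nonneg _).trans hx
  set a := ⟪y j, u j⟫ with ha
  have ha1 : |a - 1| ≤ 142 * m / g * ρ := by
    have := h.abs_abs_inner_sub_one_le e hn hmn hj
    rwa [← ha, abs_of_nonneg hsgn] at this
  have ha2 : |a| ≤ 2 := h.abs_inner_eigenvector_le e hmn hj hj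
  have hsq : |Real.sqrt (lt / lam j) - 1| ≤ ρ' := abs_sqrt_div_sub_one_le hlj hltpos.le hlt
  have hsl : 0 < Real.sqrt (lam j) := Real.sqrt_pos.2 hlj
  have hst : 0 < Real.sqrt lt := Real.sqrt_pos.2 hltpos
  have hst2 : Real.sqrt (lam j) / 2 ≤ Real.sqrt lt := by
    have : Real.sqrt (lam j / 4) = Real.sqrt (lam j) / 2 := by
      rw [Real.sqrt_div hlj.le, show (4 : ℝ) = 2 ^ 2 by norm_num, Real.sqrt_sq (by norm_num)]
    rw [← this]
    exact Real.sqrt_le_sqrt hlt0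
  have hinv : (Real.sqrt lt)⁻¹ ≤ 2 / Real.sqrt (lam j) := by
    rw [inv_le_comm₀ hst (by positivity), inv_div]
    exact hst2
  set w := u j - a • y j with hw
  have hwn : ‖w‖ ≤ 140 * m / g * ρ := h.norm_eigenvector_sub_le e hn hmn hj
  -- The noise coordinate is paired with `y j`, where cancellation over the sample is available, and
  -- with the short residual w, where only the norm of `x` is used.
  have hxu : ⟪x, u j⟫ = a * ⟪x, y j⟫ + ⟪x, w⟫ := by
    rw [hw, inner_sub_right, real_inner_smul_right]; ring
  have hsplit : (Real.sqrt lt)⁻¹ * (∑ s ∈ Finset.Icc 1 m, β s * ⟪y s, u j⟫ + ⟪x, u j⟫) -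
      β j / Real.sqrt (lam j) = (Real.sqrt lt)⁻¹ * (β j * ((a - 1) - (Real.sqrt (lt / lam j) - 1)) +
        ∑ s ∈ (Finset.Icc 1 m).erase j, β s * ⟪y s, u j⟫ + a * ⟪x, y j⟫ + ⟪x, w⟫) := by
    rw [← Finset.add_sum_erase _ _ hj, hxu, ← ha, Real.sqrt_div hltpos.le]
    field_simp
    ring
  have hb1 : |β j * ((a - 1) - (Real.sqrt (lt / lam j) - 1))| ≤ B * (142 * m / g * ρ + ρ') := by
    rw [abs_mul]
    exact mul_le_mul (hβ j hj) ((abs_sub _ _).trans (add_le_add ha1 hsq)) (abs_nonneg _) hB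
  have hb2 : |∑ s ∈ (Finset.Icc 1 m).erase j, β s * ⟪y s, u j⟫| ≤ B * (24 * m / g * ρ) := by
    refine (Finset.abs_sum_le_sum_abs _ _).trans ?_
    calc _ ≤ ∑ s ∈ (Finset.Icc 1 m).erase j, B * (24 / g * ρ) := by
          refine Finset.sum_le_sum fun s hs => ?_
          have hs' := Finset.mem_erase.1 hs
          rw [abs_mul]
          exact mul_le_mul (hβ s hs'.2) (h.abs_inner_le_of_ne e hn hmn hj hs'.2 hs'.1)
            (abs_nonneg _) hB
      _ ≤ m * (B * (24 / g * ρ)) := by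
          rw [Finset.sum_const, nsmul_eq_mul]
          refine mul_le_mul_of_nonneg_right ?_ (by positivity)
          have := Finset.card_erase_le (s := Finset.Icc 1 m) (a := j)
          simp only [Nat.card_Icc, Nat.add_sub_cancel] at this
          exact_mod_cast this
      _ = _ := by ring
  have hb3 : |a * ⟪x, y j⟫| ≤ 2 * r := by
    rw [abs_mul]
    exact mul_le_mul ha2 hxy (abs_nonneg _) (by norm_num)
  have hb4 : |⟪x, w⟫| ≤ K * (140 * m / g * ρ) :=
    (abs_real_inner_le_norm _ _).trans (mul_le_mul hx hwn (norm_nonneg _) hK)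
  rw [hsplit, abs_mul, abs_of_pos (inv_pos.2 hst)]
  have hin := ((abs_add_le _ _).trans (add_le_add ((abs_add_le _ _).trans
    (add_le_add ((abs_add_le _ _).trans (add_le_add hb1 hb2)) hb3)) hb4))
  refine (mul_le_mul hinv hin (abs_nonneg _) (by positivity)).trans (le_of_eq ?_)
  ring

end SpikedPerturbation

end Residual

/-! ### Moments of products over distinct independent rows. -/

section HasMean

variable {Ω : Type*} [MeasurableSpace Ω] {P : Measure Ω}

/-- `f` is integrable with integral `c`. -/
def HasMean (P : Measure Ω) (f : Ω → ℝ) (c : ℝ) : Prop := Integrable f P ∧ ∫ ω, f ω ∂P = c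

namespace HasMean

lemma congr {f f' : Ω → ℝ} {c c' : ℝ} (h : HasMean P f c) (hf : ∀ ω, f' ω = f ω) (hc : c' = c) :
    HasMean P f' c' := by
  obtain rfl : f' = f := funext hf
  rwa [hc]

lemma sum {ι : Type*} {T : Finset ι} {F : ι → Ω → ℝ} {c : ι → ℝ}
    (h : ∀ s ∈ T, HasMean P (F s) (c s)) :
    HasMean P (fun ω => ∑ s ∈ T, F s ω) (∑ s ∈ T, c s) :=
  ⟨integrable_finsetSum _ fun s hs => (h s hs).1, by
    rw [integral_finsetSum _ fun s hs => (h s hs).1]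
    exact Finset.sum_congr rfl fun s hs => (h s hs).2⟩

lemma const_mul {f : Ω → ℝ} {c : ℝ} (h : HasMean P f c) (a : ℝ) :
    HasMean P (fun ω => a * f ω) (a * c) :=
  ⟨h.1.const_mul a, by rw [integral_const_mul, h.2]⟩

lemma add {f g : Ω → ℝ} {a b : ℝ} (hf : HasMean P f a) (hg : HasMean P g b) :
    HasMean P (fun ω => f ω + g ω) (a + b) :=
  ⟨hf.1.add hg.1, by rw [integral_add hf.1 hg.1, hf.2, hg.2]⟩

lemma sub {f g : Ω → ℝ} {a b : ℝ} (hf : HasMean P f a) (hg : HasMean P g b) :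
    HasMean P (fun ω => f ω - g ω) (a - b) :=
  ⟨hf.1.sub hg.1, by rw [integral_sub hf.1 hg.1, hf.2, hg.2]⟩

lemma const [IsProbabilityMeasure P] (a : ℝ) : HasMean P (fun _ => a) a :=
  ⟨integrable_const a, by simp⟩

end HasMean

variable {n : ℕ} {𝓧 : Type*} [MeasurableSpace 𝓧] {Y : Fin n → Ω → 𝓧} {f g h l : 𝓧 → ℝ}
  {a b c e : ℝ}

lemma HasMean.mul_two (hY : iIndepFun Y P) {i j : Fin n} (hij : i ≠ j) (hf : Measurable f)
    (hg : Measurable g) (hi : HasMean P (fun ω => f (Y i ω)) a)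
    (hj : HasMean P (fun ω => g (Y j ω)) b) :
    HasMean P (fun ω => f (Y i ω) * g (Y j ω)) (a * b) := by
  have hind : IndepFun (fun ω => f (Y i ω)) (fun ω => g (Y j ω)) P :=
    (hY.indepFun hij).comp hf hg
  refine ⟨hind.integrable_mul hi.1 hj.1, ?_⟩
  rw [hind.integral_fun_mul_eq_mul_integral hi.1.1 hj.1.1, hi.2, hj.2]

lemma HasMean.mul_three (hY : iIndepFun Y P) (hm : ∀ i, Measurable (Y i)) {i j k : Fin n}
    (hij : i ≠ j) (hik : i ≠ k) (hjk : j ≠ k) (hf : Measurable f) (hg : Measurable g)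
    (hh : Measurable h) (hi : HasMean P (fun ω => f (Y i ω)) a)
    (hj : HasMean P (fun ω => g (Y j ω)) b) (hk : HasMean P (fun ω => h (Y k ω)) c) :
    HasMean P (fun ω => f (Y i ω) * g (Y j ω) * h (Y k ω)) (a * b * c) := by
  have h2 := HasMean.mul_two hY hij hf hg hi hj
  have hind : IndepFun (fun ω => f (Y i ω) * g (Y j ω)) (fun ω => h (Y k ω)) P :=
    (hY.indepFun_prodMk hm i j k hik hjk).comp
      (φ := fun p : 𝓧 × 𝓧 => f p.1 * g p.2) (by fun_prop) hh
  refine ⟨hind.integrable_mul h2.1 hk.1, ?_⟩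
  rw [hind.integral_fun_mul_eq_mul_integral h2.1.1 hk.1.1, h2.2, hk.2]

lemma HasMean.mul_four (hY : iIndepFun Y P) (hm : ∀ i, Measurable (Y i)) {i j k q : Fin n}
    (hij : i ≠ j) (hik : i ≠ k) (hiq : i ≠ q) (hjk : j ≠ k) (hjq : j ≠ q) (hkq : k ≠ q)
    (hf : Measurable f) (hg : Measurable g) (hh : Measurable h) (hl : Measurable l)
    (hi : HasMean P (fun ω => f (Y i ω)) a) (hj : HasMean P (fun ω => g (Y j ω)) b)
    (hk : HasMean P (fun ω => h (Y k ω)) c) (hq : HasMean P (fun ω => l (Y q ω)) e) :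
    HasMean P (fun ω => f (Y i ω) * g (Y j ω) * (h (Y k ω) * l (Y q ω))) (a * b * (c * e)) := by
  have h2 := HasMean.mul_two hY hij hf hg hi hj
  have h3 := HasMean.mul_two hY hkq hh hl hk hq
  have hind : IndepFun (fun ω => f (Y i ω) * g (Y j ω)) (fun ω => h (Y k ω) * l (Y q ω)) P :=
    (hY.indepFun_prodMk_prodMk hm i j k q hik hiq hjk hjq).comp
      (φ := fun p : 𝓧 × 𝓧 => f p.1 * g p.2) (ψ := fun p : 𝓧 × 𝓧 => h p.1 * l p.2)
      (by fun_prop) (by fun_prop)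
  refine ⟨hind.integrable_mul h2.1 h3.1, ?_⟩
  rw [hind.integral_fun_mul_eq_mul_integral h2.1.1 h3.1.1, h2.2, h3.2]

/-- The second moment of a sum of independent centred variables. -/
lemma HasMean.sq_sum_le (hY : iIndepFun Y P) (hf : Measurable f)
    (hmean : ∀ i, HasMean P (fun ω => f (Y i ω)) 0) {v : ℝ}
    (hsq : ∀ i, Integrable (fun ω => f (Y i ω) ^ 2) P ∧ ∫ ω, f (Y i ω) ^ 2 ∂P ≤ v) :
    Integrable (fun ω => (∑ i, f (Y i ω)) ^ 2) P ∧ ∫ ω, (∑ i, f (Y i ω)) ^ 2 ∂P ≤ n * v := by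
  have h1 : ∀ i ∈ Finset.univ, ∀ k ∈ Finset.univ, HasMean P (fun ω => f (Y i ω) * f (Y k ω))
      (if i = k then ∫ ω, f (Y i ω) ^ 2 ∂P else 0) := by
    intro i _ k _
    split_ifs with hik
    · subst hik
      exact HasMean.congr ⟨(hsq i).1, rfl⟩ (fun ω => by ring) rfl
    · exact (HasMean.mul_two hY hik hf hf (hmean i) (hmean k)).congr (fun _ => rfl) (by ring)
  have h2 := HasMean.sum fun i hi => HasMean.sum (h1 i hi)
  have h3 := h2.congr (f' := fun ω => (∑ i, f (Y i ω)) ^ 2)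
    (fun ω => by rw [sq, Finset.sum_mul_sum]) rfl
  refine ⟨h3.1, h3.2.trans_le ?_⟩
  simp only [Finset.sum_ite_eq, Finset.mem_univ, if_true]
  calc _ ≤ ∑ i : Fin n, v := Finset.sum_le_sum fun i _ => (hsq i).2
    _ = _ := by simp

end HasMean

/-! ### Fourth-order moments of the off-diagonal Gram matrix. -/

section OffDiagGram

variable {Ω : Type*} {n : ℕ} {Y : Fin n → Ω → ℕ → ℝ} {N : Finset ℕ}

/-- The Gram matrix of the scores in `N`, with the diagonal removed. -/
noncomputable def offDiagGram (Y : Fin n → Ω → ℕ → ℝ) (N : Finset ℕ) (ω : Ω) (i k : Fin n) : ℝ :=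
  if i = k then 0 else ∑ s ∈ N, Y i ω s * Y k ω s

lemma offDiagGram_of_ne {ω : Ω} {i k : Fin n} (hik : i ≠ k) :
    offDiagGram Y N ω i k = ∑ s ∈ N, Y i ω s * Y k ω s := if_neg hik

lemma offDiagGram_self {ω : Ω} {i : Fin n} : offDiagGram Y N ω i i = 0 := if_pos rfl

lemma offDiagGram_comm {ω : Ω} {i k : Fin n} :
    offDiagGram Y N ω i k = offDiagGram Y N ω k i := by
  by_cases hik : i = k
  · subst hik; rfl
  · rw [offDiagGram_of_ne hik, offDiagGram_of_ne (Ne.symm hik)]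
    exact Finset.sum_congr rfl fun s _ => mul_comm _ _

end OffDiagGram

section Scores

variable {Ω : Type*} [MeasurableSpace Ω]

/-- Independent rows of uncorrelated scores `Y i s`, `s ∈ T`, of variance `lam s`, whose mixed
moments up to order four behave as those of independent scores. -/
structure IsScoreFamily (P : Measure Ω) {n : ℕ} (Y : Fin n → Ω → ℕ → ℝ) (T : Finset ℕ)
    (lam : ℕ → ℝ) (K : ℝ) : Prop where
  meas : ∀ i, Measurable (Y i)
  indep : iIndepFun Y P
  memLp : ∀ i, ∀ s ∈ T, MemLp (fun ω => Y i ω s) 4 P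
  mean : ∀ i, ∀ s ∈ T, ∫ ω, Y i ω s ∂P = 0
  cov : ∀ i, ∀ s ∈ T, ∀ t ∈ T, ∫ ω, Y i ω s * Y i ω t ∂P = if s = t then lam s else 0
  sq_sq : ∀ i, ∀ s ∈ T, ∀ t ∈ T, s ≠ t →
    ∫ ω, Y i ω s ^ 2 * Y i ω t ^ 2 ∂P = lam s * lam t
  four_le : ∀ i, ∀ s ∈ T, ∫ ω, Y i ω s ^ 4 ∂P ≤ K * lam s ^ 2
  four_eq_zero : ∀ i, ∀ s₁ ∈ T, ∀ s₂ ∈ T, ∀ s₃ ∈ T, ∀ s₄ ∈ T, s₁ ≠ s₂ → s₁ ≠ s₃ → s₁ ≠ s₄ →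
    ∫ ω, Y i ω s₁ * Y i ω s₂ * Y i ω s₃ * Y i ω s₄ ∂P = 0
  nonneg : ∀ s ∈ T, 0 ≤ lam s
  one_le : 1 ≤ K

namespace IsScoreFamily

variable {P : Measure Ω} {n : ℕ} {Y : Fin n → Ω → ℕ → ℝ}
  {T N : Finset ℕ} {lam : ℕ → ℝ} {K : ℝ}

lemma memLp_mul (h : IsScoreFamily P Y T lam K) (i : Fin n) {s t : ℕ} (hs : s ∈ T) (ht : t ∈ T) :
    MemLp (fun ω => Y i ω s * Y i ω t) 2 P := by
  have : ENNReal.HolderTriple 4 4 2 := ⟨by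
    rw [show (4 : ENNReal) = 2 * 2 by norm_num,
      ENNReal.mul_inv (Or.inl (by norm_num)) (Or.inl (by norm_num)), ← mul_add,
      ENNReal.inv_two_add_inv_two, mul_one]⟩
  exact (h.memLp i t ht).mul (h.memLp i s hs)

lemma integrable_four (h : IsScoreFamily P Y T lam K) (i : Fin n) {s t u v : ℕ} (hs : s ∈ T)
    (ht : t ∈ T) (hu : u ∈ T) (hv : v ∈ T) :
    Integrable (fun ω => Y i ω s * Y i ω t * Y i ω u * Y i ω v) P := by
  refine ((h.memLp_mul i hs ht).integrable_mul (h.memLp_mul i hu hv)).congr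
    (ae_of_all _ fun ω => ?_)
  simp only [Pi.mul_apply]
  ring

/-- The mixed fourth moments. -/
noncomputable def fourth (P : Measure Ω) (Y : Fin n → Ω → ℕ → ℝ) (i : Fin n) (s t u v : ℕ) : ℝ :=
  ∫ ω, Y i ω s * Y i ω t * Y i ω u * Y i ω v ∂P

lemma hasMean_four (h : IsScoreFamily P Y T lam K) (i : Fin n) {s t u v : ℕ} (hs : s ∈ T)
    (ht : t ∈ T) (hu : u ∈ T) (hv : v ∈ T) :
    HasMean P (fun ω => Y i ω s * Y i ω t * Y i ω u * Y i ω v) (fourth P Y i s t u v) :=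
  ⟨h.integrable_four i hs ht hu hv, rfl⟩

lemma fourth_self_self (h : IsScoreFamily P Y T lam K) (i : Fin n) {s t : ℕ} (hs : s ∈ T)
    (ht : t ∈ T) : 0 ≤ fourth P Y i s s t t ∧ fourth P Y i s s t t ≤ K * (lam s * lam t) := by
  have heq : fourth P Y i s s t t = ∫ ω, Y i ω s ^ 2 * Y i ω t ^ 2 ∂P := by
    unfold fourth
    congr 1; ext ω; ring
  refine ⟨heq ▸ integral_nonneg fun ω => by positivity, ?_⟩
  by_cases hst : s = t
  · subst hst
    refine le_trans (le_of_eq ?_) ((h.four_le i s hs).trans (le_of_eq (by ring)))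
    rw [heq]
    congr 1; ext ω; ring
  · rw [heq, h.sq_sq i s hs t ht hst]
    exact le_mul_of_one_le_left (mul_nonneg (h.nonneg s hs) (h.nonneg t ht)) h.one_le

lemma fourth_self_self_of_ne (h : IsScoreFamily P Y T lam K) (i : Fin n) {s t : ℕ} (hs : s ∈ T)
    (ht : t ∈ T) (hst : s ≠ t) : fourth P Y i s s t t = lam s * lam t := by
  rw [← h.sq_sq i s hs t ht hst]
  unfold fourth
  congr 1; ext ω; ring

lemma fourth_perm (i : Fin n) (s t u v : ℕ) :
    fourth P Y i s t u v = fourth P Y i t s u v ∧ fourth P Y i s t u v = fourth P Y i u t s v ∧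
      fourth P Y i s t u v = fourth P Y i v t u s := by
  refine ⟨?_, ?_, ?_⟩ <;> (unfold fourth; congr 1; ext ω; ring)

/-- A mixed fourth moment vanishes as soon as one index occurs only once, so just the three pairings
survive. The square is what is needed for the product of such moments over two rows. -/
lemma fourth_sq_le (h : IsScoreFamily P Y T lam K) (i : Fin n) {s t u v : ℕ} (hs : s ∈ T)
    (ht : t ∈ T) (hu : u ∈ T) (hv : v ∈ T) : fourth P Y i s t u v ^ 2 ≤
      K ^ 2 * ((if s = t then if u = v then lam s ^ 2 * lam u ^ 2 else 0 else 0) +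
        (if s = u then if t = v then lam s ^ 2 * lam t ^ 2 else 0 else 0) +
        (if s = v then if t = u then lam s ^ 2 * lam t ^ 2 else 0 else 0)) := by
  have hK : 0 ≤ K ^ 2 := sq_nonneg K
  have hpair : ∀ a ∈ T, ∀ b ∈ T, fourth P Y i a a b b ^ 2 ≤ K ^ 2 * (lam a ^ 2 * lam b ^ 2) := by
    intro a ha b hb
    obtain ⟨h0, h1⟩ := h.fourth_self_self i ha hb
    calc _ ≤ (K * (lam a * lam b)) ^ 2 := pow_le_pow_left₀ h0 h1 2
      _ = _ := by ring
  have hnn : ∀ (p q : Prop) [Decidable p] [Decidable q] (a b : ℕ),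
      0 ≤ if p then if q then lam a ^ 2 * lam b ^ 2 else 0 else 0 := by
    intro p q _ _ a b
    split_ifs <;> positivity
  have hzero : fourth P Y i s t u v = 0 → fourth P Y i s t u v ^ 2 ≤
      K ^ 2 * ((if s = t then if u = v then lam s ^ 2 * lam u ^ 2 else 0 else 0) +
        (if s = u then if t = v then lam s ^ 2 * lam t ^ 2 else 0 else 0) +
        (if s = v then if t = u then lam s ^ 2 * lam t ^ 2 else 0 else 0)) := by
    intro h0
    rw [h0]
    have h1 := hnn (s = t) (u = v) s u
    have h2 := hnn (s = u) (t = v) s t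
    have h3 := hnn (s = v) (t = u) s t
    have : (0 : ℝ) ^ 2 = 0 := by norm_num
    rw [this]
    positivity
  -- `four_eq_zero` expects the unpaired index in first place; these permutations bring it there.
  obtain ⟨p1, p2, p3⟩ := fourth_perm (P := P) (Y := Y) i s t u v
  by_cases hst : s = t
  · by_cases huv : u = v
    · subst hst huv
      refine (hpair s hs u hu).trans (mul_le_mul_of_nonneg_left ?_ hK)
      rw [if_pos rfl, if_pos rfl]
      linarith [hnn (s = u) (s = u) s s]
    · apply hzero
      subst hst
      by_cases hsu : s = u
      · rw [p3]
        exact h.four_eq_zero i v hv s hs u hu s hs (by rintro rfl; exact huv hsu.symm)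
          (Ne.symm huv) (by rintro rfl; exact huv hsu.symm)
      · rw [p2]
        exact h.four_eq_zero i u hu s hs s hs v hv (Ne.symm hsu) (Ne.symm hsu) huv
  · by_cases hsu : s = u
    · by_cases htv : t = v
      · subst hsu htv
        have : fourth P Y i s t s t = fourth P Y i s s t t := by
          unfold fourth; congr 1; ext ω; ring
        rw [this]
        refine (hpair s hs t ht).trans (mul_le_mul_of_nonneg_left ?_ hK)
        rw [if_neg hst, if_pos rfl, if_pos rfl, if_neg hst]
        linarith
      · apply hzero
        subst hsu
        rw [p1]
        exact h.four_eq_zero i t ht s hs s hs v hv (Ne.symm hst) (Ne.symm hst) htv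
    · by_cases hsv : s = v
      · by_cases htu : t = u
        · subst hsv htu
          have : fourth P Y i s t t s = fourth P Y i s s t t := by
            unfold fourth; congr 1; ext ω; ring
          rw [this]
          refine (hpair s hs t ht).trans (mul_le_mul_of_nonneg_left ?_ hK)
          simp only [if_neg hst, if_true]
          linarith
        · apply hzero
          subst hsv
          rw [p1]
          exact h.four_eq_zero i t ht s hs u hu s hs (Ne.symm hst) htu (Ne.symm hst)
      · apply hzero
        exact h.four_eq_zero i s hs t ht u hu v hv hst hsu hsv

lemma sum_mul_sum_four (a b c e : ℕ → ℝ) :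
    (∑ s ∈ N, a s) * (∑ s ∈ N, b s) * ((∑ s ∈ N, c s) * ∑ s ∈ N, e s) =
      ∑ s ∈ N, ∑ t ∈ N, ∑ u ∈ N, ∑ v ∈ N, a s * b t * (c u * e v) := by
  rw [Finset.sum_mul_sum, Finset.sum_mul_sum, Finset.sum_mul]
  simp only [Finset.sum_mul, Finset.mul_sum]
  refine Finset.sum_congr rfl fun s _ => ?_
  rw [Finset.sum_comm]
  refine (Finset.sum_congr rfl fun u _ => Finset.sum_comm).trans ?_
  rw [Finset.sum_comm]
  exact Finset.sum_congr rfl fun t _ => Finset.sum_comm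

/-- In the expansion the expectation factors over the two rows into a product of mixed fourth
moments, bounded by the squares through 2ab ≤ a² + b². Each of the three pairings sums to (∑ lam
s²)². -/
lemma offDiagGram_pow_four (h : IsScoreFamily P Y T lam K) (hN : N ⊆ T) {i k : Fin n}
    (hik : i ≠ k) :
    Integrable (fun ω => offDiagGram Y N ω i k ^ 4) P ∧
      ∫ ω, offDiagGram Y N ω i k ^ 4 ∂P ≤ 3 * K ^ 2 * (∑ s ∈ N, lam s ^ 2) ^ 2 := by
  have h1 : HasMean P (fun ω => offDiagGram Y N ω i k ^ 4)
      (∑ s ∈ N, ∑ t ∈ N, ∑ u ∈ N, ∑ v ∈ N, fourth P Y i s t u v * fourth P Y k s t u v) := by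
    refine HasMean.congr (HasMean.sum fun s hs => HasMean.sum fun t ht => HasMean.sum fun u hu =>
      HasMean.sum fun v hv => HasMean.mul_two h.indep hik
        (f := fun x => x s * x t * x u * x v) (g := fun x => x s * x t * x u * x v)
        (by fun_prop) (by fun_prop)
        (h.hasMean_four i (hN hs) (hN ht) (hN hu) (hN hv))
        (h.hasMean_four k (hN hs) (hN ht) (hN hu) (hN hv))) (fun ω => ?_) rfl
    rw [offDiagGram_of_ne hik, show ∀ x : ℝ, x ^ 4 = x * x * (x * x) from fun x => by ring,
      sum_mul_sum_four]
    refine Finset.sum_congr rfl fun s _ => Finset.sum_congr rfl fun t _ =>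
      Finset.sum_congr rfl fun u _ => Finset.sum_congr rfl fun v _ => by ring
  refine ⟨h1.1, h1.2.trans_le ?_⟩
  calc _ ≤ ∑ s ∈ N, ∑ t ∈ N, ∑ u ∈ N, ∑ v ∈ N,
        K ^ 2 * ((if s = t then if u = v then lam s ^ 2 * lam u ^ 2 else 0 else 0) +
        (if s = u then if t = v then lam s ^ 2 * lam t ^ 2 else 0 else 0) +
        (if s = v then if t = u then lam s ^ 2 * lam t ^ 2 else 0 else 0)) := by
        refine Finset.sum_le_sum fun s hs => Finset.sum_le_sum fun t ht =>
          Finset.sum_le_sum fun u hu => Finset.sum_le_sum fun v hv => ?_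
        have h2 := h.fourth_sq_le i (hN hs) (hN ht) (hN hu) (hN hv)
        have h3 := h.fourth_sq_le k (hN hs) (hN ht) (hN hu) (hN hv)
        nlinarith [sq_nonneg (fourth P Y i s t u v - fourth P Y k s t u v)]
    _ = 3 * K ^ 2 * (∑ s ∈ N, lam s ^ 2) ^ 2 := by
        have e1 : ∑ s ∈ N, ∑ t ∈ N, ∑ u ∈ N, ∑ v ∈ N,
            (if s = t then if u = v then lam s ^ 2 * lam u ^ 2 else 0 else 0) =
              (∑ s ∈ N, lam s ^ 2) ^ 2 := by
          rw [sq, Finset.sum_mul_sum]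
          refine Finset.sum_congr rfl fun s hs => ?_
          rw [Finset.sum_comm]
          refine Finset.sum_congr rfl fun u hu => ?_
          simp only [Finset.sum_ite_irrel, Finset.sum_const_zero, Finset.sum_ite_eq, hs, hu, if_true]
        have e2 : ∑ s ∈ N, ∑ t ∈ N, ∑ u ∈ N, ∑ v ∈ N,
            (if s = u then if t = v then lam s ^ 2 * lam t ^ 2 else 0 else 0) =
              (∑ s ∈ N, lam s ^ 2) ^ 2 := by
          rw [sq, Finset.sum_mul_sum]
          refine Finset.sum_congr rfl fun s hs => Finset.sum_congr rfl fun t ht => ?_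
          simp only [Finset.sum_ite_irrel, Finset.sum_const_zero, Finset.sum_ite_eq, hs, ht, if_true]
        have e3 : ∑ s ∈ N, ∑ t ∈ N, ∑ u ∈ N, ∑ v ∈ N,
            (if s = v then if t = u then lam s ^ 2 * lam t ^ 2 else 0 else 0) =
              (∑ s ∈ N, lam s ^ 2) ^ 2 := by
          rw [sq, Finset.sum_mul_sum]
          refine Finset.sum_congr rfl fun s hs => Finset.sum_congr rfl fun t ht => ?_
          simp only [Finset.sum_ite_eq, hs, ht, if_true]
        simp only [← Finset.mul_sum, Finset.sum_add_distrib, e1, e2, e3]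
        ring

variable [IsProbabilityMeasure P]

lemma hasMean (h : IsScoreFamily P Y T lam K) (i : Fin n) {s : ℕ} (hs : s ∈ T) :
    HasMean P (fun ω => Y i ω s) 0 :=
  ⟨(h.memLp i s hs).integrable (by norm_num), h.mean i s hs⟩

lemma hasMean_two (h : IsScoreFamily P Y T lam K) (i : Fin n) {s t : ℕ} (hs : s ∈ T)
    (ht : t ∈ T) : HasMean P (fun ω => Y i ω s * Y i ω t) (if s = t then lam s else 0) :=
  ⟨(h.memLp_mul i hs ht).integrable (by norm_num), h.cov i s hs t ht⟩

/-- The outer rows i and k occur only quadratically and force s = t and u = v, leaving a paired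
fourth moment of the common row j. -/
lemma offDiagGram_sq_mul_sq (h : IsScoreFamily P Y T lam K) (hN : N ⊆ T) {i j k : Fin n}
    (hij : i ≠ j) (hik : i ≠ k) (hjk : j ≠ k) :
    Integrable (fun ω => offDiagGram Y N ω j i ^ 2 * offDiagGram Y N ω j k ^ 2) P ∧
      ∫ ω, offDiagGram Y N ω j i ^ 2 * offDiagGram Y N ω j k ^ 2 ∂P ≤
        K * (∑ s ∈ N, lam s ^ 2) ^ 2 := by
  have h1 : HasMean P (fun ω => offDiagGram Y N ω j i ^ 2 * offDiagGram Y N ω j k ^ 2)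
      (∑ s ∈ N, ∑ t ∈ N, ∑ u ∈ N, ∑ v ∈ N, (if s = t then lam s else 0) *
        fourth P Y j s t u v * (if u = v then lam u else 0)) := by
    refine HasMean.congr (HasMean.sum fun s hs => HasMean.sum fun t ht => HasMean.sum fun u hu =>
      HasMean.sum fun v hv => HasMean.mul_three h.indep h.meas hij hik hjk
        (f := fun x => x s * x t) (g := fun x => x s * x t * x u * x v) (h := fun x => x u * x v)
        (by fun_prop) (by fun_prop) (by fun_prop)
        (h.hasMean_two i (hN hs) (hN ht)) (h.hasMean_four j (hN hs) (hN ht) (hN hu) (hN hv))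
        (h.hasMean_two k (hN hu) (hN hv))) (fun ω => ?_) rfl
    rw [offDiagGram_of_ne hij.symm, offDiagGram_of_ne hjk, sq, sq, sum_mul_sum_four]
    refine Finset.sum_congr rfl fun s _ => Finset.sum_congr rfl fun t _ =>
      Finset.sum_congr rfl fun u _ => Finset.sum_congr rfl fun v _ => by ring
  refine ⟨h1.1, h1.2.trans_le ?_⟩
  have e1 : ∑ s ∈ N, ∑ t ∈ N, ∑ u ∈ N, ∑ v ∈ N, (if s = t then lam s else 0) *
        fourth P Y j s t u v * (if u = v then lam u else 0) =
      ∑ s ∈ N, ∑ u ∈ N, lam s * fourth P Y j s s u u * lam u := by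
    refine Finset.sum_congr rfl fun s hs => ?_
    rw [Finset.sum_comm]
    refine Finset.sum_congr rfl fun u hu => ?_
    simp only [ite_mul, zero_mul, mul_ite, mul_zero, Finset.sum_ite_eq,
      hs, hu, if_true]
  rw [e1]
  calc _ ≤ ∑ s ∈ N, ∑ u ∈ N, K * (lam s ^ 2 * lam u ^ 2) := by
        refine Finset.sum_le_sum fun s hs => Finset.sum_le_sum fun u hu => ?_
        have h2 := (h.fourth_self_self j (hN hs) (hN hu)).2
        have h3 := mul_nonneg (h.nonneg s (hN hs)) (h.nonneg u (hN hu))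
        calc _ = lam s * lam u * fourth P Y j s s u u := by ring
          _ ≤ lam s * lam u * (K * (lam s * lam u)) := mul_le_mul_of_nonneg_left h2 h3
          _ = _ := by ring
    _ = _ := by
        rw [sq, Finset.sum_mul_sum]
        simp only [Finset.mul_sum]

/-- Each of the four distinct rows forces two neighbouring indices of the cycle to agree, so all
four coincide. These are the terms present in order n⁴, and they contribute only ∑ lam s⁴, that is
tr Σ₂⁴ when `N` indexes the noise. -/
lemma offDiagGram_cycle (h : IsScoreFamily P Y T lam K) (hN : N ⊆ T) {i j k q : Fin n}
    (hij : i ≠ j) (hik : i ≠ k) (hiq : i ≠ q) (hjk : j ≠ k) (hjq : j ≠ q) (hkq : k ≠ q) :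
    HasMean P (fun ω => offDiagGram Y N ω i j * offDiagGram Y N ω j k *
      (offDiagGram Y N ω i q * offDiagGram Y N ω q k)) (∑ s ∈ N, lam s ^ 4) := by
  refine HasMean.congr (HasMean.sum fun s hs => HasMean.sum fun t ht => HasMean.sum fun u hu =>
      HasMean.sum fun v hv => HasMean.mul_four h.indep h.meas hij hik hiq hjk hjq hkq
        (f := fun x => x s * x u) (g := fun x => x s * x t) (h := fun x => x t * x v)
        (l := fun x => x u * x v) (by fun_prop) (by fun_prop) (by fun_prop) (by fun_prop)
        (h.hasMean_two i (hN hs) (hN hu)) (h.hasMean_two j (hN hs) (hN ht))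
        (h.hasMean_two k (hN ht) (hN hv)) (h.hasMean_two q (hN hu) (hN hv))) (fun ω => ?_) ?_
  · rw [offDiagGram_of_ne hij, offDiagGram_of_ne hjk, offDiagGram_of_ne hiq,
      offDiagGram_of_ne hkq.symm, sum_mul_sum_four]
    refine Finset.sum_congr rfl fun s _ => Finset.sum_congr rfl fun t _ =>
      Finset.sum_congr rfl fun u _ => Finset.sum_congr rfl fun v _ => by ring
  · refine Finset.sum_congr rfl fun s hs => ?_
    rw [Finset.sum_eq_single s (fun t _ ht => by simp [Ne.symm ht]) (fun hn => absurd hs hn),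
      Finset.sum_eq_single s (fun u _ hu => by simp [Ne.symm hu]) (fun hn => absurd hs hn),
      Finset.sum_eq_single s (fun v _ hv => by simp [Ne.symm hv]) (fun hn => absurd hs hn)]
    simp only [if_true]
    ring

end IsScoreFamily

end Scores

/-! ### Second-moment bounds for the sample statistics. -/

section ScoreMoments

namespace IsScoreFamily

variable {Ω : Type*} [MeasurableSpace Ω]
variable {P : Measure Ω} [IsProbabilityMeasure P] {n : ℕ} {Y : Fin n → Ω → ℕ → ℝ}
  {T N : Finset ℕ} {lam : ℕ → ℝ} {K : ℝ}

/-- The indicators record the coincidences i = k and j = q, the only ones compatible with a nonzero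
term since the diagonal has been removed. Each costs a factor n in the later sum over rows, so the
larger bound by (∑ lam s²)² is harmless there. -/
lemma offDiagGram_cycle_le (h : IsScoreFamily P Y T lam K) (hN : N ⊆ T) (i k j q : Fin n) :
    Integrable (fun ω => offDiagGram Y N ω i j * offDiagGram Y N ω j k *
      (offDiagGram Y N ω i q * offDiagGram Y N ω q k)) P ∧
    ∫ ω, offDiagGram Y N ω i j * offDiagGram Y N ω j k *
      (offDiagGram Y N ω i q * offDiagGram Y N ω q k) ∂P ≤
      ∑ s ∈ N, lam s ^ 4 + 3 * K ^ 2 * (∑ s ∈ N, lam s ^ 2) ^ 2 *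
        ((if i = k then 1 else 0) + if j = q then 1 else 0) := by
  have h4 : 0 ≤ ∑ s ∈ N, lam s ^ 4 := Finset.sum_nonneg fun s _ => by positivity
  have hK := h.one_le
  have hi1 : (0 : ℝ) ≤ if i = k then 1 else 0 := by split_ifs <;> norm_num
  have hj1 : (0 : ℝ) ≤ if j = q then 1 else 0 := by split_ifs <;> norm_num
  set τ := (∑ s ∈ N, lam s ^ 2) ^ 2 with hτ
  have hτ0 : 0 ≤ τ := sq_nonneg _
  have hrhs : 0 ≤ ∑ s ∈ N, lam s ^ 4 + 3 * K ^ 2 * τ *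
        ((if i = k then 1 else 0) + if j = q then 1 else 0) := by positivity
  have hzero : (∀ ω, offDiagGram Y N ω i j * offDiagGram Y N ω j k *
      (offDiagGram Y N ω i q * offDiagGram Y N ω q k) = 0) →
      Integrable (fun ω => offDiagGram Y N ω i j * offDiagGram Y N ω j k *
        (offDiagGram Y N ω i q * offDiagGram Y N ω q k)) P ∧
      ∫ ω, offDiagGram Y N ω i j * offDiagGram Y N ω j k *
        (offDiagGram Y N ω i q * offDiagGram Y N ω q k) ∂P ≤
        ∑ s ∈ N, lam s ^ 4 + 3 * K ^ 2 * τ *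
          ((if i = k then 1 else 0) + if j = q then 1 else 0) := fun h0 => by
    constructor
    · simp only [h0]; exact integrable_const 0
    · simp only [h0, integral_zero]; exact hrhs
  by_cases hij : i = j
  · exact hzero fun ω => by rw [hij, offDiagGram_self]; ring
  by_cases hjk : j = k
  · exact hzero fun ω => by rw [hjk, offDiagGram_self]; ring
  by_cases hiq : i = q
  · exact hzero fun ω => by rw [hiq, offDiagGram_self]; ring
  by_cases hqk : q = k
  · exact hzero fun ω => by rw [hqk, offDiagGram_self]; ring
  have hKτ : K * τ ≤ 3 * K ^ 2 * τ := mul_le_mul_of_nonneg_right (by nlinarith) hτ0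
  by_cases hik : i = k
  · subst hik
    by_cases hjq : j = q
    · subst hjq
      have h1 := h.offDiagGram_pow_four hN hij
      have heq : (fun ω => offDiagGram Y N ω i j * offDiagGram Y N ω j i *
          (offDiagGram Y N ω i j * offDiagGram Y N ω j i)) =
          fun ω => offDiagGram Y N ω i j ^ 4 := by
        ext ω
        rw [offDiagGram_comm (i := j) (k := i)]; ring
      rw [heq]
      refine ⟨h1.1, h1.2.trans ?_⟩
      simp only [if_true]
      linarith [mul_nonneg (mul_nonneg (by norm_num : (0 : ℝ) ≤ 3) (sq_nonneg K)) hτ0]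
    · have h1 := h.offDiagGram_sq_mul_sq hN (Ne.symm hij) hjq hiq
      have heq : (fun ω => offDiagGram Y N ω i j * offDiagGram Y N ω j i *
          (offDiagGram Y N ω i q * offDiagGram Y N ω q i)) =
          fun ω => offDiagGram Y N ω i j ^ 2 * offDiagGram Y N ω i q ^ 2 := by
        ext ω
        rw [offDiagGram_comm (i := j) (k := i), offDiagGram_comm (i := q) (k := i)]; ring
      rw [heq]
      refine ⟨h1.1, h1.2.trans ?_⟩
      rw [if_pos rfl, if_neg hjq]
      linarith
  · by_cases hjq : j = q
    · subst hjq
      have h1 := h.offDiagGram_sq_mul_sq hN hij hik hjk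
      have heq : (fun ω => offDiagGram Y N ω i j * offDiagGram Y N ω j k *
          (offDiagGram Y N ω i j * offDiagGram Y N ω j k)) =
          fun ω => offDiagGram Y N ω j i ^ 2 * offDiagGram Y N ω j k ^ 2 := by
        ext ω
        rw [offDiagGram_comm (i := j) (k := i)]; ring
      rw [heq]
      refine ⟨h1.1, h1.2.trans ?_⟩
      rw [if_pos rfl, if_neg hik]
      linarith
    · have h1 := h.offDiagGram_cycle hN hij hik hiq hjk hjq (Ne.symm hqk)
      refine ⟨h1.1, h1.2.le.trans ?_⟩
      rw [if_neg hik, if_neg hjq]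
      linarith

/-- The Frobenius norm of the square of the off-diagonal Gram matrix. -/
lemma sum_sq_offDiagGram_sq (h : IsScoreFamily P Y T lam K) (hN : N ⊆ T) :
    Integrable (fun ω => ∑ i, ∑ k,
      (∑ j, offDiagGram Y N ω i j * offDiagGram Y N ω j k) ^ 2) P ∧
    ∫ ω, ∑ i, ∑ k, (∑ j, offDiagGram Y N ω i j * offDiagGram Y N ω j k) ^ 2 ∂P ≤
      n ^ 4 * ∑ s ∈ N, lam s ^ 4 + 6 * K ^ 2 * n ^ 3 * (∑ s ∈ N, lam s ^ 2) ^ 2 := by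
  have h1 : HasMean P (fun ω => ∑ i, ∑ k,
      (∑ j, offDiagGram Y N ω i j * offDiagGram Y N ω j k) ^ 2) _ :=
    HasMean.congr (HasMean.sum (T := Finset.univ) fun i _ => HasMean.sum (T := Finset.univ)
      fun k _ => HasMean.sum (T := Finset.univ) fun j _ => HasMean.sum (T := Finset.univ)
      fun q _ => ⟨(h.offDiagGram_cycle_le hN i k j q).1, rfl⟩)
      (fun ω => by simp only [sq, Finset.sum_mul_sum]) rfl
  refine ⟨h1.1, h1.2.trans_le ?_⟩
  refine (Finset.sum_le_sum fun i _ => Finset.sum_le_sum fun k _ => Finset.sum_le_sum fun j _ =>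
    Finset.sum_le_sum fun q _ => (h.offDiagGram_cycle_le hN i k j q).2).trans (le_of_eq ?_)
  simp only [mul_add, Finset.sum_add_distrib, Finset.sum_const, Finset.card_univ, Fintype.card_fin,
    nsmul_eq_mul, mul_ite, mul_one, mul_zero, Finset.sum_ite_eq, Finset.mem_univ, if_true]
  ring

/-- The off-diagonal Gram matrix of the scores in `N` applied to another score. -/
lemma sum_sq_offDiagGram_mulVec (h : IsScoreFamily P Y T lam K) (hN : N ⊆ T) {r : ℕ}
    (hr : r ∈ T) (hrN : r ∉ N) :
    Integrable (fun ω => ∑ i, (∑ k, offDiagGram Y N ω i k * Y k ω r) ^ 2) P ∧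
    ∫ ω, ∑ i, (∑ k, offDiagGram Y N ω i k * Y k ω r) ^ 2 ∂P ≤
      n ^ 2 * ((∑ s ∈ N, lam s ^ 2) * lam r) := by
  have hτ : 0 ≤ (∑ s ∈ N, lam s ^ 2) * lam r :=
    mul_nonneg (Finset.sum_nonneg fun s _ => sq_nonneg _) (h.nonneg r hr)
  -- Because r lies outside `N`, `Y · r` is uncorrelated with the scores in `N`, and the terms with
  -- k ≠ q vanish. The remaining order n², instead of n³, is the gain of the fine bound ρ over η.
  have key : ∀ i k q : Fin n, HasMean P
      (fun ω => offDiagGram Y N ω i k * Y k ω r * (offDiagGram Y N ω i q * Y q ω r))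
      (if k = q then if i = k then 0 else (∑ s ∈ N, lam s ^ 2) * lam r else 0) := by
    intro i k q
    by_cases hik : i = k
    · refine (HasMean.const 0).congr (fun ω => ?_) ?_
      · rw [hik, offDiagGram_self]; ring
      · simp [hik]
    by_cases hiq : i = q
    · refine (HasMean.const 0).congr (fun ω => ?_) ?_
      · rw [hiq, offDiagGram_self]; ring
      · rw [if_neg (fun hkq => hik (hiq.trans hkq.symm))]
    by_cases hkq : k = q
    · subst hkq
      refine HasMean.congr (HasMean.sum fun s hs => HasMean.sum fun t ht =>
        HasMean.mul_two h.indep hik (f := fun x => x s * x t) (g := fun x => x s * x t * x r * x r)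
        (by fun_prop) (by fun_prop) (h.hasMean_two i (hN hs) (hN ht))
        (h.hasMean_four k (hN hs) (hN ht) hr hr)) (fun ω => ?_) ?_
      · rw [offDiagGram_of_ne hik, mul_mul_mul_comm, Finset.sum_mul_sum, Finset.sum_mul]
        refine Finset.sum_congr rfl fun s _ => ?_
        rw [Finset.sum_mul]
        exact Finset.sum_congr rfl fun t _ => by ring
      · rw [if_pos rfl, if_neg hik, Finset.sum_mul]
        refine Finset.sum_congr rfl fun s hs => ?_
        simp only [ite_mul, zero_mul, Finset.sum_ite_eq, hs, if_true]
        rw [h.fourth_self_self_of_ne k (hN hs) hr (by rintro rfl; exact hrN hs)]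
        ring
    · refine HasMean.congr (HasMean.sum fun s hs => HasMean.sum fun t ht =>
        HasMean.mul_three h.indep h.meas hik hiq hkq (f := fun x => x s * x t)
        (g := fun x => x s * x r) (h := fun x => x t * x r) (by fun_prop) (by fun_prop)
        (by fun_prop) (h.hasMean_two i (hN hs) (hN ht)) (h.hasMean_two k (hN hs) hr)
        (h.hasMean_two q (hN ht) hr)) (fun ω => ?_) ?_
      · rw [offDiagGram_of_ne hik, offDiagGram_of_ne hiq, mul_mul_mul_comm, Finset.sum_mul_sum,
          Finset.sum_mul]
        refine Finset.sum_congr rfl fun s _ => ?_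
        rw [Finset.sum_mul]
        exact Finset.sum_congr rfl fun t _ => by ring
      · rw [if_neg hkq]
        refine (Finset.sum_eq_zero fun s hs => Finset.sum_eq_zero fun t ht => ?_).symm
        rw [if_neg (show t ≠ r by rintro rfl; exact hrN ht), mul_zero]
  have h1 : HasMean P (fun ω => ∑ i, (∑ k, offDiagGram Y N ω i k * Y k ω r) ^ 2) _ :=
    HasMean.congr (HasMean.sum (T := Finset.univ) fun i _ => HasMean.sum (T := Finset.univ)
      fun k _ => HasMean.sum (T := Finset.univ) fun q _ => key i k q)
      (fun ω => by simp only [sq, Finset.sum_mul_sum]) rfl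
  refine ⟨h1.1, h1.2.trans_le ?_⟩
  calc _ ≤ ∑ i : Fin n, ∑ k : Fin n, (∑ s ∈ N, lam s ^ 2) * lam r := by
        refine Finset.sum_le_sum fun i _ => Finset.sum_le_sum fun k _ => ?_
        simp only [Finset.sum_ite_eq, Finset.mem_univ, if_true]
        split_ifs
        exacts [hτ, le_rfl]
    _ = _ := by simp; ring

lemma memLp_sum_sq (h : IsScoreFamily P Y T lam K) (hN : N ⊆ T) (i : Fin n) :
    HasMean P (fun ω => ∑ s ∈ N, Y i ω s ^ 2) (∑ s ∈ N, lam s) :=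
  HasMean.sum fun s hs => (h.hasMean_two i (hN hs) (hN hs)).congr (fun ω => sq _) (by simp)

/-- The squared lengths of the rows concentrate. -/
lemma sum_sq_sum_sq_sub (h : IsScoreFamily P Y T lam K) (hN : N ⊆ T) :
    Integrable (fun ω => ∑ i, (∑ s ∈ N, Y i ω s ^ 2 - ∑ s ∈ N, lam s) ^ 2) P ∧
    ∫ ω, ∑ i, (∑ s ∈ N, Y i ω s ^ 2 - ∑ s ∈ N, lam s) ^ 2 ∂P ≤
      n * (K * ∑ s ∈ N, lam s ^ 2) := by
  have key : ∀ i : Fin n, HasMean P (fun ω => (∑ s ∈ N, Y i ω s ^ 2 - ∑ s ∈ N, lam s) ^ 2)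
      (∑ s ∈ N, ∑ t ∈ N, (fourth P Y i s s t t - lam s * lam t)) := by
    intro i
    have h1 : HasMean P (fun ω => (∑ s ∈ N, Y i ω s ^ 2) ^ 2)
        (∑ s ∈ N, ∑ t ∈ N, fourth P Y i s s t t) :=
      HasMean.congr (HasMean.sum fun s hs => HasMean.sum fun t ht =>
        h.hasMean_four i (hN hs) (hN hs) (hN ht) (hN ht)) (fun ω => by
          rw [sq, Finset.sum_mul_sum]
          exact Finset.sum_congr rfl fun s _ => Finset.sum_congr rfl fun t _ => by ring) rfl
    refine ((h1.sub ((h.memLp_sum_sq hN i).const_mul (2 * ∑ s ∈ N, lam s))).add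
      (HasMean.const ((∑ s ∈ N, lam s) ^ 2))).congr (fun ω => by ring) ?_
    simp only [Finset.sum_sub_distrib, ← Finset.sum_mul_sum]
    ring
  have h1 := HasMean.sum (T := Finset.univ) fun i _ => key i
  refine ⟨h1.1, h1.2.trans_le ?_⟩
  calc _ ≤ ∑ i : Fin n, K * ∑ s ∈ N, lam s ^ 2 := by
        refine Finset.sum_le_sum fun i _ => ?_
        rw [Finset.mul_sum]
        refine Finset.sum_le_sum fun s hs => ?_
        -- The condition E(z_s² z_t²) = 1 makes squares of distinct scores uncorrelated, so only the
        -- diagonal of the variance is left.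
        rw [Finset.sum_eq_single_of_mem s hs (fun t ht hts => by
          rw [h.fourth_self_self_of_ne i (hN hs) (hN ht) (Ne.symm hts), sub_self])]
        have := (h.fourth_self_self i (hN hs) (hN hs)).2
        nlinarith [sq_nonneg (lam s)]
    _ = _ := by simp

lemma sq_sum_score (h : IsScoreFamily P Y T lam K) {s : ℕ} (hs : s ∈ T) :
    Integrable (fun ω => (∑ i, Y i ω s) ^ 2) P ∧ ∫ ω, (∑ i, Y i ω s) ^ 2 ∂P ≤ n * lam s := by
  have hsq : ∀ i, Integrable (fun ω => Y i ω s ^ 2) P ∧ ∫ ω, Y i ω s ^ 2 ∂P ≤ lam s := fun i => by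
    have := (h.hasMean_two i hs hs).congr (f' := fun ω => Y i ω s ^ 2) (fun ω => sq _) rfl
    exact ⟨this.1, by rw [this.2, if_pos rfl]⟩
  have hm : Measurable fun x : ℕ → ℝ => x s := measurable_pi_apply s
  exact HasMean.sq_sum_le h.indep hm (fun i => h.hasMean i hs) hsq

lemma sq_sum_score_mul_score (h : IsScoreFamily P Y T lam K) {s t : ℕ} (hs : s ∈ T)
    (ht : t ∈ T) :
    Integrable (fun ω => (∑ i, (Y i ω s * Y i ω t - if s = t then lam s else 0)) ^ 2) P ∧
    ∫ ω, (∑ i, (Y i ω s * Y i ω t - if s = t then lam s else 0)) ^ 2 ∂P ≤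
      n * (K * (lam s * lam t)) := by
  set a := if s = t then lam s else 0 with ha
  have hm : Measurable fun x : ℕ → ℝ => x s * x t - a := by fun_prop
  have h0 : ∀ i, HasMean P (fun ω => Y i ω s * Y i ω t - a) 0 := fun i =>
    ((h.hasMean_two i hs ht).sub (HasMean.const a)).congr (fun _ => rfl) (by simp [ha])
  refine HasMean.sq_sum_le h.indep hm h0 fun i => ?_
  have h4 : HasMean P (fun ω => (Y i ω s * Y i ω t) ^ 2) (fourth P Y i s s t t) :=
    (h.hasMean_four i hs hs ht ht).congr (fun ω => by ring) rfl
  have h5 : HasMean P (fun ω => (Y i ω s * Y i ω t - a) ^ 2)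
      (fourth P Y i s s t t - a ^ 2) :=
    ((h4.sub ((h.hasMean_two i hs ht).const_mul (2 * a))).add (HasMean.const (a ^ 2))).congr
      (fun ω => by ring) (by rw [← ha]; ring)
  refine ⟨h5.1, h5.2.trans_le ?_⟩
  linarith [(h.fourth_self_self i hs ht).2, sq_nonneg a]

end IsScoreFamily

end ScoreMoments

/-! ### Chernoff and Bernstein bounds from exponential moments. -/

section ExponentialTails

/-- The Taylor remainder bound for the complex exponential, restricted to the real line. After
expectation of a centred variable the linear term disappears and the quadratic one yields the
sub-Gaussian bound. -/
lemma exp_le_one_add_add_sq_mul_exp_abs (x : ℝ) :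
    Real.exp x ≤ 1 + x + x ^ 2 * Real.exp |x| := by
  have h := Complex.norm_exp_sub_sum_le_norm_mul_exp (x : ℂ) 2
  have h1 : Complex.exp x - ∑ m ∈ Finset.range 2, (x : ℂ) ^ m / m.factorial =
      ((Real.exp x - (1 + x) : ℝ) : ℂ) := by
    simp [Finset.sum_range_succ]
  rw [h1, Complex.norm_real, Complex.norm_real, Real.norm_eq_abs, Real.norm_eq_abs, sq_abs] at h
  linarith [le_abs_self (Real.exp x - (1 + x))]

variable {Ω : Type*} [MeasurableSpace Ω] {P : Measure Ω}

lemma integrable_exp_mul_of_abs_le {X : Ω → ℝ} (hX : Measurable X) {t s : ℝ} (hs : |s| ≤ t)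
    (hint : Integrable (fun ω => Real.exp (t * |X ω|)) P) :
    Integrable (fun ω => Real.exp (s * X ω)) P := by
  refine hint.mono' (by fun_prop) (ae_of_all _ fun ω => ?_)
  rw [Real.norm_eq_abs, Real.abs_exp]
  refine Real.exp_le_exp.2 ((le_abs_self _).trans ?_)
  rw [abs_mul]
  exact mul_le_mul_of_nonneg_right hs (abs_nonneg _)

variable [IsProbabilityMeasure P]

/-- A centred variable with an exponential moment has a sub-Gaussian moment generating function
near zero. -/
lemma mgf_le_of_exp_abs {X : Ω → ℝ} (hX : Measurable X) (hmean : HasMean P X 0) {t C s : ℝ}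
    (ht : 0 < t) (hint : Integrable (fun ω => Real.exp (t * |X ω|)) P)
    (hC : ∫ ω, Real.exp (t * |X ω|) ∂P ≤ C) (hs : |s| ≤ t / 2) :
    mgf X P s ≤ Real.exp (8 * C / t ^ 2 * s ^ 2) := by
  have hpt : ∀ ω, Real.exp (s * X ω) ≤
      1 + s * X ω + 8 / t ^ 2 * s ^ 2 * Real.exp (t * |X ω|) := fun ω => by
    refine (exp_le_one_add_add_sq_mul_exp_abs _).trans ?_
    -- The moment exp(t|X|) is spent in halves: one dominates exp|sX|, which needs |s| ≤ t/2, the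
    -- other dominates X². The 8/t² comes from y²/2 ≤ exp y at y = t|X|/2.
    have h1 : Real.exp |s * X ω| ≤ Real.exp (t * |X ω| / 2) := by
      refine Real.exp_le_exp.2 ?_
      rw [abs_mul]
      nlinarith [abs_nonneg (X ω)]
    have h2 : X ω ^ 2 ≤ 8 / t ^ 2 * Real.exp (t * |X ω| / 2) := by
      have h3 := Real.quadratic_le_exp_of_nonneg (x := t * |X ω| / 2) (by positivity)
      have h4 : (t * |X ω| / 2) ^ 2 / 2 ≤ Real.exp (t * |X ω| / 2) := by
        have : 0 ≤ t * |X ω| / 2 := by positivity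
        linarith
      rw [div_mul_eq_mul_div, le_div_iff₀ (by positivity), ← sq_abs (X ω)]
      nlinarith
    have h5 : (s * X ω) ^ 2 * Real.exp |s * X ω| ≤ 8 / t ^ 2 * s ^ 2 * Real.exp (t * |X ω|) := by
      calc _ ≤ (s ^ 2 * (8 / t ^ 2 * Real.exp (t * |X ω| / 2))) * Real.exp (t * |X ω| / 2) := by
            rw [mul_pow]
            exact mul_le_mul (mul_le_mul_of_nonneg_left h2 (sq_nonneg _)) h1
              (Real.exp_pos _).le (by positivity)
        _ = 8 / t ^ 2 * s ^ 2 * (Real.exp (t * |X ω| / 2) * Real.exp (t * |X ω| / 2)) := by ring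
        _ = _ := by rw [← Real.exp_add]; ring_nf
    linarith
  have hint' := integrable_exp_mul_of_abs_le hX (hs.trans (by linarith)) hint
  have hR : HasMean P (fun ω => 1 + s * X ω + 8 / t ^ 2 * s ^ 2 * Real.exp (t * |X ω|))
      (1 + s * 0 + 8 / t ^ 2 * s ^ 2 * ∫ ω, Real.exp (t * |X ω|) ∂P) :=
    ((HasMean.const 1).add (hmean.const_mul s)).add (HasMean.const_mul ⟨hint, rfl⟩ _)
  calc mgf X P s ≤ _ := (integral_mono hint' hR.1 hpt).trans hR.2.le
    _ ≤ 1 + 8 / t ^ 2 * s ^ 2 * C := by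
        rw [mul_zero, add_zero]
        gcongr
    _ = 8 * C / t ^ 2 * s ^ 2 + 1 := by ring
    _ ≤ _ := Real.add_one_le_exp _

variable {n : ℕ} {X : Fin n → Ω → ℝ}

lemma measure_sum_ge_le_exp (hind : iIndepFun X P) (hX : ∀ i, Measurable (X i)) {s b r : ℝ}
    (hs : 0 ≤ s) (hint : ∀ i, Integrable (fun ω => Real.exp (s * X i ω)) P)
    (hb : ∀ i, mgf (X i) P s ≤ Real.exp b) :
    P {ω | r ≤ ∑ i, X i ω} ≤ ENNReal.ofReal (Real.exp (n * b - s * r)) := by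
  have h1 := measure_ge_le_exp_mul_mgf r hs
    (hind.integrable_exp_mul_sum hX (s := Finset.univ) fun i _ => hint i)
  rw [hind.mgf_sum hX] at h1
  have h2 : ∏ i, mgf (X i) P s ≤ Real.exp (n * b) := by
    refine (Finset.prod_le_prod (fun i _ => mgf_nonneg) fun i _ => hb i).trans (le_of_eq ?_)
    rw [Finset.prod_const, Finset.card_univ, Fintype.card_fin, ← Real.exp_nat_mul]
  have h3 : P.real {ω | r ≤ (∑ i, X i) ω} ≤ Real.exp (n * b - s * r) := by
    refine h1.trans ((mul_le_mul_of_nonneg_left h2 (Real.exp_pos _).le).trans (le_of_eq ?_))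
    rw [← Real.exp_add]
    ring_nf
  simp only [Finset.sum_apply] at h3
  rw [← ofReal_measureReal]
  exact ENNReal.ofReal_le_ofReal h3

/-- A Bernstein-type inequality at the scale `√(n L)`. -/
lemma measure_abs_sum_ge_le (hind : iIndepFun X P) (hX : ∀ i, Measurable (X i))
    (hmean : ∀ i, HasMean P (X i) 0) {t C L : ℝ} (ht : 0 < t)
    (hint : ∀ i, Integrable (fun ω => Real.exp (t * |X i ω|)) P)
    (hC : ∀ i, ∫ ω, Real.exp (t * |X i ω|) ∂P ≤ C) (hn : 0 < n) (hL : 0 ≤ L)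
    (hLn : Real.sqrt (L / n) ≤ t / 2) :
    P {ω | (8 * C / t ^ 2 + 2) * Real.sqrt (n * L) ≤ |∑ i, X i ω|} ≤
      ENNReal.ofReal (2 * Real.exp (-(2 * L))) := by
  have hn' : (0 : ℝ) < n := by exact_mod_cast hn
  -- The Chernoff parameter: n·b·s² = bL and s·√(nL) = L, so the threshold constant b + 2 leaves the
  -- exponent −2L. With L = log d this is d⁻², enough for a union over d coordinates.
  set s := Real.sqrt (L / n) with hsdef
  have hs0 : 0 ≤ s := Real.sqrt_nonneg _
  have hs2 : s ^ 2 = L / n := Real.sq_sqrt (by positivity)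
  have hsr : s * Real.sqrt (n * L) = L := by
    rw [hsdef, ← Real.sqrt_mul (by positivity), show L / n * (n * L) = L ^ 2 by field_simp,
      Real.sqrt_sq hL]
  have hexp : (n : ℝ) * (8 * C / t ^ 2 * s ^ 2) - s * ((8 * C / t ^ 2 + 2) * Real.sqrt (n * L)) =
      -(2 * L) := by
    have : s * ((8 * C / t ^ 2 + 2) * Real.sqrt (n * L)) =
        (8 * C / t ^ 2 + 2) * (s * Real.sqrt (n * L)) := by ring
    rw [this, hsr, hs2]
    field_simp
    ring
  have ht2 : t / 2 ≤ t := by linarith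
  have habs : |s| ≤ t / 2 := by rwa [abs_of_nonneg hs0]
  have h1 := measure_sum_ge_le_exp hind hX (r := (8 * C / t ^ 2 + 2) * Real.sqrt (n * L)) hs0
    (fun i => integrable_exp_mul_of_abs_le (hX i) (habs.trans ht2) (hint i))
    (fun i => mgf_le_of_exp_abs (hX i) (hmean i) ht (hint i) (hC i) habs)
  have h2 := measure_sum_ge_le_exp (X := fun i ω => -X i ω) (hind.comp (fun _ x => -x)
      fun _ => measurable_neg) (fun i => (hX i).neg)
    (r := (8 * C / t ^ 2 + 2) * Real.sqrt (n * L)) hs0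
    (fun i => integrable_exp_mul_of_abs_le (hX i).neg (habs.trans ht2)
      (by simpa only [Pi.neg_apply, abs_neg] using hint i))
    (fun i => mgf_le_of_exp_abs (hX i).neg
      (((hmean i).const_mul (-1)).congr (fun ω => by simp) (by simp)) ht
      (by simpa only [Pi.neg_apply, abs_neg] using hint i)
      (by simpa only [Pi.neg_apply, abs_neg] using hC i) habs)
  rw [hexp] at h1 h2
  rw [two_mul (Real.exp _), ENNReal.ofReal_add (Real.exp_pos _).le (Real.exp_pos _).le]
  refine (measure_mono fun ω hω => ?_).trans ((measure_union_le _ _).trans (add_le_add h1 h2))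
  simp only [Set.mem_ofPred_eq, Set.mem_union, Finset.sum_neg_distrib] at hω ⊢
  exact le_abs.1 hω

/-- Exponential moments bound a sum by a multiple of `n`. -/
lemma measure_sum_ge_le_of_exp (hind : iIndepFun X P) (hX : ∀ i, Measurable (X i)) {t C : ℝ}
    (ht : 0 < t) (hint : ∀ i, Integrable (fun ω => Real.exp (t * X i ω)) P)
    (hC : ∀ i, ∫ ω, Real.exp (t * X i ω) ∂P ≤ C) :
    P {ω | (C + 2) / t * n ≤ ∑ i, X i ω} ≤ ENNReal.ofReal (Real.exp (-(2 * n))) := by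
  -- The moment bound C is at most exp C, so at s = t the exponent is nC − (C + 2)n = −2n.
  refine (measure_sum_ge_le_exp hind hX ht.le hint (b := C) fun i => (hC i).trans ?_).trans
    (le_of_eq ?_)
  · linarith [Real.add_one_le_exp C]
  · congr 2
    field_simp
    ring

end ExponentialTails

/-! ### The centring projection on the sample space. -/

section Centering

variable {n : ℕ}

local notation "⟪" x ", " y "⟫" => inner ℝ x y

lemma euclidean_inner_eq_sum (x y : EuclideanSpace ℝ (Fin n)) : ⟪x, y⟫ = ∑ i, x i * y i := by
  rw [PiLp.inner_apply]
  exact Finset.sum_congr rfl fun i _ => by simp [mul_comm]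

/-- The vector of ones. -/
noncomputable def onesVec (n : ℕ) : EuclideanSpace ℝ (Fin n) := WithLp.toLp 2 fun _ => 1

lemma inner_onesVec (u : EuclideanSpace ℝ (Fin n)) : ⟪onesVec n, u⟫ = ∑ i, u i := by
  simp [euclidean_inner_eq_sum, onesVec]

lemma norm_onesVec_sq : ‖onesVec n‖ ^ 2 = n := by
  rw [← real_inner_self_eq_norm_sq, inner_onesVec]; simp [onesVec]

lemma norm_onesVec : ‖onesVec n‖ = Real.sqrt n := by
  rw [← norm_onesVec_sq, Real.sqrt_sq (norm_nonneg _)]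

/-- The projection onto the orthogonal complement of the vector of ones. -/
noncomputable def centering (n : ℕ) : EuclideanSpace ℝ (Fin n) →ₗ[ℝ] EuclideanSpace ℝ (Fin n) :=
  LinearMap.id - (n : ℝ)⁻¹ • (innerₛₗ ℝ (onesVec n)).smulRight (onesVec n)

lemma centering_apply (u : EuclideanSpace ℝ (Fin n)) :
    centering n u = u - ((n : ℝ)⁻¹ * ⟪onesVec n, u⟫) • onesVec n := by
  simp [centering, smul_smul]

lemma inner_centering (x u : EuclideanSpace ℝ (Fin n)) :
    ⟪x, centering n u⟫ = ⟪x, u⟫ - (n : ℝ)⁻¹ * (⟪onesVec n, x⟫ * ⟪onesVec n, u⟫) := by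
  rw [centering_apply, inner_sub_right, real_inner_smul_right, real_inner_comm (onesVec n) x]
  ring

lemma centering_symm : (centering n).IsSymmetric := fun x y => by
  rw [inner_centering, real_inner_comm y, inner_centering, real_inner_comm x y]
  ring

lemma centering_idem (u : EuclideanSpace ℝ (Fin n)) :
    centering n (centering n u) = centering n u := by
  rcases Nat.eq_zero_or_pos n with rfl | hn
  · exact Subsingleton.elim _ _
  have h0 : ⟪onesVec n, centering n u⟫ = 0 := by
    rw [inner_centering, real_inner_self_eq_norm_sq, norm_onesVec_sq]
    field_simp
    ring
  rw [centering_apply, h0]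
  simp

lemma inner_centering_centering (x u : EuclideanSpace ℝ (Fin n)) :
    ⟪centering n x, centering n u⟫ = ⟪x, centering n u⟫ := by
  rw [centering_symm, centering_idem]

lemma norm_centering_le (u : EuclideanSpace ℝ (Fin n)) : ‖centering n u‖ ≤ ‖u‖ := by
  have h1 : ‖centering n u‖ ^ 2 = ⟪u, centering n u⟫ := by
    rw [← real_inner_self_eq_norm_sq, inner_centering_centering]
  have h2 := real_inner_le_norm u (centering n u)
  rcases (norm_nonneg (centering n u)).eq_or_lt with h | h
  · rw [← h]; exact norm_nonneg _
  · nlinarith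

lemma centering_apply_coord (u : EuclideanSpace ℝ (Fin n)) (i : Fin n) :
    centering n u i = u i - (∑ k, u k) / n := by
  rw [centering_apply, inner_onesVec]
  simp [onesVec]
  ring

end Centering

/-! ### Operator norms from Frobenius norms. -/

section MatrixBounds

variable {n : ℕ}

local notation "⟪" x ", " y "⟫" => inner ℝ x y

lemma toEuclideanLin_coord (G : Matrix (Fin n) (Fin n) ℝ) (u : EuclideanSpace ℝ (Fin n))
    (i : Fin n) : Matrix.toEuclideanLin G u i = ∑ k, G i k * u k := by
  simp [Matrix.mulVec, dotProduct]

/-- The Frobenius norm bounds the operator norm. -/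
lemma norm_toEuclideanLin_sq_le (G : Matrix (Fin n) (Fin n) ℝ) (u : EuclideanSpace ℝ (Fin n)) :
    ‖Matrix.toEuclideanLin G u‖ ^ 2 ≤ (∑ i, ∑ k, G i k ^ 2) * ‖u‖ ^ 2 := by
  rw [EuclideanSpace.real_norm_sq_eq, EuclideanSpace.real_norm_sq_eq, Finset.sum_mul]
  refine Finset.sum_le_sum fun i _ => ?_
  rw [toEuclideanLin_coord]
  exact Finset.sum_mul_sq_le_sq_mul_sq _ _ _

/-- The square root of the Frobenius norm of `G²` bounds the operator norm of a symmetric `G`. -/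
lemma norm_toEuclideanLin_pow_four_le {G : Matrix (Fin n) (Fin n) ℝ} (hG : G.IsHermitian)
    (u : EuclideanSpace ℝ (Fin n)) :
    ‖Matrix.toEuclideanLin G u‖ ^ 4 ≤ (∑ i, ∑ k, (∑ j, G i j * G j k) ^ 2) * ‖u‖ ^ 4 := by
  have hsymm := Matrix.isSymmetric_toEuclideanLin_iff.2 hG
  have h1 := norm_toEuclideanLin_sq_le (G * G) u
  have h2 : Matrix.toEuclideanLin (G * G) u =
      Matrix.toEuclideanLin G (Matrix.toEuclideanLin G u) := by
    simp [Matrix.toLpLin_apply, Matrix.mulVec_mulVec]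
  rw [h2] at h1
  simp only [Matrix.mul_apply] at h1
  -- Passing to G² matters: the Frobenius norm of the off-diagonal Gram matrix is of order n√(tr
  -- Σ₂²) and not small enough, whereas for G² the n⁴ term carries tr Σ₂⁴ and becomes negligible.
  have h3 : ‖Matrix.toEuclideanLin G u‖ ^ 2 ≤
      ‖u‖ * ‖Matrix.toEuclideanLin G (Matrix.toEuclideanLin G u)‖ := by
    rw [← real_inner_self_eq_norm_sq, hsymm]
    exact real_inner_le_norm _ _
  calc _ = (‖Matrix.toEuclideanLin G u‖ ^ 2) ^ 2 := by ring
    _ ≤ (‖u‖ * ‖Matrix.toEuclideanLin G (Matrix.toEuclideanLin G u)‖) ^ 2 :=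
        pow_le_pow_left₀ (by positivity) h3 2
    _ = ‖u‖ ^ 2 * ‖Matrix.toEuclideanLin G (Matrix.toEuclideanLin G u)‖ ^ 2 := by ring
    _ ≤ ‖u‖ ^ 2 * ((∑ i, ∑ k, (∑ j, G i j * G j k) ^ 2) * ‖u‖ ^ 2) :=
        mul_le_mul_of_nonneg_left h1 (by positivity)
    _ = _ := by ring

end MatrixBounds

/-! ### Good samples, and why they give a spiked perturbation. -/

section GoodSample

variable {Ω : Type*} {n : ℕ}

local notation "⟪" x ", " y "⟫" => inner ℝ x y

/-- The sample vector of the score `s`. -/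
noncomputable def scoreCol (Y : Fin n → Ω → ℕ → ℝ) (ω : Ω) (s : ℕ) : EuclideanSpace ℝ (Fin n) :=
  WithLp.toLp 2 fun i => Y i ω s

/-- The deviation of the squared row length of the scores in `N` from its mean. -/
noncomputable def rowDev (Y : Fin n → Ω → ℕ → ℝ) (N : Finset ℕ) (lam : ℕ → ℝ) (ω : Ω)
    (i : Fin n) : ℝ := ∑ s ∈ N, Y i ω s ^ 2 - ∑ s ∈ N, lam s

/-- The centred Gram operator of the scores in `N`, minus its mean, before normalization. -/
noncomputable def gramDev (Y : Fin n → Ω → ℕ → ℝ) (N : Finset ℕ) (lam : ℕ → ℝ) (ω : Ω) :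
    EuclideanSpace ℝ (Fin n) →ₗ[ℝ] EuclideanSpace ℝ (Fin n) :=
  Matrix.toEuclideanLin (Matrix.of (offDiagGram Y N ω)) +
    Matrix.toEuclideanLin (Matrix.diagonal (rowDev Y N lam ω))

/-- The bounds on a realization of the scores used in the perturbation argument. -/
structure IsGoodSample (Y : Fin n → Ω → ℕ → ℝ) (N : Finset ℕ) (m : ℕ) (lam : ℕ → ℝ) (c δ : ℝ)
    (ω : Ω) : Prop where
  gram : ∀ s ∈ Finset.Icc 1 m, ∀ t ∈ Finset.Icc 1 m,
    |∑ i, (Y i ω s * Y i ω t - if s = t then lam s else 0)| ≤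
      c * Real.sqrt n * (Real.sqrt (lam s) * Real.sqrt (lam t))
  sum : ∀ s ∈ Finset.Icc 1 m, |∑ i, Y i ω s| ≤ c * Real.sqrt n * Real.sqrt (lam s)
  len : ∑ i, rowDev Y N lam ω i ^ 2 ≤ c ^ 2 * n * ∑ s ∈ N, lam s ^ 2
  cross : ∀ s ∈ Finset.Icc 1 m, ∑ i, (∑ k, offDiagGram Y N ω i k * Y k ω s) ^ 2 ≤
    c ^ 2 * n ^ 2 * (∑ s ∈ N, lam s ^ 2) * lam s
  off : ∑ i, ∑ k, (∑ j, offDiagGram Y N ω i j * offDiagGram Y N ω j k) ^ 2 ≤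
    δ ^ 4 * n ^ 4 * (∑ s ∈ N, lam s ^ 2) ^ 2

variable {Y : Fin n → Ω → ℕ → ℝ} {N : Finset ℕ} {m : ℕ} {lam : ℕ → ℝ} {c δ : ℝ} {ω : Ω}

lemma inner_scoreCol (s t : ℕ) : ⟪scoreCol Y ω s, scoreCol Y ω t⟫ = ∑ i, Y i ω s * Y i ω t := by
  simp [euclidean_inner_eq_sum, scoreCol]

lemma isHermitian_offDiagGram : (Matrix.of (offDiagGram Y N ω)).IsHermitian := by
  ext i k
  simp [offDiagGram_comm (i := k)]

lemma gramDev_symm : (gramDev Y N lam ω).IsSymmetric :=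
  (Matrix.isSymmetric_toEuclideanLin_iff.2 isHermitian_offDiagGram).add
    (Matrix.isSymmetric_toEuclideanLin_iff.2 (Matrix.isHermitian_diagonal _))

/-- The off-diagonal part and the diagonal deviation recombine to the full noise Gram operator minus
its mean (∑ lam s)·I, which is what identifies the shift κ. -/
lemma gramDev_apply (u : EuclideanSpace ℝ (Fin n)) :
    gramDev Y N lam ω u =
      ∑ s ∈ N, ⟪scoreCol Y ω s, u⟫ • scoreCol Y ω s - (∑ s ∈ N, lam s) • u := by
  ext i
  have h1 : ∀ k, offDiagGram Y N ω i k * u k = (∑ s ∈ N, Y i ω s * Y k ω s) * u k -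
      if i = k then (∑ s ∈ N, Y i ω s ^ 2) * u k else 0 := by
    intro k
    by_cases hik : i = k
    · subst hik
      rw [offDiagGram_self, if_pos rfl]
      simp only [sq]
      ring
    · rw [offDiagGram_of_ne hik, if_neg hik, sub_zero]
  have h2 : gramDev Y N lam ω u i = ∑ k, offDiagGram Y N ω i k * u k + rowDev Y N lam ω i * u i := by
    simp only [gramDev, LinearMap.add_apply, PiLp.add_apply, toEuclideanLin_coord,
      Matrix.of_apply, Matrix.diagonal_apply, ite_mul, zero_mul, Finset.sum_ite_eq,
      Finset.mem_univ, if_true]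
  rw [h2, Finset.sum_congr rfl fun k _ => h1 k, Finset.sum_sub_distrib, Finset.sum_ite_eq,
    if_pos (Finset.mem_univ _), rowDev]
  have h3 : (∑ s ∈ N, ⟪scoreCol Y ω s, u⟫ • scoreCol Y ω s) i =
      ∑ k, (∑ s ∈ N, Y i ω s * Y k ω s) * u k := by
    simp only [WithLp.ofLp_sum, Finset.sum_apply, PiLp.smul_apply, smul_eq_mul,
      euclidean_inner_eq_sum, Finset.sum_mul]
    rw [Finset.sum_comm]
    refine Finset.sum_congr rfl fun k _ => Finset.sum_congr rfl fun s _ => ?_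
    simp only [scoreCol]
    ring
  rw [PiLp.sub_apply, h3, PiLp.smul_apply, smul_eq_mul]
  ring

namespace IsGoodSample

lemma norm_offDiagGram_le (h : IsGoodSample Y N m lam c δ ω) (hδ : 0 ≤ δ)
    (u : EuclideanSpace ℝ (Fin n)) :
    ‖Matrix.toEuclideanLin (Matrix.of (offDiagGram Y N ω)) u‖ ≤
      δ * n * Real.sqrt (∑ s ∈ N, lam s ^ 2) * ‖u‖ := by
  refine (pow_le_pow_iff_left₀ (norm_nonneg _) (by positivity) (by norm_num : 4 ≠ 0)).1 ?_
  refine (norm_toEuclideanLin_pow_four_le isHermitian_offDiagGram u).trans ?_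
  have hτ : Real.sqrt (∑ s ∈ N, lam s ^ 2) ^ 4 = (∑ s ∈ N, lam s ^ 2) ^ 2 := by
    rw [show 4 = 2 * 2 by norm_num, pow_mul,
      Real.sq_sqrt (Finset.sum_nonneg fun _ _ => sq_nonneg _)]
  calc _ ≤ δ ^ 4 * n ^ 4 * (∑ s ∈ N, lam s ^ 2) ^ 2 * ‖u‖ ^ 4 :=
        mul_le_mul_of_nonneg_right h.off (by positivity)
    _ = _ := by rw [← hτ]; ring

lemma norm_rowDev_le (h : IsGoodSample Y N m lam c δ ω) (hc : 0 ≤ c)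
    (u : EuclideanSpace ℝ (Fin n)) :
    ‖Matrix.toEuclideanLin (Matrix.diagonal (rowDev Y N lam ω)) u‖ ≤
      c * Real.sqrt n * Real.sqrt (∑ s ∈ N, lam s ^ 2) * ‖u‖ := by
  refine (pow_le_pow_iff_left₀ (norm_nonneg _) (by positivity) (by norm_num : 2 ≠ 0)).1 ?_
  refine (norm_toEuclideanLin_sq_le _ u).trans ?_
  have h1 : ∑ i, ∑ k, Matrix.diagonal (rowDev Y N lam ω) i k ^ 2 = ∑ i, rowDev Y N lam ω i ^ 2 := by
    refine Finset.sum_congr rfl fun i _ => ?_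
    simp [Matrix.diagonal_apply, ite_pow]
  rw [h1]
  calc _ ≤ c ^ 2 * n * (∑ s ∈ N, lam s ^ 2) * ‖u‖ ^ 2 :=
        mul_le_mul_of_nonneg_right h.len (by positivity)
    _ = _ := by
        rw [mul_pow, mul_pow, mul_pow, Real.sq_sqrt (Nat.cast_nonneg _),
          Real.sq_sqrt (Finset.sum_nonneg fun _ _ => sq_nonneg _)]

lemma norm_gramDev_le (h : IsGoodSample Y N m lam c δ ω) (hc : 0 ≤ c) (hδ : 0 ≤ δ)
    (u : EuclideanSpace ℝ (Fin n)) :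
    ‖gramDev Y N lam ω u‖ ≤
      (δ * n + c * Real.sqrt n) * Real.sqrt (∑ s ∈ N, lam s ^ 2) * ‖u‖ := by
  refine (norm_add_le _ _).trans ((add_le_add (h.norm_offDiagGram_le hδ u)
    (h.norm_rowDev_le hc u)).trans (le_of_eq (by ring)))

lemma norm_scoreCol_le (h : IsGoodSample Y N m lam c δ ω) (hc : 0 ≤ c) (hn : 2 ≤ n) {s : ℕ}
    (hs : s ∈ Finset.Icc 1 m) (hl : 0 < lam s) :
    ‖scoreCol Y ω s‖ ≤ (1 + c) * Real.sqrt n * Real.sqrt (lam s) := by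
  refine (pow_le_pow_iff_left₀ (norm_nonneg _) (by positivity) (by norm_num : 2 ≠ 0)).1 ?_
  have h1 := (abs_le.1 (h.gram s hs s hs)).2
  have hn1 : (1 : ℝ) ≤ n := by exact_mod_cast (by omega : 1 ≤ n)
  rw [Finset.sum_sub_distrib, if_pos rfl, Finset.sum_const, Finset.card_univ, Fintype.card_fin,
    nsmul_eq_mul, Real.mul_self_sqrt hl.le] at h1
  rw [← real_inner_self_eq_norm_sq, inner_scoreCol, mul_pow, mul_pow,
    Real.sq_sqrt (Nat.cast_nonneg _), Real.sq_sqrt hl.le]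
  have h2 : Real.sqrt n ≤ n := by
    rw [Real.sqrt_le_left (by positivity)]; nlinarith
  have h3 : c * Real.sqrt n * lam s ≤ c * n * lam s := by gcongr
  have h4 : (n + c * n) * lam s ≤ (1 + c) ^ 2 * n * lam s := by
    refine mul_le_mul_of_nonneg_right ?_ hl.le
    nlinarith [mul_nonneg hc (by linarith : (0 : ℝ) ≤ n),
      mul_nonneg (mul_nonneg hc hc) (by linarith : (0 : ℝ) ≤ n)]
  linarith

/-- For the off-diagonal part the bound `cross` replaces the operator norm, giving order n instead
of δ n^{3/2}. The diagonal part already has operator norm of order √n. -/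
lemma norm_gramDev_scoreCol_le (h : IsGoodSample Y N m lam c δ ω) (hc : 0 ≤ c)
    (hn : 2 ≤ n) {s : ℕ} (hs : s ∈ Finset.Icc 1 m) (hl : 0 < lam s) :
    ‖gramDev Y N lam ω (scoreCol Y ω s)‖ ≤
      (2 * c + c ^ 2) * n * Real.sqrt (∑ s ∈ N, lam s ^ 2) * Real.sqrt (lam s) := by
  set τ := Real.sqrt (∑ s ∈ N, lam s ^ 2) with hτ
  have h1 : ‖Matrix.toEuclideanLin (Matrix.of (offDiagGram Y N ω)) (scoreCol Y ω s)‖ ≤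
      c * n * τ * Real.sqrt (lam s) := by
    refine (pow_le_pow_iff_left₀ (norm_nonneg _) (by positivity) (by norm_num : 2 ≠ 0)).1 ?_
    rw [EuclideanSpace.real_norm_sq_eq]
    simp only [toEuclideanLin_coord, Matrix.of_apply]
    refine (h.cross s hs).trans (le_of_eq ?_)
    rw [mul_pow, mul_pow, mul_pow, hτ, Real.sq_sqrt hl.le,
      Real.sq_sqrt (Finset.sum_nonneg fun _ _ => sq_nonneg _)]
  have h2 : ‖Matrix.toEuclideanLin (Matrix.diagonal (rowDev Y N lam ω)) (scoreCol Y ω s)‖ ≤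
      c * (1 + c) * n * τ * Real.sqrt (lam s) := by
    refine (h.norm_rowDev_le hc _).trans ?_
    calc _ ≤ c * Real.sqrt n * τ * ((1 + c) * Real.sqrt n * Real.sqrt (lam s)) :=
          mul_le_mul_of_nonneg_left (h.norm_scoreCol_le hc hn hs hl) (by positivity)
      _ = c * (1 + c) * (Real.sqrt n * Real.sqrt n) * τ * Real.sqrt (lam s) := by ring
      _ = _ := by rw [Real.mul_self_sqrt (Nat.cast_nonneg _)]
  exact (norm_add_le _ _).trans ((add_le_add h1 h2).trans (le_of_eq (by ring)))

/-- Centring subtracts the mean score, of order √(lam s)/√n, times the vector of ones; with so small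
a coefficient the crude operator bound on the ones is sufficient. -/
lemma norm_gramDev_centering_scoreCol_le (h : IsGoodSample Y N m lam c δ ω) (hc : 0 ≤ c)
    (hδ : 0 ≤ δ) (hδ1 : δ ≤ 1) (hn : 2 ≤ n) {s : ℕ} (hs : s ∈ Finset.Icc 1 m) (hl : 0 < lam s) :
    ‖gramDev Y N lam ω (centering n (scoreCol Y ω s))‖ ≤
      (3 * c + 2 * c ^ 2) * n * Real.sqrt (∑ s ∈ N, lam s ^ 2) * Real.sqrt (lam s) := by
  have h1 := h.norm_gramDev_scoreCol_le hc hn hs hl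
  have h2 := h.norm_gramDev_le hc hδ (onesVec n)
  set τ := Real.sqrt (∑ s ∈ N, lam s ^ 2) with hτ
  have hn1 : (1 : ℝ) ≤ n := by exact_mod_cast (by omega : 1 ≤ n)
  have hn0 : (0 : ℝ) < n := by linarith
  have hsq : Real.sqrt n * Real.sqrt n = n := Real.mul_self_sqrt hn0.le
  have hsn : Real.sqrt n ≤ n := by
    rw [Real.sqrt_le_left (by positivity)]; nlinarith
  rw [centering_apply, map_sub, map_smul]
  have h3 : ‖((n : ℝ)⁻¹ * ⟪onesVec n, scoreCol Y ω s⟫) • gramDev Y N lam ω (onesVec n)‖ ≤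
      (c + c ^ 2) * n * τ * Real.sqrt (lam s) := by
    rw [norm_smul, Real.norm_eq_abs, abs_mul, abs_of_pos (inv_pos.2 hn0), inner_onesVec]
    calc _ ≤ (n : ℝ)⁻¹ * (c * Real.sqrt n * Real.sqrt (lam s)) *
          ((δ * n + c * Real.sqrt n) * τ * Real.sqrt n) := by
          rw [norm_onesVec] at h2
          exact mul_le_mul (mul_le_mul_of_nonneg_left (h.sum s hs) (by positivity)) h2
            (norm_nonneg _) (by positivity)
      _ = (n : ℝ)⁻¹ * (Real.sqrt n * Real.sqrt n) * (c * δ * n + c ^ 2 * Real.sqrt n) * τ *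
          Real.sqrt (lam s) := by ring
      _ = (c * δ * n + c ^ 2 * Real.sqrt n) * τ * Real.sqrt (lam s) := by
          rw [hsq, inv_mul_cancel₀ hn0.ne', one_mul]
      _ ≤ _ := by
          have : c * δ * n + c ^ 2 * Real.sqrt n ≤ (c + c ^ 2) * n := by
            have := mul_le_mul_of_nonneg_left hδ1 (mul_nonneg hc hn0.le)
            have := mul_le_mul_of_nonneg_left hsn (sq_nonneg c)
            linarith
          gcongr
  exact (norm_sub_le _ _).trans ((add_le_add h1 h3).trans (le_of_eq (by ring)))

end IsGoodSample

/-- The normalized direction of the score `s` in the sample space. -/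
noncomputable def spikeDir (Y : Fin n → Ω → ℕ → ℝ) (lam : ℕ → ℝ) (ω : Ω) (s : ℕ) :
    EuclideanSpace ℝ (Fin n) :=
  (Real.sqrt ((n : ℝ) - 1) * Real.sqrt (lam s))⁻¹ • centering n (scoreCol Y ω s)

/-- The centred fluctuation of the noise part of the dual covariance operator. -/
noncomputable def noiseOp (Y : Fin n → Ω → ℕ → ℝ) (N : Finset ℕ) (lam : ℕ → ℝ) (ω : Ω) :
    EuclideanSpace ℝ (Fin n) →ₗ[ℝ] EuclideanSpace ℝ (Fin n) :=
  ((n : ℝ) - 1)⁻¹ • (centering n ∘ₗ gramDev Y N lam ω ∘ₗ centering n)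

lemma noiseOp_apply (u : EuclideanSpace ℝ (Fin n)) : noiseOp Y N lam ω u =
    ((n : ℝ) - 1)⁻¹ • centering n (gramDev Y N lam ω (centering n u)) := rfl

lemma noiseOp_symm : (noiseOp Y N lam ω).IsSymmetric := fun x y => by
  rw [noiseOp_apply, noiseOp_apply, real_inner_smul_left, real_inner_smul_right, centering_symm,
    gramDev_symm, centering_symm]

lemma inv_sub_one_le {n : ℕ} (hn : 2 ≤ n) : ((n : ℝ) - 1)⁻¹ ≤ 2 / n := by
  have : (2 : ℝ) ≤ n := by exact_mod_cast hn
  rw [inv_eq_one_div, div_le_div_iff₀ (by linarith) (by linarith)]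
  linarith

lemma inv_sqrt_sub_one_le {n : ℕ} (hn : 2 ≤ n) : (Real.sqrt ((n : ℝ) - 1))⁻¹ ≤ 2 / Real.sqrt n := by
  have h2 : (2 : ℝ) ≤ n := by exact_mod_cast hn
  rw [inv_le_comm₀ (Real.sqrt_pos.2 (by linarith)) (by positivity), inv_div,
    div_le_iff₀ (by norm_num)]
  have : Real.sqrt (4 * ((n : ℝ) - 1)) = Real.sqrt ((n : ℝ) - 1) * 2 := by
    rw [Real.sqrt_mul (by norm_num), show (4 : ℝ) = 2 ^ 2 by norm_num,
      Real.sqrt_sq (by norm_num), mul_comm]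
  rw [← this]
  exact Real.sqrt_le_sqrt (by linarith)

namespace IsGoodSample

/-- The terms of 1 + c + c² are three errors: n − 1 in place of n, the fluctuation of the sample
second moments, and the product of the sample means removed by centring. -/
lemma nearlyOrthonormal (h : IsGoodSample Y N m lam c δ ω) (hc : 0 ≤ c) (hn : 2 ≤ n)
    (hl : ∀ s ∈ Finset.Icc 1 m, 0 < lam s) :
    NearlyOrthonormal (Finset.Icc 1 m) (spikeDir Y lam ω)
      (2 * (1 + c + c ^ 2) / Real.sqrt n) := by
  intro s hs t ht
  have h2n : (2 : ℝ) ≤ n := by exact_mod_cast hn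
  have hn0 : (0 : ℝ) < n := by linarith
  have hn1 : (0 : ℝ) < (n : ℝ) - 1 := by linarith
  have hls := Real.sqrt_pos.2 (hl s hs)
  have hlt := Real.sqrt_pos.2 (hl t ht)
  have hsq : Real.sqrt n * Real.sqrt n = n := Real.mul_self_sqrt hn0.le
  have hsn : 0 < Real.sqrt n := Real.sqrt_pos.2 hn0
  have hs1 : 1 ≤ Real.sqrt n := by rw [Real.one_le_sqrt]; linarith
  set L := Real.sqrt (lam s) * Real.sqrt (lam t) with hL
  have hL0 : 0 < L := by positivity
  have h1 := h.gram s hs t ht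
  have h2 : |(n : ℝ)⁻¹ * ((∑ i, Y i ω s) * ∑ i, Y i ω t)| ≤ c ^ 2 * L := by
    rw [abs_mul, abs_mul, abs_of_pos (inv_pos.2 hn0)]
    calc _ ≤ (n : ℝ)⁻¹ * ((c * Real.sqrt n * Real.sqrt (lam s)) *
          (c * Real.sqrt n * Real.sqrt (lam t))) :=
          mul_le_mul_of_nonneg_left (mul_le_mul (h.sum s hs) (h.sum t ht) (abs_nonneg _)
            (by positivity)) (by positivity)
      _ = (n : ℝ)⁻¹ * (Real.sqrt n * Real.sqrt n) * (c ^ 2 * L) := by rw [hL]; ring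
      _ = _ := by rw [hsq, inv_mul_cancel₀ hn0.ne', one_mul]
  rw [Finset.sum_sub_distrib, Finset.sum_const, Finset.card_univ, Fintype.card_fin,
    nsmul_eq_mul] at h1
  have hδL : (if s = t then lam s else 0) = (if s = t then (1 : ℝ) else 0) * L := by
    split_ifs with hst
    · subst hst; rw [hL, Real.mul_self_sqrt (hl s hs).le, one_mul]
    · ring
  rw [hδL] at h1
  set e : ℝ := if s = t then 1 else 0 with he
  have he1 : |e| ≤ 1 := by rw [he]; split_ifs <;> simp
  have hinner : ⟪spikeDir Y lam ω s, spikeDir Y lam ω t⟫ - e =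
      (((n : ℝ) - 1) * L)⁻¹ * ((∑ i, Y i ω s * Y i ω t - n * (e * L)) -
        (n : ℝ)⁻¹ * ((∑ i, Y i ω s) * ∑ i, Y i ω t) + e * L) := by
    rw [spikeDir, spikeDir, real_inner_smul_left, real_inner_smul_right,
      inner_centering_centering, inner_centering, inner_scoreCol, inner_onesVec, inner_onesVec]
    simp only [scoreCol]
    have h3 : (Real.sqrt ((n : ℝ) - 1) * Real.sqrt (lam s))⁻¹ *
        (Real.sqrt ((n : ℝ) - 1) * Real.sqrt (lam t))⁻¹ = (((n : ℝ) - 1) * L)⁻¹ := by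
      rw [← mul_inv, mul_mul_mul_comm, Real.mul_self_sqrt hn1.le, hL]
    rw [← mul_assoc, h3]
    have h4 : e = (((n : ℝ) - 1) * L)⁻¹ * ((n - 1) * (e * L)) := by field_simp
    nth_rw 1 [h4]
    ring
  rw [hinner, abs_mul, abs_of_pos (by positivity)]
  have h5 : |(∑ i, Y i ω s * Y i ω t - n * (e * L)) -
        (n : ℝ)⁻¹ * ((∑ i, Y i ω s) * ∑ i, Y i ω t) + e * L| ≤
      (1 + c + c ^ 2) * Real.sqrt n * L := by
    have h6 : c ^ 2 * L ≤ c ^ 2 * Real.sqrt n * L := by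
      have : c ^ 2 * 1 ≤ c ^ 2 * Real.sqrt n := by gcongr
      nlinarith
    have h7 : |e * L| ≤ Real.sqrt n * L := by
      rw [abs_mul, abs_of_pos hL0]; nlinarith
    refine (abs_add_le _ _).trans ((add_le_add ((abs_sub _ _).trans (add_le_add h1 h2)) h7).trans ?_)
    nlinarith
  calc _ ≤ (((n : ℝ) - 1) * L)⁻¹ * ((1 + c + c ^ 2) * Real.sqrt n * L) :=
        mul_le_mul_of_nonneg_left h5 (by positivity)
    _ = ((n : ℝ) - 1)⁻¹ * ((1 + c + c ^ 2) * Real.sqrt n) := by field_simp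
    _ ≤ 2 / n * ((1 + c + c ^ 2) * Real.sqrt n) :=
        mul_le_mul_of_nonneg_right (inv_sub_one_le hn) (by positivity)
    _ = _ := by
        nth_rw 1 [← hsq]
        field_simp

lemma norm_noiseOp_le (h : IsGoodSample Y N m lam c δ ω) (hc : 0 ≤ c) (hδ : 0 ≤ δ)
    (hn : 2 ≤ n) (u : EuclideanSpace ℝ (Fin n)) :
    ‖noiseOp Y N lam ω u‖ ≤
      2 * (δ + c / Real.sqrt n) * Real.sqrt (∑ s ∈ N, lam s ^ 2) * ‖u‖ := by
  have h2n : (2 : ℝ) ≤ n := by exact_mod_cast hn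
  have hn0 : (0 : ℝ) < n := by linarith
  have hn1 : (0 : ℝ) < (n : ℝ) - 1 := by linarith
  have hsn : 0 < Real.sqrt n := Real.sqrt_pos.2 hn0
  have hsq : Real.sqrt n * Real.sqrt n = n := Real.mul_self_sqrt hn0.le
  rw [noiseOp_apply, norm_smul, Real.norm_eq_abs, abs_of_pos (inv_pos.2 hn1)]
  calc _ ≤ 2 / n * ((δ * n + c * Real.sqrt n) * Real.sqrt (∑ s ∈ N, lam s ^ 2) * ‖u‖) := by
        refine mul_le_mul (inv_sub_one_le hn) ?_ (norm_nonneg _) (by positivity)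
        refine (norm_centering_le _).trans ((h.norm_gramDev_le hc hδ _).trans ?_)
        exact mul_le_mul_of_nonneg_left (norm_centering_le u) (by positivity)
    _ = 2 * (δ * (n / n) + c * (Real.sqrt n / n)) * Real.sqrt (∑ s ∈ N, lam s ^ 2) * ‖u‖ := by
        ring
    _ = _ := by
        have : Real.sqrt n / n = 1 / Real.sqrt n := by
          nth_rw 2 [← hsq]; field_simp
        rw [div_self hn0.ne', this]; ring

lemma norm_noiseOp_spikeDir_le (h : IsGoodSample Y N m lam c δ ω) (hc : 0 ≤ c) (hδ : 0 ≤ δ)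
    (hδ1 : δ ≤ 1) (hn : 2 ≤ n) {s : ℕ} (hs : s ∈ Finset.Icc 1 m) (hl : 0 < lam s) :
    ‖noiseOp Y N lam ω (spikeDir Y lam ω s)‖ ≤
      4 * (3 * c + 2 * c ^ 2) / Real.sqrt n * Real.sqrt (∑ s ∈ N, lam s ^ 2) := by
  have h2n : (2 : ℝ) ≤ n := by exact_mod_cast hn
  have hn0 : (0 : ℝ) < n := by linarith
  have hn1 : (0 : ℝ) < (n : ℝ) - 1 := by linarith
  have hls := Real.sqrt_pos.2 hl
  have h1 := h.norm_gramDev_centering_scoreCol_le hc hδ hδ1 hn hs hl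
  set τ := Real.sqrt (∑ s ∈ N, lam s ^ 2) with hτ
  rw [noiseOp_apply, spikeDir, map_smul, map_smul, map_smul, centering_idem, norm_smul, norm_smul,
    Real.norm_eq_abs, Real.norm_eq_abs, abs_of_pos (inv_pos.2 hn1),
    abs_of_pos (inv_pos.2 (mul_pos (Real.sqrt_pos.2 hn1) hls)), mul_inv]
  calc _ ≤ 2 / n * ((2 / Real.sqrt n * (Real.sqrt (lam s))⁻¹) *
        ((3 * c + 2 * c ^ 2) * n * τ * Real.sqrt (lam s))) := by
        refine mul_le_mul (inv_sub_one_le hn) ?_ (by positivity) (by positivity)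
        refine mul_le_mul (mul_le_mul_of_nonneg_right (inv_sqrt_sub_one_le hn) (by positivity))
          ((norm_centering_le _).trans h1) (norm_nonneg _) (by positivity)
    _ = _ := by field_simp; ring

/-- The total centred noise variance. -/
lemma abs_sum_norm_centering_sub_le (h : IsGoodSample Y N m lam c δ ω) (hc : 0 ≤ c)
    (hδ : 0 ≤ δ) (hδ1 : δ ≤ 1) (hn : 2 ≤ n) :
    |((n : ℝ) - 1)⁻¹ * ∑ s ∈ N, ‖centering n (scoreCol Y ω s)‖ ^ 2 - ∑ s ∈ N, lam s| ≤
      (4 * c + 2) * Real.sqrt (∑ s ∈ N, lam s ^ 2) := by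
  have h2n : (2 : ℝ) ≤ n := by exact_mod_cast hn
  have hn0 : (0 : ℝ) < n := by linarith
  have hn1 : (0 : ℝ) < (n : ℝ) - 1 := by linarith
  have hsq : Real.sqrt n * Real.sqrt n = n := Real.mul_self_sqrt hn0.le
  have hsn : Real.sqrt n ≤ n := by
    rw [Real.sqrt_le_left (by positivity)]; nlinarith
  have hg := h.norm_gramDev_le hc hδ (onesVec n)
  set τ := Real.sqrt (∑ s ∈ N, lam s ^ 2) with hτ
  -- The deviation of the total noise is expressed through the row deviations and the form of
  -- `gramDev` at the ones, both already bounded on a good sample.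
  have h1 : ∑ s ∈ N, ‖centering n (scoreCol Y ω s)‖ ^ 2 - ((n : ℝ) - 1) * ∑ s ∈ N, lam s =
      ∑ i, rowDev Y N lam ω i - (n : ℝ)⁻¹ * ⟪onesVec n, gramDev Y N lam ω (onesVec n)⟫ := by
    have e1 : ∑ s ∈ N, ‖centering n (scoreCol Y ω s)‖ ^ 2 =
        ∑ s ∈ N, ∑ i, Y i ω s ^ 2 -
          (n : ℝ)⁻¹ * ∑ s ∈ N, ⟪onesVec n, scoreCol Y ω s⟫ ^ 2 := by
      rw [Finset.mul_sum, ← Finset.sum_sub_distrib]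
      refine Finset.sum_congr rfl fun s _ => ?_
      rw [← real_inner_self_eq_norm_sq, inner_centering_centering, inner_centering,
        inner_scoreCol]
      simp only [sq]
    have e2 : ⟪onesVec n, gramDev Y N lam ω (onesVec n)⟫ =
        ∑ s ∈ N, ⟪onesVec n, scoreCol Y ω s⟫ ^ 2 - (∑ s ∈ N, lam s) * n := by
      rw [gramDev_apply, inner_sub_right, real_inner_smul_right, real_inner_self_eq_norm_sq,
        norm_onesVec_sq, inner_sum]
      congr 1
      refine Finset.sum_congr rfl fun s _ => ?_
      rw [real_inner_smul_right, real_inner_comm (onesVec n), sq]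
    rw [e1, e2, Finset.sum_comm]
    simp only [rowDev, Finset.sum_sub_distrib, Finset.sum_const, Finset.card_univ,
      Fintype.card_fin, nsmul_eq_mul]
    field_simp
    ring
  have h2 : |∑ i, rowDev Y N lam ω i| ≤ c * n * τ := by
    refine abs_le_of_sq_le_sq ?_ (by positivity)
    have := sq_sum_le_card_mul_sum_sq (s := Finset.univ) (f := rowDev Y N lam ω)
    rw [Finset.card_univ, Fintype.card_fin] at this
    refine this.trans ((mul_le_mul_of_nonneg_left h.len hn0.le).trans (le_of_eq ?_))
    rw [mul_pow, mul_pow, hτ, Real.sq_sqrt (Finset.sum_nonneg fun _ _ => sq_nonneg _)]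
    ring
  have h3 : |(n : ℝ)⁻¹ * ⟪onesVec n, gramDev Y N lam ω (onesVec n)⟫| ≤ (1 + c) * n * τ := by
    rw [abs_mul, abs_of_pos (inv_pos.2 hn0)]
    calc _ ≤ (n : ℝ)⁻¹ * (Real.sqrt n * ((δ * n + c * Real.sqrt n) * τ * Real.sqrt n)) := by
          refine mul_le_mul_of_nonneg_left ?_ (by positivity)
          refine (abs_real_inner_le_norm _ _).trans ?_
          rw [norm_onesVec] at hg ⊢
          exact mul_le_mul_of_nonneg_left hg (Real.sqrt_nonneg _)
      _ = (n : ℝ)⁻¹ * (Real.sqrt n * Real.sqrt n) * (δ * n + c * Real.sqrt n) * τ := by ring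
      _ = (δ * n + c * Real.sqrt n) * τ := by rw [hsq, inv_mul_cancel₀ hn0.ne', one_mul]
      _ ≤ _ := by
          have : δ * n + c * Real.sqrt n ≤ (1 + c) * n := by
            have := mul_le_mul_of_nonneg_right hδ1 hn0.le
            have := mul_le_mul_of_nonneg_left hsn hc
            linarith
          exact mul_le_mul_of_nonneg_right this (Real.sqrt_nonneg _)
  have h4 : ((n : ℝ) - 1)⁻¹ * ∑ s ∈ N, ‖centering n (scoreCol Y ω s)‖ ^ 2 - ∑ s ∈ N, lam s =
      ((n : ℝ) - 1)⁻¹ * (∑ i, rowDev Y N lam ω i -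
        (n : ℝ)⁻¹ * ⟪onesVec n, gramDev Y N lam ω (onesVec n)⟫) := by
    rw [← h1]
    field_simp
  rw [h4, abs_mul, abs_of_pos (inv_pos.2 hn1)]
  calc _ ≤ 2 / n * (c * n * τ + (1 + c) * n * τ) :=
        mul_le_mul (inv_sub_one_le hn) ((abs_sub _ _).trans (add_le_add h2 h3)) (abs_nonneg _)
          (by positivity)
    _ = _ := by field_simp; ring

/-- On a good sample, the dual covariance operator is a spiked perturbation. -/
lemma spikedPerturbation (h : IsGoodSample Y N m lam c δ ω) (hc : 0 ≤ c) (hδ : 0 ≤ δ)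
    (hδ1 : δ ≤ 1) (hn : 2 ≤ n) (hm : 1 ≤ m) (hanti : AntitoneOn lam (Finset.Icc 1 m))
    (hpos : 0 < lam m) (hN : ∀ s ∈ N, 0 ≤ lam s) {g Q ρ : ℝ} (hg0 : 0 < g) (hg1 : g ≤ 1)
    (hgap : ∀ j ∈ Finset.Icc 1 m, ∀ j' ∈ Finset.Icc 1 m, j < j' → (1 + g) * lam j' ≤ lam j)
    (hQ0 : 0 ≤ Q) (hQ : Real.sqrt (∑ s ∈ N, lam s ^ 2) ≤ Q * lam m)
    (hρ : ρ = 12 * (1 + c) ^ 2 * (1 + Q) / Real.sqrt n) (hsmall : 300 * m * (2 * Q * δ + ρ) ≤ g)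
    {A : EuclideanSpace ℝ (Fin n) →ₗ[ℝ] EuclideanSpace ℝ (Fin n)}
    (hA : ∀ u, A u = ((n : ℝ) - 1)⁻¹ •
      (∑ s ∈ Finset.Icc 1 m, ⟪centering n (scoreCol Y ω s), u⟫ • centering n (scoreCol Y ω s) +
        ∑ s ∈ N, ⟪centering n (scoreCol Y ω s), u⟫ • centering n (scoreCol Y ω s))) :
    SpikedPerturbation m A (centering n) (noiseOp Y N lam ω) lam (spikeDir Y lam ω)
      (((n : ℝ) - 1)⁻¹ * ∑ s ∈ N, lam s) g (2 * Q * δ + ρ) ρ := by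
  have h2n : (2 : ℝ) ≤ n := by exact_mod_cast hn
  have hn0 : (0 : ℝ) < n := by linarith
  have hn1 : (0 : ℝ) < (n : ℝ) - 1 := by linarith
  have hsn : 0 < Real.sqrt n := Real.sqrt_pos.2 hn0
  have hlpos : ∀ s ∈ Finset.Icc 1 m, 0 < lam s := fun s hs =>
    hpos.trans_le (hanti (by exact_mod_cast hs) (by simpa using hm) (Finset.mem_Icc.1 hs).2)
  have hρ0 : 0 ≤ ρ := by rw [hρ]; positivity
  refine
    { apply_eq := fun u => ?_
      one_le := hm
      anti := hanti
      pos := hpos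
      gap := hgap
      proj_symm := centering_symm
      proj_idem := centering_idem
      proj_spike := fun s _ => by rw [spikeDir, map_smul, centering_idem]
      proj_noise := fun u => by rw [noiseOp_apply, map_smul, centering_idem]
      noise_symm := noiseOp_symm
      noise_le := fun u => ?_
      noise_spike_le := fun s hs => ?_
      gram := fun s hs t ht => (h.nearlyOrthonormal hc hn hlpos s hs t ht).trans ?_
      shift_nonneg := mul_nonneg (inv_nonneg.2 hn1.le) (Finset.sum_nonneg hN)
      gap_pos := hg0
      gap_le := hg1
      rho_nonneg := hρ0
      rho_le := by nlinarith [mul_nonneg hQ0 hδ]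
      small := hsmall }
  · rw [hA, noiseOp_apply, gramDev_apply, map_sub, map_sum, map_smul, centering_idem,
      add_assoc, mul_smul, ← smul_add, smul_add]
    congr 1
    · rw [Finset.smul_sum]
      refine Finset.sum_congr rfl fun s hs => ?_
      have hls := hlpos s hs
      rw [spikeDir, real_inner_smul_left, smul_smul, smul_smul]
      congr 1
      have e5 : Real.sqrt ((n : ℝ) - 1) * Real.sqrt (lam s) *
          (Real.sqrt ((n : ℝ) - 1) * Real.sqrt (lam s)) = ((n : ℝ) - 1) * lam s := by
        rw [mul_mul_mul_comm, Real.mul_self_sqrt hn1.le, Real.mul_self_sqrt hls.le]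
      have e6 : lam s * ((Real.sqrt ((n : ℝ) - 1) * Real.sqrt (lam s))⁻¹ *
          (Real.sqrt ((n : ℝ) - 1) * Real.sqrt (lam s))⁻¹) = ((n : ℝ) - 1)⁻¹ := by
        rw [← mul_inv, e5]
        field_simp
      rw [← e6]
      ring
    · congr 1
      -- The κP term restores the mean subtracted in `gramDev`, so the noise sum is recovered
      -- exactly.
      rw [add_sub_cancel]
      refine Finset.sum_congr rfl fun s _ => ?_
      rw [map_smul, centering_symm]
  · refine (h.norm_noiseOp_le hc hδ hn u).trans (mul_le_mul_of_nonneg_right ?_ (norm_nonneg _))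
    calc _ ≤ 2 * (δ + c / Real.sqrt n) * (Q * lam m) :=
          mul_le_mul_of_nonneg_left hQ (by positivity)
      _ = (2 * Q * δ + 2 * c * Q / Real.sqrt n) * lam m := by ring
      _ ≤ _ := by
          refine mul_le_mul_of_nonneg_right (add_le_add le_rfl ?_) hpos.le
          rw [hρ]
          refine div_le_div_of_nonneg_right ?_ hsn.le
          nlinarith [mul_nonneg hc hQ0, mul_nonneg (mul_nonneg hc hc) hQ0]
  · refine (h.norm_noiseOp_spikeDir_le hc hδ hδ1 hn hs (hlpos s hs)).trans ?_
    calc _ ≤ 4 * (3 * c + 2 * c ^ 2) / Real.sqrt n * (Q * lam m) :=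
          mul_le_mul_of_nonneg_left hQ (by positivity)
      _ = 4 * (3 * c + 2 * c ^ 2) * Q / Real.sqrt n * lam m := by ring
      _ ≤ _ := by
          refine mul_le_mul_of_nonneg_right ?_ hpos.le
          rw [hρ]
          refine div_le_div_of_nonneg_right ?_ hsn.le
          nlinarith [mul_nonneg hc hQ0, mul_nonneg (mul_nonneg hc hc) hQ0, mul_nonneg hc hc]
  · rw [hρ]
    refine div_le_div_of_nonneg_right ?_ hsn.le
    nlinarith [mul_nonneg hc hQ0, mul_nonneg (mul_nonneg hc hc) hQ0, mul_nonneg hc hc]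

end IsGoodSample

end GoodSample

/-! ### The sampling model in terms of scores and the dual operator. -/

section Model

namespace SampleModel

variable {d n : ℕ} (S : SampleModel.{u} d n)

local notation "⟪" x ", " y "⟫" => inner ℝ x y

/-- The score of the `i`-th observation on the `s`-th PC direction. -/
def score (i : Fin n) (ω : S.Ω) (s : ℕ) : ℝ := S.h s ⬝ᵥ (S.x i ω - S.mu)

lemma h_dotProduct {s t : ℕ} (hs : s ∈ Finset.Icc 1 d) (ht : t ∈ Finset.Icc 1 d) :
    S.h s ⬝ᵥ S.h t = if s = t then 1 else 0 :=
  S.spectral.2.1 s (by simpa using hs) t (by simpa using ht)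

lemma centred_obs_eq (i : Fin n) (ω : S.Ω) : S.x i ω - S.mu =
    ∑ s ∈ Finset.Icc 1 d, (Real.sqrt (S.lam s) * S.z i s ω) • S.h s := by
  ext a
  simp only [Pi.sub_apply, S.sphering, Finset.sum_apply, Pi.smul_apply, smul_eq_mul]

lemma score_eq (i : Fin n) (ω : S.Ω) {s : ℕ} (hs : s ∈ Finset.Icc 1 d) :
    S.score i ω s = Real.sqrt (S.lam s) * S.z i s ω := by
  rw [score, centred_obs_eq, dotProduct_sum, Finset.sum_eq_single_of_mem s hs]
  · rw [dotProduct_smul, S.h_dotProduct hs hs, if_pos rfl, smul_eq_mul, mul_one]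
  · intro t ht hts
    rw [dotProduct_smul, S.h_dotProduct hs ht, if_neg (Ne.symm hts), smul_zero]

lemma centred_obs_apply (i : Fin n) (ω : S.Ω) (a : Fin d) :
    S.x i ω a - S.mu a = ∑ s ∈ Finset.Icc 1 d, S.score i ω s * S.h s a := by
  rw [S.sphering]
  exact Finset.sum_congr rfl fun s hs => by rw [S.score_eq i ω hs]

lemma measurable_dotProduct_sub (v : Fin d → ℝ) :
    Measurable fun x : Fin d → ℝ => v ⬝ᵥ (x - S.mu) := by
  unfold dotProduct
  fun_prop

lemma measurable_score (i : Fin n) : Measurable (S.score i) :=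
  measurable_pi_lambda _ fun s => (S.measurable_dotProduct_sub (S.h s)).comp (S.measurable_x i)

lemma iIndepFun_score : iIndepFun S.score S.P :=
  S.indep_x.comp (fun _ x s => S.h s ⬝ᵥ (x - S.mu))
    fun _ => measurable_pi_lambda _ fun s => S.measurable_dotProduct_sub (S.h s)

/-- The variance stays in the form (√λ_s)², because nonnegativity of the eigenvalues is not yet
available; it will be deduced from this. -/
lemma hasMean_score_mul (i : Fin n) {s t : ℕ} (hs : s ∈ Finset.Icc 1 d)
    (ht : t ∈ Finset.Icc 1 d) :
    HasMean S.P (fun ω => S.score i ω s * S.score i ω t)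
      (if s = t then Real.sqrt (S.lam s) ^ 2 else 0) := by
  have hz : HasMean S.P (fun ω => S.z i s ω * S.z i t ω) (if s = t then 1 else 0) :=
    ⟨(S.memLp_z i s (by simpa using hs)).integrable_mul (S.memLp_z i t (by simpa using ht)),
      S.cov_z i s (by simpa using hs) t (by simpa using ht)⟩
  refine (hz.const_mul (Real.sqrt (S.lam s) * Real.sqrt (S.lam t))).congr (fun ω => ?_) ?_
  · rw [S.score_eq i ω hs, S.score_eq i ω ht]; ring
  · split_ifs with hst
    · subst hst; ring
    · ring

lemma spectral_apply (a b : Fin d) :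
    S.Sig a b = ∑ s ∈ Finset.Icc 1 d, S.lam s * (S.h s a * S.h s b) := by
  have h := S.spectral.2.2
  conv_lhs => rw [h]
  simp [Matrix.sum_apply, vecMulVec_apply]

lemma cov_apply (i : Fin n) (a b : Fin d) :
    S.Sig a b = ∑ s ∈ Finset.Icc 1 d, Real.sqrt (S.lam s) ^ 2 * (S.h s a * S.h s b) := by
  rw [← S.cov_x i]
  refine (HasMean.congr (HasMean.sum fun s hs => HasMean.sum fun t ht =>
    (S.hasMean_score_mul i hs ht).const_mul (S.h s a * S.h t b)) (fun ω => ?_) ?_).2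
  · rw [S.centred_obs_apply, S.centred_obs_apply, Finset.sum_mul_sum]
    exact Finset.sum_congr rfl fun s _ => Finset.sum_congr rfl fun t _ => by ring
  · refine Finset.sum_congr rfl fun s hs => ?_
    simp only [mul_ite, mul_zero, Finset.sum_ite_eq, hs, if_true]
    ring

/-- Sphering writes the covariance with coefficients (√λ_s)², the spectral decomposition with λ_s.
Testing both against h_s gives λ_s = (√λ_s)² ≥ 0, also excluding the case where the square root of a
negative number defaults to 0. One observation is needed to have the sphering identity at all. -/
lemma lam_nonneg (hn : 0 < n) {s : ℕ} (hs : s ∈ Finset.Icc 1 d) : 0 ≤ S.lam s := by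
  have key : ∀ c : ℕ → ℝ, (∀ a b, S.Sig a b = ∑ t ∈ Finset.Icc 1 d, c t * (S.h t a * S.h t b)) →
      S.h s ⬝ᵥ (S.Sig *ᵥ S.h s) = c s := by
    intro c hc
    have hS : S.Sig = ∑ t ∈ Finset.Icc 1 d, c t • vecMulVec (S.h t) (S.h t) := by
      ext a b
      rw [hc]
      simp [Matrix.sum_apply, vecMulVec_apply]
    rw [hS, Matrix.sum_mulVec, dotProduct_sum, Finset.sum_eq_single_of_mem s hs]
    · rw [smul_mulVec, dotProduct_smul, vecMulVec_mulVec, dotProduct_smul,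
        S.h_dotProduct hs hs]
      simp
    · intro t ht hts
      rw [smul_mulVec, dotProduct_smul, vecMulVec_mulVec, dotProduct_smul,
        S.h_dotProduct hs ht, if_neg (Ne.symm hts)]
      simp
  rw [← key S.lam S.spectral_apply, key _ (S.cov_apply ⟨0, hn⟩)]
  positivity

lemma sq_sqrt_lam (hn : 0 < n) {s : ℕ} (hs : s ∈ Finset.Icc 1 d) :
    Real.sqrt (S.lam s) ^ 2 = S.lam s := Real.sq_sqrt (S.lam_nonneg hn hs)

lemma sigma_eq (i : Fin n) (a : Fin d) :
    S.sigma i a = ∑ s ∈ Finset.Icc 1 d, S.lam s * S.h s a ^ 2 := by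
  have hm : AEMeasurable (fun ω => S.x i ω a) S.P := (S.memLp_x i a).1.aemeasurable
  rw [sigma, variance_eq_integral hm, S.mean_x]
  have := S.cov_x i a a
  simp only [← sq] at this
  rw [this, S.spectral_apply]
  simp only [sq]

lemma lam_mul_sq_le_sigma (i : Fin n) (a : Fin d) {s : ℕ} (hs : s ∈ Finset.Icc 1 d) :
    S.lam s * S.h s a ^ 2 ≤ S.sigma i a := by
  rw [S.sigma_eq]
  exact Finset.single_le_sum (f := fun s => S.lam s * S.h s a ^ 2)
    (fun t ht => mul_nonneg (S.lam_nonneg i.pos ht) (sq_nonneg _)) hs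

lemma noise_apply {m : ℕ} (hmd : m ≤ d) (i : Fin n) (ω : S.Ω) (a : Fin d) :
    S.noise m i ω a = ∑ s ∈ Finset.Icc (m + 1) d, S.score i ω s * S.h s a := by
  have h1 : S.noise m i ω a =
      (S.x i ω a - S.mu a) - ∑ s ∈ Finset.Icc 1 m, S.score i ω s * S.h s a := by
    rw [noise, noiseProj, sub_mulVec, one_mulVec, Matrix.sum_mulVec]
    simp [vecMulVec_mulVec, score, mul_comm]
  have h2 : Finset.Icc 1 m ∪ Finset.Icc (m + 1) d = Finset.Icc 1 d := by
    ext s; simp only [Finset.mem_union, Finset.mem_Icc]; omega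
  have h3 : Disjoint (Finset.Icc 1 m) (Finset.Icc (m + 1) d) := by
    rw [Finset.disjoint_left]; intro s; simp only [Finset.mem_Icc]; omega
  rw [h1, S.centred_obs_apply, ← h2, Finset.sum_union h3]
  ring

lemma noise_mem {m s : ℕ} (hs : s ∈ Finset.Icc (m + 1) d) : s ∈ Finset.Icc 1 d := by
  simp only [Finset.mem_Icc] at hs ⊢; omega

lemma measurable_noise (m : ℕ) (a : Fin d) :
    Measurable fun x : Fin d → ℝ => (S.noiseProj m *ᵥ (x - S.mu)) a := by
  unfold mulVec
  exact S.measurable_dotProduct_sub _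

/-- Condition (C-ii) bounds only the full variance from above; this transfers that bound to the
noise part, whose variance enters the exponents of (A-ii). -/
lemma sigmaNoise_le {m : ℕ} (hmd : m ≤ d) (i : Fin n) (a : Fin d) :
    S.sigmaNoise m i a ≤ S.sigma i a := by
  have hm : AEStronglyMeasurable (fun ω => S.noise m i ω a) S.P :=
    ((S.measurable_noise m a).comp (S.measurable_x i)).aestronglyMeasurable
  refine (variance_le_expectation_sq hm).trans ?_
  have h1 : HasMean S.P (fun ω => S.noise m i ω a ^ 2)
      (∑ s ∈ Finset.Icc (m + 1) d, S.lam s * S.h s a ^ 2) := by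
    refine HasMean.congr (HasMean.sum (T := Finset.Icc (m + 1) d) fun s hs =>
      HasMean.sum (T := Finset.Icc (m + 1) d) fun t ht =>
      (S.hasMean_score_mul i (noise_mem hs) (noise_mem ht)).const_mul (S.h s a * S.h t a))
      (fun ω => ?_) ?_
    · rw [S.noise_apply hmd, sq, Finset.sum_mul_sum]
      exact Finset.sum_congr rfl fun s _ => Finset.sum_congr rfl fun t _ => by ring
    · refine Finset.sum_congr rfl fun s hs => ?_
      simp only [mul_ite, mul_zero, Finset.sum_ite_eq, hs, if_true]
      rw [S.sq_sqrt_lam i.pos (noise_mem hs)]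
      ring
  refine h1.2.le.trans ?_
  rw [S.sigma_eq]
  exact Finset.sum_le_sum_of_subset_of_nonneg (fun s => noise_mem)
    fun s hs _ => mul_nonneg (S.lam_nonneg i.pos hs) (sq_nonneg _)

lemma trace_noiseCov_sq (m : ℕ) :
    ((S.noiseCov m) ^ 2).trace = ∑ s ∈ Finset.Icc (m + 1) d, S.lam s ^ 2 := by
  rw [sq, noiseCov, Finset.sum_mul_sum, Matrix.trace_sum]
  refine Finset.sum_congr rfl fun s hs => ?_
  rw [Matrix.trace_sum, Finset.sum_eq_single_of_mem s hs]
  · rw [Matrix.smul_mul, Matrix.mul_smul, vecMulVec_mul_vecMulVec, S.h_dotProduct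
      (noise_mem hs) (noise_mem hs)]
    simp only [if_true, Matrix.trace_smul, trace_vecMulVec, one_smul,
      S.h_dotProduct (noise_mem hs) (noise_mem hs), smul_eq_mul]
    ring
  · intro t ht hts
    rw [Matrix.smul_mul, Matrix.mul_smul, vecMulVec_mul_vecMulVec, S.h_dotProduct
      (noise_mem hs) (noise_mem ht), if_neg (Ne.symm hts)]
    simp

/-- Expanding each observation in the h_s makes μ cancel and turns centring of the data into
centring of the score columns. -/
lemma centered_apply (ω : S.Ω) (a : Fin d) (i : Fin n) : S.centered ω a i =
    ∑ s ∈ Finset.Icc 1 d, S.h s a * centering n (scoreCol S.score ω s) i := by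
  have hn : (n : ℝ) ≠ 0 := by exact_mod_cast i.pos.ne'
  have h1 : ∀ l, S.x l ω a = S.mu a + ∑ s ∈ Finset.Icc 1 d, S.score l ω s * S.h s a := fun l => by
    rw [← S.centred_obs_apply]; ring
  simp only [centered, Matrix.of_apply, centering_apply_coord, h1, scoreCol]
  rw [Finset.sum_add_distrib, Finset.sum_comm, Finset.sum_const, Finset.card_univ,
    Fintype.card_fin, nsmul_eq_mul, add_div, mul_div_cancel_left₀ _ hn, add_sub_add_left_eq_sub,
    Finset.sum_div, ← Finset.sum_sub_distrib]
  refine Finset.sum_congr rfl fun s _ => ?_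
  rw [← Finset.sum_mul]
  ring

lemma centered_mulVec (ω : S.Ω) (u : EuclideanSpace ℝ (Fin n)) (a : Fin d) :
    (S.centered ω *ᵥ u.ofLp) a =
      ∑ s ∈ Finset.Icc 1 d, S.h s a * ⟪centering n (scoreCol S.score ω s), u⟫ := by
  simp only [mulVec, dotProduct, S.centered_apply, euclidean_inner_eq_sum, Finset.sum_mul,
    Finset.mul_sum]
  rw [Finset.sum_comm]
  exact Finset.sum_congr rfl fun s _ => Finset.sum_congr rfl fun i _ => by ring

lemma h_dotProduct_centered_mulVec (ω : S.Ω) (u : EuclideanSpace ℝ (Fin n)) {s : ℕ}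
    (hs : s ∈ Finset.Icc 1 d) :
    S.h s ⬝ᵥ (S.centered ω *ᵥ u.ofLp) = ⟪centering n (scoreCol S.score ω s), u⟫ := by
  have h1 : S.centered ω *ᵥ u.ofLp =
      ∑ t ∈ Finset.Icc 1 d, ⟪centering n (scoreCol S.score ω t), u⟫ • S.h t := by
    ext a
    rw [S.centered_mulVec]
    simp [mul_comm]
  rw [h1, dotProduct_sum, Finset.sum_eq_single_of_mem s hs]
  · rw [dotProduct_smul, S.h_dotProduct hs hs, if_pos rfl, smul_eq_mul, mul_one]
  · intro t ht hts
    rw [dotProduct_smul, S.h_dotProduct hs ht, if_neg (Ne.symm hts), smul_zero]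

lemma isHermitian_dualCov (ω : S.Ω) : (S.dualCov ω).IsHermitian := by
  unfold dualCov
  rw [Matrix.IsHermitian, Matrix.conjTranspose_smul, Matrix.conjTranspose_mul]
  simp

lemma gram_centered (ω : S.Ω) : (S.centered ω)ᵀ * S.centered ω =
    Matrix.of fun i k => ∑ s ∈ Finset.Icc 1 d,
      centering n (scoreCol S.score ω s) i * centering n (scoreCol S.score ω s) k := by
  ext i k
  simp only [Matrix.mul_apply, Matrix.transpose_apply, Matrix.of_apply, S.centered_apply,
    Finset.sum_mul_sum]
  rw [Finset.sum_comm]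
  refine Finset.sum_congr rfl fun s hs => ?_
  rw [Finset.sum_comm, Finset.sum_eq_single_of_mem s hs]
  · have h1 := S.h_dotProduct hs hs
    rw [if_pos rfl, dotProduct] at h1
    rw [← mul_one (_ * _), ← h1, Finset.mul_sum]
    exact Finset.sum_congr rfl fun a _ => by ring
  · intro t ht hts
    have h1 := S.h_dotProduct hs ht
    rw [if_neg (Ne.symm hts), dotProduct] at h1
    rw [← mul_zero (centering n (scoreCol S.score ω s) i * centering n (scoreCol S.score ω t) k),
      ← h1, Finset.mul_sum]
    exact Finset.sum_congr rfl fun a _ => by ring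

lemma dualCov_apply {m : ℕ} (hmd : m ≤ d) (ω : S.Ω) (u : EuclideanSpace ℝ (Fin n)) :
    Matrix.toEuclideanLin (S.dualCov ω) u = ((n : ℝ) - 1)⁻¹ •
      (∑ s ∈ Finset.Icc 1 m, ⟪centering n (scoreCol S.score ω s), u⟫ •
          centering n (scoreCol S.score ω s) +
        ∑ s ∈ Finset.Icc (m + 1) d, ⟪centering n (scoreCol S.score ω s), u⟫ •
          centering n (scoreCol S.score ω s)) := by
  have h2 : Finset.Icc 1 m ∪ Finset.Icc (m + 1) d = Finset.Icc 1 d := by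
    ext s; simp only [Finset.mem_union, Finset.mem_Icc]; omega
  have h3 : Disjoint (Finset.Icc 1 m) (Finset.Icc (m + 1) d) := by
    rw [Finset.disjoint_left]; intro s; simp only [Finset.mem_Icc]; omega
  rw [← Finset.sum_union h3, h2]
  ext i
  rw [toEuclideanLin_coord, dualCov, S.gram_centered]
  simp only [Matrix.smul_apply, Matrix.of_apply, smul_eq_mul, PiLp.smul_apply, WithLp.ofLp_sum,
    Finset.sum_apply, euclidean_inner_eq_sum, mul_assoc, ← Finset.mul_sum, Finset.sum_mul]
  congr 1
  rw [Finset.sum_comm]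
  exact Finset.sum_congr rfl fun s _ => Finset.sum_congr rfl fun k _ => by ring

lemma trace_dualCov {m : ℕ} (hmd : m ≤ d) (ω : S.Ω) : (S.dualCov ω).trace =
    ((n : ℝ) - 1)⁻¹ * ∑ s ∈ Finset.Icc 1 m, ‖centering n (scoreCol S.score ω s)‖ ^ 2 +
    ((n : ℝ) - 1)⁻¹ * ∑ s ∈ Finset.Icc (m + 1) d, ‖centering n (scoreCol S.score ω s)‖ ^ 2 := by
  have h2 : Finset.Icc 1 m ∪ Finset.Icc (m + 1) d = Finset.Icc 1 d := by
    ext s; simp only [Finset.mem_union, Finset.mem_Icc]; omega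
  have h3 : Disjoint (Finset.Icc 1 m) (Finset.Icc (m + 1) d) := by
    rw [Finset.disjoint_left]; intro s; simp only [Finset.mem_Icc]; omega
  rw [← mul_add, ← Finset.sum_union h3, h2, dualCov, Matrix.trace_smul, S.gram_centered,
    smul_eq_mul]
  congr 1
  simp only [Matrix.trace, Matrix.diag_apply, Matrix.of_apply, EuclideanSpace.real_norm_sq_eq]
  rw [Finset.sum_comm]
  exact Finset.sum_congr rfl fun s _ => Finset.sum_congr rfl fun k _ => by ring

lemma isEigenSystem_dualCov (ω : S.Ω) {lamHat : ℕ → ℝ} {uHat : ℕ → Fin n → ℝ}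
    (hspec : IsSpectralDecomp (S.dualCov ω) lamHat uHat) :
    IsEigenSystem (Matrix.toEuclideanLin (S.dualCov ω)) n lamHat
      (fun s => WithLp.toLp 2 (uHat s)) where
  symm := Matrix.isSymmetric_toEuclideanLin_iff.2 (S.isHermitian_dualCov ω)
  anti := by simpa using hspec.1
  ortho := fun s hs t ht => by
    rw [← hspec.2.1 s (by simpa using hs) t (by simpa using ht), euclidean_inner_eq_sum]
    rfl
  eigen := fun s hs => by
    rw [Matrix.toLpLin_toLp, Matrix.toLin'_apply, ← WithLp.toLp_smul]
    congr 1
    conv_lhs => rw [hspec.2.2]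
    rw [Matrix.sum_mulVec, Finset.sum_eq_single_of_mem s hs]
    · rw [smul_mulVec, vecMulVec_mulVec, hspec.2.1 s (by simpa using hs) s (by simpa using hs)]
      simp
    · intro t ht hts
      rw [smul_mulVec, vecMulVec_mulVec, hspec.2.1 t (by simpa using ht) s (by simpa using hs),
        if_neg hts]
      simp

end SampleModel

end Model

/-! ### Coordinates of the noise-reduction direction. -/

section Coordinates

namespace SampleModel

variable {d n : ℕ} (S : SampleModel.{u} d n)

local notation "⟪" x ", " y "⟫" => inner ℝ x y

/-- The sample vector of the `a`-th coordinate of the noise part. -/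
noncomputable def noiseCol (m : ℕ) (ω : S.Ω) (a : Fin d) : EuclideanSpace ℝ (Fin n) :=
  WithLp.toLp 2 fun i => S.noise m i ω a

lemma noiseCol_eq {m : ℕ} (hmd : m ≤ d) (ω : S.Ω) (a : Fin d) :
    S.noiseCol m ω a = ∑ s ∈ Finset.Icc (m + 1) d, S.h s a • scoreCol S.score ω s := by
  ext i
  simp only [noiseCol, S.noise_apply hmd, WithLp.ofLp_sum, Finset.sum_apply, PiLp.smul_apply,
    smul_eq_mul, scoreCol]
  exact Finset.sum_congr rfl fun s _ => mul_comm _ _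

lemma sum_Icc_split {m : ℕ} (hmd : m ≤ d) (f : ℕ → ℝ) : ∑ s ∈ Finset.Icc 1 d, f s =
    ∑ s ∈ Finset.Icc 1 m, f s + ∑ s ∈ Finset.Icc (m + 1) d, f s := by
  rw [← Finset.sum_union]
  · congr 1
    ext s; simp only [Finset.mem_union, Finset.mem_Icc]; omega
  · rw [Finset.disjoint_left]; intro s; simp only [Finset.mem_Icc]; omega

lemma inner_centering_scoreCol (ω : S.Ω) (u : EuclideanSpace ℝ (Fin n)) {s : ℕ}
    (hl : 0 < S.lam s) (hn : 2 ≤ n) :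
    ⟪centering n (scoreCol S.score ω s), u⟫ =
      Real.sqrt ((n : ℝ) - 1) * Real.sqrt (S.lam s) * ⟪spikeDir S.score S.lam ω s, u⟫ := by
  have h2n : (2 : ℝ) ≤ n := by exact_mod_cast hn
  have h1 : 0 < Real.sqrt ((n : ℝ) - 1) := Real.sqrt_pos.2 (by linarith)
  have h2 : 0 < Real.sqrt (S.lam s) := Real.sqrt_pos.2 hl
  rw [spikeDir, real_inner_smul_left]
  field_simp

/-- Coordinates of the noise-reduction direction. -/
lemma nrDirection_apply {m : ℕ} (hmd : m ≤ d) (hn : 2 ≤ n)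
    (hl : ∀ s ∈ Finset.Icc 1 m, 0 < S.lam s) (ω : S.Ω) (lamHat : ℕ → ℝ)
    (uHat : ℕ → Fin n → ℝ) (j : ℕ) (a : Fin d) :
    S.nrDirection ω lamHat uHat j a = (Real.sqrt (S.nrEigenvalue ω lamHat j))⁻¹ *
      (∑ s ∈ Finset.Icc 1 m, Real.sqrt (S.lam s) * S.h s a *
          ⟪spikeDir S.score S.lam ω s, (WithLp.toLp 2 (uHat j) : EuclideanSpace ℝ (Fin n))⟫ +
        ⟪(Real.sqrt ((n : ℝ) - 1))⁻¹ • centering n (S.noiseCol m ω a),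
          (WithLp.toLp 2 (uHat j) : EuclideanSpace ℝ (Fin n))⟫) := by
  have h2n : (2 : ℝ) ≤ n := by exact_mod_cast hn
  have h1 : 0 < Real.sqrt ((n : ℝ) - 1) := Real.sqrt_pos.2 (by linarith)
  set u : EuclideanSpace ℝ (Fin n) := WithLp.toLp 2 (uHat j) with hu
  have h3 : S.nrDirection ω lamHat uHat j a =
      (Real.sqrt (((n : ℝ) - 1) * S.nrEigenvalue ω lamHat j))⁻¹ *
        (S.centered ω *ᵥ u.ofLp) a := rfl
  rw [h3, S.centered_mulVec, sum_Icc_split hmd, Real.sqrt_mul (by linarith), S.noiseCol_eq hmd,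
    map_sum, real_inner_smul_left, sum_inner]
  have h4 : ∑ s ∈ Finset.Icc 1 m, S.h s a * ⟪centering n (scoreCol S.score ω s), u⟫ =
      Real.sqrt ((n : ℝ) - 1) * ∑ s ∈ Finset.Icc 1 m, Real.sqrt (S.lam s) * S.h s a *
        ⟪spikeDir S.score S.lam ω s, u⟫ := by
    rw [Finset.mul_sum]
    refine Finset.sum_congr rfl fun s hs => ?_
    rw [S.inner_centering_scoreCol ω u (hl s hs) hn]
    ring
  simp only [map_smul, real_inner_smul_left]
  rw [h4, mul_inv]
  field_simp

/-- The sign convention makes the inner product with the spike direction nonnegative. -/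
lemma inner_spikeDir_nonneg {j : ℕ} (hj : j ∈ Finset.Icc 1 d) (hn : 2 ≤ n)
    (hl : 0 < S.lam j) (ω : S.Ω) {lamHat : ℕ → ℝ} {uHat : ℕ → Fin n → ℝ}
    (hpos : 0 < lamHat j) (hsign : 0 ≤ S.h j ⬝ᵥ S.pcDirection ω lamHat uHat j) :
    0 ≤ ⟪spikeDir S.score S.lam ω j, (WithLp.toLp 2 (uHat j) : EuclideanSpace ℝ (Fin n))⟫ := by
  have h2n : (2 : ℝ) ≤ n := by exact_mod_cast hn
  have h1 : 0 < Real.sqrt ((n : ℝ) - 1) := Real.sqrt_pos.2 (by linarith)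
  have h2 : 0 < Real.sqrt (S.lam j) := Real.sqrt_pos.2 hl
  have h3 : 0 < Real.sqrt (((n : ℝ) - 1) * lamHat j) :=
    Real.sqrt_pos.2 (mul_pos (by linarith) hpos)
  rw [pcDirection, dotProduct_smul, smul_eq_mul] at hsign
  have h4 := S.h_dotProduct_centered_mulVec ω (WithLp.toLp 2 (uHat j)) hj
  rw [S.inner_centering_scoreCol ω _ hl hn] at h4
  rw [h4] at hsign
  have h5 := nonneg_of_mul_nonneg_right hsign (inv_pos.2 h3)
  exact nonneg_of_mul_nonneg_right h5 (mul_pos h1 h2)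

lemma norm_noise_dir_le (hn : 2 ≤ n) {m : ℕ} (ω : S.Ω) (a : Fin d) {K₂ : ℝ}
    (hK : ∑ i, S.noise m i ω a ^ 2 ≤ K₂ * n) (hK0 : 0 ≤ K₂) :
    ‖(Real.sqrt ((n : ℝ) - 1))⁻¹ • centering n (S.noiseCol m ω a)‖ ≤ 2 * Real.sqrt K₂ := by
  have h2n : (2 : ℝ) ≤ n := by exact_mod_cast hn
  have hsn : 0 < Real.sqrt n := Real.sqrt_pos.2 (by linarith)
  have h1 : ‖S.noiseCol m ω a‖ ≤ Real.sqrt K₂ * Real.sqrt n := by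
    rw [← Real.sqrt_mul hK0, EuclideanSpace.norm_eq]
    refine Real.sqrt_le_sqrt ?_
    simpa [noiseCol] using hK
  rw [norm_smul, Real.norm_eq_abs, abs_of_nonneg (by positivity)]
  calc _ ≤ 2 / Real.sqrt n * (Real.sqrt K₂ * Real.sqrt n) :=
        mul_le_mul (inv_sqrt_sub_one_le hn) ((norm_centering_le _).trans h1) (norm_nonneg _)
          (by positivity)
    _ = _ := by field_simp

/-- The uncentred inner product is the Bernstein sum of `noise * z`. The centring correction is a
product of two means, O(1) for the noise and O(n^{-1/2}) for the score, and is absorbed into the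
rate because L ≥ 1. -/
lemma abs_inner_noise_dir_le (hn : 2 ≤ n) {m j : ℕ} (hjd : j ∈ Finset.Icc 1 d)
    (hl : 0 < S.lam j) (ω : S.Ω) (a : Fin d) {c K₁ K₂ L : ℝ} (hc : 0 ≤ c)
    (hsum : |∑ i, S.score i ω j| ≤ c * Real.sqrt n * Real.sqrt (S.lam j))
    (hcross : |∑ i, S.noise m i ω a * S.z i j ω| ≤ K₁ * Real.sqrt (n * L))
    (hK : ∑ i, S.noise m i ω a ^ 2 ≤ K₂ * n) (hK0 : 0 ≤ K₂) (hL : 1 ≤ L) :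
    |⟪(Real.sqrt ((n : ℝ) - 1))⁻¹ • centering n (S.noiseCol m ω a),
      spikeDir S.score S.lam ω j⟫| ≤
      2 * (K₁ + c * Real.sqrt K₂) * (Real.sqrt L / Real.sqrt n) := by
  have h2n : (2 : ℝ) ≤ n := by exact_mod_cast hn
  have hn0 : (0 : ℝ) < n := by linarith
  have hn1 : (0 : ℝ) < (n : ℝ) - 1 := by linarith
  have hsn : 0 < Real.sqrt n := Real.sqrt_pos.2 hn0
  have hsq : Real.sqrt n * Real.sqrt n = n := Real.mul_self_sqrt hn0.le
  have hsl : 0 < Real.sqrt (S.lam j) := Real.sqrt_pos.2 hl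
  have hs1 : 0 < Real.sqrt ((n : ℝ) - 1) := Real.sqrt_pos.2 hn1
  have hL1 : 1 ≤ Real.sqrt L := by rwa [Real.one_le_sqrt]
  have h1 : ∑ i, S.noise m i ω a * S.score i ω j =
      Real.sqrt (S.lam j) * ∑ i, S.noise m i ω a * S.z i j ω := by
    rw [Finset.mul_sum]
    exact Finset.sum_congr rfl fun i _ => by rw [S.score_eq i ω hjd]; ring
  -- Plain Cauchy–Schwarz with the second-moment bound; no cancellation in the noise mean is needed.
  have h2 : |∑ i, S.noise m i ω a| ≤ n * Real.sqrt K₂ := by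
    refine abs_le_of_sq_le_sq ?_ (by positivity)
    have := sq_sum_le_card_mul_sum_sq (s := Finset.univ) (f := fun i => S.noise m i ω a)
    rw [Finset.card_univ, Fintype.card_fin] at this
    refine this.trans ((mul_le_mul_of_nonneg_left hK hn0.le).trans (le_of_eq ?_))
    rw [mul_pow, Real.sq_sqrt hK0]
    ring
  have h3 : ⟪(Real.sqrt ((n : ℝ) - 1))⁻¹ • centering n (S.noiseCol m ω a),
      spikeDir S.score S.lam ω j⟫ = ((n : ℝ) - 1)⁻¹ * (Real.sqrt (S.lam j))⁻¹ *
        (Real.sqrt (S.lam j) * ∑ i, S.noise m i ω a * S.z i j ω -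
          (n : ℝ)⁻¹ * ((∑ i, S.noise m i ω a) * ∑ i, S.score i ω j)) := by
    rw [spikeDir, real_inner_smul_left, real_inner_smul_right, inner_centering_centering,
      inner_centering, inner_onesVec, inner_onesVec, ← h1, euclidean_inner_eq_sum, ← mul_assoc,
      mul_inv, ← mul_assoc, ← mul_inv, Real.mul_self_sqrt hn1.le]
    rfl
  rw [h3, abs_mul, abs_of_pos (by positivity)]
  have h4 : |Real.sqrt (S.lam j) * ∑ i, S.noise m i ω a * S.z i j ω -
      (n : ℝ)⁻¹ * ((∑ i, S.noise m i ω a) * ∑ i, S.score i ω j)| ≤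
      (K₁ + c * Real.sqrt K₂) * Real.sqrt n * Real.sqrt L * Real.sqrt (S.lam j) := by
    refine (abs_sub _ _).trans ?_
    have h5 : |Real.sqrt (S.lam j) * ∑ i, S.noise m i ω a * S.z i j ω| ≤
        K₁ * Real.sqrt n * Real.sqrt L * Real.sqrt (S.lam j) := by
      rw [abs_mul, abs_of_pos hsl]
      refine (mul_le_mul_of_nonneg_left hcross hsl.le).trans (le_of_eq ?_)
      rw [Real.sqrt_mul hn0.le]
      ring
    have h6 : |(n : ℝ)⁻¹ * ((∑ i, S.noise m i ω a) * ∑ i, S.score i ω j)| ≤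
        c * Real.sqrt K₂ * Real.sqrt n * Real.sqrt L * Real.sqrt (S.lam j) := by
      rw [abs_mul, abs_mul, abs_of_pos (inv_pos.2 hn0)]
      calc _ ≤ (n : ℝ)⁻¹ * ((n * Real.sqrt K₂) * (c * Real.sqrt n * Real.sqrt (S.lam j))) :=
            mul_le_mul_of_nonneg_left (mul_le_mul h2 hsum (abs_nonneg _) (by positivity))
              (by positivity)
        _ = c * Real.sqrt K₂ * Real.sqrt n * Real.sqrt (S.lam j) * 1 := by field_simp
        _ ≤ c * Real.sqrt K₂ * Real.sqrt n * Real.sqrt (S.lam j) * Real.sqrt L :=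
            mul_le_mul_of_nonneg_left hL1 (by positivity)
        _ = _ := by ring
    linarith
  calc _ ≤ 2 / n * (Real.sqrt (S.lam j))⁻¹ *
        ((K₁ + c * Real.sqrt K₂) * Real.sqrt n * Real.sqrt L * Real.sqrt (S.lam j)) :=
        mul_le_mul (mul_le_mul_of_nonneg_right (inv_sub_one_le hn) (by positivity)) h4
          (abs_nonneg _) (by positivity)
    _ = 2 * (K₁ + c * Real.sqrt K₂) * (Real.sqrt L * (Real.sqrt n / n)) := by field_simp
    _ = _ := by
        have : Real.sqrt n / n = 1 / Real.sqrt n := by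
          nth_rw 2 [← hsq]; field_simp
        rw [this]; ring

/-- The constant in the coordinate bound. -/
noncomputable def coordConst (m : ℕ) (g c Q B K₁ K₂ : ℝ) : ℝ :=
  let C₀ := 12 * (1 + c) ^ 2 * (1 + Q)
  2 * (B * (142 * m / g * C₀ + (13 * C₀ + 2 * (5 * m + (4 * c + 2) * Q))) +
    B * (24 * m / g * C₀) + 2 * (2 * (K₁ + c * Real.sqrt K₂)) +
    2 * Real.sqrt K₂ * (140 * m / g * C₀))

/-- The deterministic bound on the coordinates of the noise-reduction direction. -/
lemma abs_nrDirection_sub_le {m : ℕ} (hm : 1 ≤ m) (hmd : m ≤ d) (hmn : 4 * m + 4 ≤ n)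
    {ω : S.Ω} {c δ g Q B K₁ K₂ L : ℝ}
    (h : IsGoodSample S.score (Finset.Icc (m + 1) d) m S.lam c δ ω) (hc : 0 ≤ c) (hδ : 0 ≤ δ)
    (hδ1 : δ ≤ 1) (hpos : 0 < S.lam m) (hg0 : 0 < g) (hg1 : g ≤ 1)
    (hgap : ∀ j ∈ Finset.Icc 1 m, ∀ j' ∈ Finset.Icc 1 m, j < j' → (1 + g) * S.lam j' ≤ S.lam j)
    (hQ0 : 0 ≤ Q)
    (hQ : Real.sqrt (∑ s ∈ Finset.Icc (m + 1) d, S.lam s ^ 2) ≤ Q * S.lam m)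
    (hsmall : 300 * m * (2 * Q * δ + 12 * (1 + c) ^ 2 * (1 + Q) / Real.sqrt n) ≤ g)
    (hsmall' : (13 * (12 * (1 + c) ^ 2 * (1 + Q)) + 2 * (5 * m + (4 * c + 2) * Q)) /
      Real.sqrt n ≤ 1 / 2)
    {a : Fin d} (hB : ∀ s ∈ Finset.Icc 1 m, |Real.sqrt (S.lam s) * S.h s a| ≤ B)
    (hK2 : 0 ≤ K₂) (hL : 1 ≤ L)
    {j : ℕ} (hj : j ∈ Finset.Icc 1 m)
    (hcross : |∑ i, S.noise m i ω a * S.z i j ω| ≤ K₁ * Real.sqrt (n * L))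
    (hnoise : ∑ i, S.noise m i ω a ^ 2 ≤ K₂ * n)
    {lamHat : ℕ → ℝ} {uHat : ℕ → Fin n → ℝ}
    (hspec : IsSpectralDecomp (S.dualCov ω) lamHat uHat)
    (hsign : 0 ≤ S.h j ⬝ᵥ S.pcDirection ω lamHat uHat j) :
    |S.nrDirection ω lamHat uHat j a - S.h j a| ≤
      coordConst m g c Q B K₁ K₂ * Real.sqrt ((S.lam j)⁻¹ * (n : ℝ)⁻¹ * L) := by
  have hn : 2 ≤ n := by omega
  have hnpos : 0 < n := by omega
  have hmn' : m ≤ n := by omega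
  have h2n : (2 : ℝ) ≤ n := by exact_mod_cast hn
  have hn0 : (0 : ℝ) < n := by linarith
  have hsn : 0 < Real.sqrt n := Real.sqrt_pos.2 hn0
  have hsq : Real.sqrt n * Real.sqrt n = n := Real.mul_self_sqrt hn0.le
  have hs1 : 1 ≤ Real.sqrt n := by rw [Real.one_le_sqrt]; linarith
  have hsub : Finset.Icc 1 m ⊆ Finset.Icc 1 d := Finset.Icc_subset_Icc le_rfl hmd
  have hanti : AntitoneOn S.lam (Finset.Icc 1 m) := by
    refine S.spectral.1.mono ?_
    intro s hs
    simpa using hsub hs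
  have hlN : ∀ s ∈ Finset.Icc (m + 1) d, 0 ≤ S.lam s := fun s hs =>
    S.lam_nonneg hnpos (noise_mem hs)
  have hP := h.spikedPerturbation hc hδ hδ1 hn hm hanti hpos hlN hg0 hg1 hgap hQ0 hQ rfl hsmall
    (S.dualCov_apply hmd ω)
  have hE := S.isEigenSystem_dualCov ω hspec
  have hfin : Module.finrank ℝ (EuclideanSpace ℝ (Fin n)) = n := finrank_euclideanSpace_fin
  have hl : ∀ s ∈ Finset.Icc 1 m, 0 < S.lam s := fun s hs => hP.lam_pos hs
  set C₀ := 12 * (1 + c) ^ 2 * (1 + Q) with hC₀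
  have hC₀0 : 0 ≤ C₀ := by positivity
  set D := (4 * c + 2) * Q with hD
  have hD0 : 0 ≤ D := by positivity
  have htr : |(S.dualCov ω).trace -
      ∑ t ∈ Finset.Icc 1 m, S.lam t * ‖spikeDir S.score S.lam ω t‖ ^ 2 -
      (n - 1) * (((n : ℝ) - 1)⁻¹ * ∑ s ∈ Finset.Icc (m + 1) d, S.lam s)| ≤ D * S.lam m := by
    have h1 : ∑ t ∈ Finset.Icc 1 m, S.lam t * ‖spikeDir S.score S.lam ω t‖ ^ 2 =
        ((n : ℝ) - 1)⁻¹ * ∑ t ∈ Finset.Icc 1 m, ‖centering n (scoreCol S.score ω t)‖ ^ 2 := by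
      rw [Finset.mul_sum]
      refine Finset.sum_congr rfl fun t ht => ?_
      have hlt := hl t ht
      rw [spikeDir, norm_smul, mul_pow, Real.norm_eq_abs, sq_abs, inv_pow, mul_pow,
        Real.sq_sqrt (by linarith : (0 : ℝ) ≤ (n : ℝ) - 1), Real.sq_sqrt hlt.le]
      field_simp
    -- The spike parts of the trace cancel identically, so only the total noise variance has to be
    -- compared with its mean.
    have hne : (n : ℝ) - 1 ≠ 0 := by linarith
    rw [S.trace_dualCov hmd, h1, add_sub_cancel_left, mul_inv_cancel_left₀ hne]
    refine (h.abs_sum_norm_centering_sub_le hc hδ hδ1 hn).trans ?_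
    rw [hD, mul_assoc]
    exact mul_le_mul_of_nonneg_left hQ (by positivity)
  have hlt := hP.abs_noise_reduction_sub_le hE hfin hmn hj htr
  set ρ := C₀ / Real.sqrt n with hρ
  have hinvn : (1 : ℝ) / n ≤ 1 / Real.sqrt n := by
    refine one_div_le_one_div_of_le hsn ?_
    nlinarith
  have hρ' : 13 * ρ + 2 * (5 * m + D) / n ≤ (13 * C₀ + 2 * (5 * m + D)) / Real.sqrt n := by
    have h1 : 13 * ρ = 13 * C₀ / Real.sqrt n := by rw [hρ]; ring
    rw [add_div, h1, div_eq_mul_one_div (2 * (5 * (m : ℝ) + D)) (n : ℝ),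
      div_eq_mul_one_div (2 * (5 * (m : ℝ) + D)) (Real.sqrt n)]
    exact add_le_add le_rfl (mul_le_mul_of_nonneg_left hinvn (by positivity))
  have hsgn := S.inner_spikeDir_nonneg (hsub hj) hn (hl j hj) ω
    (hP.eigenvalue_pos hE hfin hmn' hj) hsign
  have hr := S.abs_inner_noise_dir_le hn (hsub hj) (hl j hj) ω a hc (h.sum j hj) hcross hnoise
    hK2 hL
  have hfinal := hP.abs_coordinate_sub_le hE hfin hmn' hj hsgn
    (hlt.trans (mul_le_mul_of_nonneg_right hρ' (hl j hj).le)) hsmall' hB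
    (S.norm_noise_dir_le hn ω a hnoise hK2) hr
  have hβ : Real.sqrt (S.lam j) * S.h j a / Real.sqrt (S.lam j) = S.h j a := by
    have := Real.sqrt_pos.2 (hl j hj)
    field_simp
  have hB0 : 0 ≤ B := (abs_nonneg _).trans (hB j hj)
  rw [hβ] at hfinal
  rw [S.nrDirection_apply hmd hn hl]
  refine hfinal.trans ?_
  have hsL : 1 ≤ Real.sqrt L := by rwa [Real.one_le_sqrt]
  have hrate : Real.sqrt ((S.lam j)⁻¹ * (n : ℝ)⁻¹ * L) =
      Real.sqrt L / Real.sqrt n / Real.sqrt (S.lam j) := by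
    rw [Real.sqrt_mul (by have := hl j hj; positivity),
      Real.sqrt_mul (by have := hl j hj; positivity), Real.sqrt_inv, Real.sqrt_inv]
    field_simp
  rw [hrate]
  set q := Real.sqrt L / Real.sqrt n with hq
  have hq0 : 0 ≤ q := by positivity
  rw [← mul_div_assoc (coordConst m g c Q B K₁ K₂)]
  refine div_le_div_of_nonneg_right ?_ (Real.sqrt_nonneg _)
  -- Since L ≥ 1, every n^{-1/2} error fits under √(L/n), and the bound collapses to one constant
  -- times q.
  have hq1 : ∀ x : ℝ, 0 ≤ x → x / Real.sqrt n ≤ x * q := fun x hx => by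
    rw [hq, ← mul_div_assoc]
    exact div_le_div_of_nonneg_right (le_mul_of_one_le_right hx hsL) hsn.le
  have hρq : ρ ≤ C₀ * q := hq1 C₀ hC₀0
  have hρq' := hq1 (13 * C₀ + 2 * (5 * m + D)) (by positivity)
  have hcc : coordConst m g c Q B K₁ K₂ * q =
      2 * (B * (142 * m / g * (C₀ * q) + (13 * C₀ + 2 * (5 * m + D)) * q) +
        B * (24 * m / g * (C₀ * q)) + 2 * (2 * (K₁ + c * Real.sqrt K₂) * q) +
        2 * Real.sqrt K₂ * (140 * m / g * (C₀ * q))) := by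
    simp only [coordConst, ← hC₀, ← hD]
    ring
  rw [hcc]
  gcongr

end SampleModel

end Coordinates

/-! ### Probabilities of the exceptional events. -/

section Probability

variable {Ω : Type*} [MeasurableSpace Ω] {P : Measure Ω}

lemma measure_lt_le_of_integral_le [IsFiniteMeasure P] {V : Ω → ℝ} (hV : ∀ ω, 0 ≤ V ω)
    {a ε b : ℝ} (h : Integrable V P ∧ ∫ ω, V ω ∂P ≤ b) (hb : b ≤ ε * a) (ha : 0 < a) :
    P {ω | a < V ω} ≤ ENNReal.ofReal ε := by
  have h1 := mul_meas_ge_le_integral_of_nonneg (ae_of_all P hV) h.1 a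
  have h2 : P.real {ω | a ≤ V ω} ≤ ε :=
    le_of_mul_le_mul_left ((h1.trans (h.2.trans hb)).trans_eq (mul_comm _ _)) ha
  calc P {ω | a < V ω} ≤ P {ω | a ≤ V ω} := measure_mono fun ω hω => by
        simp only [Set.mem_ofPred_eq] at hω ⊢
        exact hω.le
    _ = ENNReal.ofReal (P.real {ω | a ≤ V ω}) := by rw [ofReal_measureReal]
    _ ≤ _ := ENNReal.ofReal_le_ofReal h2

lemma measure_biUnion_le_card_mul {ι : Type*} (T : Finset ι) {A : ι → Set Ω} {ε : ℝ}
    (h : ∀ s ∈ T, P (A s) ≤ ENNReal.ofReal ε) :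
    P (⋃ s ∈ T, A s) ≤ ENNReal.ofReal (T.card * ε) := by
  refine (measure_biUnion_finset_le T A).trans ((Finset.sum_le_card_nsmul T _ _ h).trans ?_)
  rw [nsmul_eq_mul, ENNReal.ofReal_mul (Nat.cast_nonneg _), ENNReal.ofReal_natCast]

lemma measure_union_le_ofReal {A B : Set Ω} {a b : ℝ} (ha : 0 ≤ a) (hb : 0 ≤ b)
    (hA : P A ≤ ENNReal.ofReal a) (hB : P B ≤ ENNReal.ofReal b) :
    P (A ∪ B) ≤ ENNReal.ofReal (a + b) := by
  rw [ENNReal.ofReal_add ha hb]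
  exact (measure_union_le A B).trans (add_le_add hA hB)

namespace IsScoreFamily

variable {n : ℕ} {Y : Fin n → Ω → ℕ → ℝ} {T N : Finset ℕ} {lam : ℕ → ℝ} {K : ℝ}

/-- A sample is good with large probability. -/
lemma measure_not_isGoodSample_le [IsProbabilityMeasure P] (h : IsScoreFamily P Y T lam K)
    (hN : N ⊆ T) {m : ℕ} (hmT : Finset.Icc 1 m ⊆ T) (hmN : ∀ s ∈ Finset.Icc 1 m, s ∉ N)
    (hn : 0 < n) (hl : ∀ s ∈ Finset.Icc 1 m, 0 < lam s) (hτ : 0 < ∑ s ∈ N, lam s ^ 2)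
    {c δ ε : ℝ} (hc : 0 < c) (hδ : 0 < δ) (hε : 0 ≤ ε) (hK : K ≤ ε * c ^ 2)
    (hoff : n ^ 4 * ∑ s ∈ N, lam s ^ 4 + 6 * K ^ 2 * n ^ 3 * (∑ s ∈ N, lam s ^ 2) ^ 2 ≤
      ε * (δ ^ 4 * n ^ 4 * (∑ s ∈ N, lam s ^ 2) ^ 2)) :
    P {ω | ¬ IsGoodSample Y N m lam c δ ω} ≤
      ENNReal.ofReal (((m : ℝ) * m + 2 * m + 2) * ε) := by
  have hn' : (0 : ℝ) < n := by exact_mod_cast hn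
  -- The bounds for the score sums and the cross terms carry no factor K; since K ≥ 1 the same c
  -- serves them.
  have h1K : 1 ≤ ε * c ^ 2 := h.one_le.trans hK
  have hgram : ∀ s ∈ Finset.Icc 1 m, ∀ t ∈ Finset.Icc 1 m,
      P {ω | (c * Real.sqrt n * (Real.sqrt (lam s) * Real.sqrt (lam t))) ^ 2 <
        (∑ i, (Y i ω s * Y i ω t - if s = t then lam s else 0)) ^ 2} ≤ ENNReal.ofReal ε := by
    intro s hs t ht
    have hls := hl s hs
    have hlt := hl t ht
    refine measure_lt_le_of_integral_le (fun ω => sq_nonneg _)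
      (h.sq_sum_score_mul_score (hmT hs) (hmT ht)) ?_ (by positivity)
    rw [mul_pow, mul_pow, mul_pow, Real.sq_sqrt hn'.le, Real.sq_sqrt hls.le, Real.sq_sqrt hlt.le]
    calc _ = K * (n * (lam s * lam t)) := by ring
      _ ≤ ε * c ^ 2 * (n * (lam s * lam t)) := mul_le_mul_of_nonneg_right hK (by positivity)
      _ = _ := by ring
  have hsum : ∀ s ∈ Finset.Icc 1 m,
      P {ω | (c * Real.sqrt n * Real.sqrt (lam s)) ^ 2 < (∑ i, Y i ω s) ^ 2} ≤
        ENNReal.ofReal ε := by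
    intro s hs
    have hls := hl s hs
    refine measure_lt_le_of_integral_le (fun ω => sq_nonneg _) (h.sq_sum_score (hmT hs)) ?_
      (by positivity)
    rw [mul_pow, mul_pow, Real.sq_sqrt hn'.le, Real.sq_sqrt hls.le]
    calc _ = 1 * (n * lam s) := by ring
      _ ≤ ε * c ^ 2 * (n * lam s) := mul_le_mul_of_nonneg_right h1K (by positivity)
      _ = _ := by ring
  have hlen : P {ω | c ^ 2 * n * ∑ s ∈ N, lam s ^ 2 < ∑ i, rowDev Y N lam ω i ^ 2} ≤
      ENNReal.ofReal ε := by
    refine measure_lt_le_of_integral_le (fun ω => Finset.sum_nonneg fun i _ => sq_nonneg _)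
      (h.sum_sq_sum_sq_sub hN) ?_ (by positivity)
    calc _ = K * (n * ∑ s ∈ N, lam s ^ 2) := by ring
      _ ≤ ε * c ^ 2 * (n * ∑ s ∈ N, lam s ^ 2) := mul_le_mul_of_nonneg_right hK (by positivity)
      _ = _ := by ring
  have hcross : ∀ s ∈ Finset.Icc 1 m,
      P {ω | c ^ 2 * n ^ 2 * (∑ s ∈ N, lam s ^ 2) * lam s <
        ∑ i, (∑ k, offDiagGram Y N ω i k * Y k ω s) ^ 2} ≤ ENNReal.ofReal ε := by
    intro s hs
    have hls := hl s hs
    refine measure_lt_le_of_integral_le (fun ω => Finset.sum_nonneg fun i _ => sq_nonneg _)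
      (h.sum_sq_offDiagGram_mulVec hN (hmT hs) (hmN s hs)) ?_ (by positivity)
    calc _ = 1 * (n ^ 2 * (∑ s ∈ N, lam s ^ 2) * lam s) := by ring
      _ ≤ ε * c ^ 2 * (n ^ 2 * (∑ s ∈ N, lam s ^ 2) * lam s) :=
        mul_le_mul_of_nonneg_right h1K (by positivity)
      _ = _ := by ring
  have hof : P {ω | δ ^ 4 * n ^ 4 * (∑ s ∈ N, lam s ^ 2) ^ 2 <
      ∑ i, ∑ k, (∑ j, offDiagGram Y N ω i j * offDiagGram Y N ω j k) ^ 2} ≤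
        ENNReal.ofReal ε :=
    measure_lt_le_of_integral_le
      (fun ω => Finset.sum_nonneg fun i _ => Finset.sum_nonneg fun k _ => sq_nonneg _)
      (h.sum_sq_offDiagGram_sq hN) hoff (by positivity)
  -- The union counts m² + m + 1 + m + 1 events: `gram`, `sum`, `len`, `cross`, `off`.
  have hU := measure_union_le_ofReal (by positivity) (by positivity)
    (measure_union_le_ofReal (by positivity) (by positivity)
      (measure_union_le_ofReal (by positivity) (by positivity)
        (measure_union_le_ofReal (by positivity) (by positivity)
          (measure_biUnion_le_card_mul (Finset.Icc 1 m) fun s hs =>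
            measure_biUnion_le_card_mul (Finset.Icc 1 m) (hgram s hs))
          (measure_biUnion_le_card_mul (Finset.Icc 1 m) hsum)) hlen)
      (measure_biUnion_le_card_mul (Finset.Icc 1 m) hcross)) hof
  rw [Nat.card_Icc, Nat.add_sub_cancel] at hU
  refine (measure_mono ?_).trans (hU.trans (ENNReal.ofReal_le_ofReal (le_of_eq (by ring))))
  intro ω hω
  by_contra hcon
  simp only [Set.mem_union, Set.mem_iUnion, Set.mem_ofPred_eq, not_or, not_exists, not_lt] at hcon
  obtain ⟨⟨⟨⟨h1, h2⟩, h3⟩, h4⟩, h5⟩ := hcon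
  exact hω
    { gram := fun s hs t ht => abs_le_of_sq_le_sq (h1 s hs t ht)
        (by have := hl s hs; have := hl t ht; positivity)
      sum := fun s hs => abs_le_of_sq_le_sq (h2 s hs) (by positivity)
      len := h3
      cross := h4
      off := h5 }

end IsScoreFamily

namespace SampleModel

variable {d n : ℕ} (S : SampleModel.{u} d n)

/-- The scores of a sample whose sphered data have the moments of independent variables. -/
lemma isScoreFamily (hn : 0 < n) (h4 : ∀ i, ∀ s ∈ Set.Icc 1 d, MemLp (S.z i s) 4 S.P)
    (h22 : ∀ i, ∀ s₁ ∈ Set.Icc 1 d, ∀ s₂ ∈ Set.Icc 1 d, s₁ ≠ s₂ →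
      ∫ ω, S.z i s₁ ω ^ 2 * S.z i s₂ ω ^ 2 ∂S.P = 1)
    (h0 : ∀ i, ∀ s₁ ∈ Set.Icc 1 d, ∀ s₂ ∈ Set.Icc 1 d, ∀ s₃ ∈ Set.Icc 1 d, ∀ s₄ ∈ Set.Icc 1 d,
      s₁ ≠ s₂ → s₁ ≠ s₃ → s₁ ≠ s₄ →
      ∫ ω, S.z i s₁ ω * S.z i s₂ ω * S.z i s₃ ω * S.z i s₄ ω ∂S.P = 0)
    {C : ℝ} (hC : ∀ i, ∀ s ∈ Set.Icc 1 d, variance (fun ω => S.z i s ω ^ 2) S.P ≤ C) :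
    IsScoreFamily S.P S.score (Finset.Icc 1 d) S.lam (|C| + 1) where
  meas := S.measurable_score
  indep := S.iIndepFun_score
  memLp i s hs := by
    have := (h4 i s (by simpa using hs)).const_mul (Real.sqrt (S.lam s))
    simpa only [S.score_eq i _ hs] using this
  mean i s hs := by
    simp only [S.score_eq i _ hs, integral_const_mul, S.mean_z i s (by simpa using hs), mul_zero]
  cov i s hs t ht := by
    rw [(S.hasMean_score_mul i hs ht).2, S.sq_sqrt_lam hn hs]
  sq_sq i s hs t ht hst := by
    have h1 : ∀ ω, S.score i ω s ^ 2 * S.score i ω t ^ 2 =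
        S.lam s * S.lam t * (S.z i s ω ^ 2 * S.z i t ω ^ 2) := fun ω => by
      rw [S.score_eq i ω hs, S.score_eq i ω ht, mul_pow, mul_pow, S.sq_sqrt_lam hn hs,
        S.sq_sqrt_lam hn ht]
      ring
    simp only [h1, integral_const_mul, h22 i s (by simpa using hs) t (by simpa using ht) hst,
      mul_one]
  four_le i s hs := by
    have hs' : s ∈ Set.Icc 1 d := by simpa using hs
    have h1 : ∀ ω, S.score i ω s ^ 4 = S.lam s ^ 2 * (S.z i s ω ^ 2) ^ 2 := fun ω => by
      rw [S.score_eq i ω hs]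
      nth_rw 2 [← S.sq_sqrt_lam hn hs]
      ring
    have h2 : MemLp (fun ω => S.z i s ω ^ 2) 2 S.P := by
      have : ENNReal.HolderTriple 4 4 2 := ⟨by
        rw [show (4 : ENNReal) = 2 * 2 by norm_num,
          ENNReal.mul_inv (Or.inl (by norm_num)) (Or.inl (by norm_num)), ← mul_add,
          ENNReal.inv_two_add_inv_two, mul_one]⟩
      have := (h4 i s hs').mul (h4 i s hs') (r := 2)
      simpa only [sq, Pi.mul_def] using this
    have h3 := hC i s hs'
    have h4 : ∫ ω, S.z i s ω ^ 2 ∂S.P = 1 := by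
      have := S.cov_z i s hs' s hs'
      simpa only [sq, if_true] using this
    -- As E z² = 1, a variance of z² at most C means E z⁴ ≤ C + 1; hence the constant |C| + 1, the
    -- absolute value making it at least 1.
    rw [variance_eq_sub h2] at h3
    simp only [Pi.pow_apply, h4] at h3
    simp only [h1, integral_const_mul]
    rw [mul_comm]
    refine mul_le_mul_of_nonneg_right ?_ (sq_nonneg _)
    linarith [le_abs_self C]
  four_eq_zero i s₁ h₁ s₂ h₂ s₃ h₃ s₄ h₄ h12 h13 h14 := by
    have h1 : ∀ ω, S.score i ω s₁ * S.score i ω s₂ * S.score i ω s₃ * S.score i ω s₄ =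
        Real.sqrt (S.lam s₁) * Real.sqrt (S.lam s₂) * Real.sqrt (S.lam s₃) *
          Real.sqrt (S.lam s₄) * (S.z i s₁ ω * S.z i s₂ ω * S.z i s₃ ω * S.z i s₄ ω) :=
      fun ω => by
        rw [S.score_eq i ω h₁, S.score_eq i ω h₂, S.score_eq i ω h₃, S.score_eq i ω h₄]
        ring
    simp only [h1, integral_const_mul, h0 i s₁ (by simpa using h₁) s₂ (by simpa using h₂) s₃
      (by simpa using h₃) s₄ (by simpa using h₄) h12 h13 h14, mul_zero]
  nonneg s hs := S.lam_nonneg hn hs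
  one_le := by linarith [abs_nonneg C]

variable {S} in
-- Replacing the coordinate's own variance by a common upper bound weakens the exponent and yields
-- one exponential rate valid for all coordinates.
lemma integrable_exp_and_le {f : S.Ω → ℝ} (hf : Measurable f) (hf0 : ∀ ω, 0 ≤ f ω)
    {t v V C : ℝ} (ht : 0 < t) (hv : 0 < v) (hvV : v ≤ V)
    (h : Integrable (fun ω => Real.exp (t * f ω / Real.sqrt v)) S.P ∧
      ∫ ω, Real.exp (t * f ω / Real.sqrt v) ∂S.P ≤ C) :
    Integrable (fun ω => Real.exp (t / Real.sqrt V * f ω)) S.P ∧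
      ∫ ω, Real.exp (t / Real.sqrt V * f ω) ∂S.P ≤ C := by
  have h1 : ∀ ω, Real.exp (t / Real.sqrt V * f ω) ≤ Real.exp (t * f ω / Real.sqrt v) := fun ω => by
    rw [div_mul_eq_mul_div]
    exact Real.exp_le_exp.2 (div_le_div_of_nonneg_left (mul_nonneg ht.le (hf0 ω))
      (Real.sqrt_pos.2 hv) (Real.sqrt_le_sqrt hvV))
  have h2 : Integrable (fun ω => Real.exp (t / Real.sqrt V * f ω)) S.P :=
    h.1.mono' (by fun_prop) (ae_of_all _ fun ω => by
      rw [Real.norm_eq_abs, abs_of_pos (Real.exp_pos _)]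
      exact h1 ω)
  exact ⟨h2, (integral_mono h2 h.1 h1).trans h.2⟩

/-- Concentration of the covariances of the noise coordinates with the spike components. -/
lemma measure_abs_sum_noise_mul_ge_le {m : ℕ} (hmd : m ≤ d) (hn : 0 < n) {j : ℕ}
    (hj : j ∈ Finset.Icc 1 m) (hl : 0 < S.lam j) (a : Fin d) {t V C L : ℝ} (ht : 0 < t)
    (hv : ∀ i : Fin n, 0 < S.sigmaNoise m i a) (hvV : ∀ i : Fin n, S.sigmaNoise m i a ≤ V)
    (h : ∀ i, Integrable (fun ω => Real.exp (t * |S.noise m i ω a * S.z i j ω| /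
        Real.sqrt (S.sigmaNoise m i a))) S.P ∧
      ∫ ω, Real.exp (t * |S.noise m i ω a * S.z i j ω| /
        Real.sqrt (S.sigmaNoise m i a)) ∂S.P ≤ C) (hL : 0 ≤ L)
    (hLn : Real.sqrt (L / n) ≤ t / Real.sqrt V / 2) :
    S.P {ω | (8 * C / (t / Real.sqrt V) ^ 2 + 2) * Real.sqrt (n * L) ≤
      |∑ i, S.noise m i ω a * S.z i j ω|} ≤ ENNReal.ofReal (2 * Real.exp (-(2 * L))) := by
  have hjd : j ∈ Finset.Icc 1 d := Finset.Icc_subset_Icc le_rfl hmd hj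
  have hV : 0 < V := (hv ⟨0, hn⟩).trans_le (hvV ⟨0, hn⟩)
  have hsl : Real.sqrt (S.lam j) ≠ 0 := (Real.sqrt_pos.2 hl).ne'
  -- The model assumes neither measurability nor independence of the z. Since λ_j > 0, z_ij is
  -- recovered as a measurable function of x_i, so the products inherit both.
  have hz : ∀ i ω, S.z i j ω = S.h j ⬝ᵥ (S.x i ω - S.mu) * (Real.sqrt (S.lam j))⁻¹ :=
    fun i ω => by
      have := S.score_eq i ω hjd
      rw [score] at this
      rw [this]
      field_simp
  set φ : (Fin d → ℝ) → ℝ := fun x => (S.noiseProj m *ᵥ (x - S.mu)) a *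
    (S.h j ⬝ᵥ (x - S.mu) * (Real.sqrt (S.lam j))⁻¹) with hφ
  have hφm : Measurable φ :=
    (S.measurable_noise m a).mul ((S.measurable_dotProduct_sub (S.h j)).mul_const _)
  have hX : (fun i ω => S.noise m i ω a * S.z i j ω) = fun i => φ ∘ S.x i := by
    ext i ω
    rw [hz]
    rfl
  have hXm : ∀ i, Measurable fun ω => S.noise m i ω a * S.z i j ω := fun i => by
    have := congrFun hX i
    rw [this]
    exact hφm.comp (S.measurable_x i)
  have hind : iIndepFun (fun i ω => S.noise m i ω a * S.z i j ω) S.P := by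
    rw [hX]
    exact S.indep_x.comp (fun _ => φ) fun _ => hφm
  have hmean : ∀ i, HasMean S.P (fun ω => S.noise m i ω a * S.z i j ω) 0 := fun i => by
    refine HasMean.congr (HasMean.sum (T := Finset.Icc (m + 1) d) fun s hs =>
      (S.hasMean_score_mul i (noise_mem hs) hjd).const_mul
        (S.h s a * (Real.sqrt (S.lam j))⁻¹)) (fun ω => ?_) ?_
    · rw [S.noise_apply hmd, Finset.sum_mul]
      refine Finset.sum_congr rfl fun s _ => ?_
      rw [S.score_eq i ω hjd]
      field_simp
    · refine (Finset.sum_eq_zero fun s hs => ?_).symm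
      -- The noise involves only components beyond m, uncorrelated with the spike component j; hence
      -- the mean is zero.
      have : s ≠ j := by rw [Finset.mem_Icc] at hs hj; omega
      rw [if_neg this, mul_zero]
  have hE := fun i => integrable_exp_and_le (hXm i).abs (fun ω => abs_nonneg _) ht (hv i) (hvV i)
    (h i)
  exact measure_abs_sum_ge_le hind hXm hmean (div_pos ht (Real.sqrt_pos.2 hV))
    (fun i => (hE i).1) (fun i => (hE i).2) hn hL hLn

/-- Concentration of the sums of squares of the noise coordinates. -/
lemma measure_sum_noise_sq_ge_le {m : ℕ} (hn : 0 < n) (a : Fin d) {t V C : ℝ} (ht : 0 < t)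
    (hv : ∀ i : Fin n, 0 < S.thetaNoise m i a) (hvV : ∀ i : Fin n, S.thetaNoise m i a ≤ V)
    (h : ∀ i, Integrable (fun ω => Real.exp (t * S.noise m i ω a ^ 2 /
        Real.sqrt (S.thetaNoise m i a))) S.P ∧
      ∫ ω, Real.exp (t * S.noise m i ω a ^ 2 / Real.sqrt (S.thetaNoise m i a)) ∂S.P ≤ C) :
    S.P {ω | (C + 2) / (t / Real.sqrt V) * n ≤ ∑ i, S.noise m i ω a ^ 2} ≤
      ENNReal.ofReal (Real.exp (-(2 * n))) := by
  have hV : 0 < V := (hv ⟨0, hn⟩).trans_le (hvV ⟨0, hn⟩)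
  have hφm : Measurable fun x : Fin d → ℝ => (S.noiseProj m *ᵥ (x - S.mu)) a ^ 2 :=
    (S.measurable_noise m a).pow_const 2
  have hXm : ∀ i, Measurable fun ω => S.noise m i ω a ^ 2 := fun i =>
    hφm.comp (S.measurable_x i)
  have hind : iIndepFun (fun i ω => S.noise m i ω a ^ 2) S.P :=
    S.indep_x.comp (fun _ x => (S.noiseProj m *ᵥ (x - S.mu)) a ^ 2) fun _ => hφm
  have hE := fun i => integrable_exp_and_le (hXm i) (fun ω => sq_nonneg _) ht (hv i) (hvV i)
    (h i)
  exact measure_sum_ge_le_of_exp hind hXm (div_pos ht (Real.sqrt_pos.2 hV))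
    (fun i => (hE i).1) (fun i => (hE i).2)

end SampleModel

end Probability

/-! ### From fixed (d, n) to the limit. -/

section Asymptotics

namespace SampleModel

variable {d n : ℕ} (S : SampleModel.{u} d n)

/-- The maximal coordinate error of the noise-reduction direction exceeds the deterministic bound
only on the union of the exceptional events. -/
lemma measure_iSup_abs_nrDirection_sub_le {m : ℕ} (hm : 1 ≤ m) (hmd : m ≤ d)
    (hmn : 4 * m + 4 ≤ n) {c δ g Q B K₁ K₂ L M : ℝ} (hc : 0 ≤ c) (hδ : 0 ≤ δ)
    (hδ1 : δ ≤ 1) (hpos : 0 < S.lam m) (hg0 : 0 < g) (hg1 : g ≤ 1)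
    (hgap : ∀ j ∈ Finset.Icc 1 m, ∀ j' ∈ Finset.Icc 1 m, j < j' → (1 + g) * S.lam j' ≤ S.lam j)
    (hQ0 : 0 ≤ Q)
    (hQ : Real.sqrt (∑ s ∈ Finset.Icc (m + 1) d, S.lam s ^ 2) ≤ Q * S.lam m)
    (hsmall : 300 * m * (2 * Q * δ + 12 * (1 + c) ^ 2 * (1 + Q) / Real.sqrt n) ≤ g)
    (hsmall' : (13 * (12 * (1 + c) ^ 2 * (1 + Q)) + 2 * (5 * m + (4 * c + 2) * Q)) /
      Real.sqrt n ≤ 1 / 2)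
    (hB : ∀ a, ∀ s ∈ Finset.Icc 1 m, |Real.sqrt (S.lam s) * S.h s a| ≤ B)
    (hK2 : 0 ≤ K₂) (hL : 1 ≤ L) (hM : 0 ≤ M) (hMc : coordConst m g c Q B K₁ K₂ ≤ M)
    {j : ℕ} (hj : j ∈ Finset.Icc 1 m) {ε η ζ : ℝ} (hε : 0 ≤ ε) (hη : 0 ≤ η) (hζ : 0 ≤ ζ)
    (hgood : S.P {ω | ¬ IsGoodSample S.score (Finset.Icc (m + 1) d) m S.lam c δ ω} ≤
      ENNReal.ofReal ε)
    (hcross : ∀ a, S.P {ω | K₁ * Real.sqrt (n * L) ≤ |∑ i, S.noise m i ω a * S.z i j ω|} ≤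
      ENNReal.ofReal η)
    (hnoise : ∀ a, S.P {ω | K₂ * n ≤ ∑ i, S.noise m i ω a ^ 2} ≤ ENNReal.ofReal ζ)
    {lamHat : S.Ω → ℕ → ℝ} {uHat : S.Ω → ℕ → Fin n → ℝ}
    (hspec : ∀ ω, IsSpectralDecomp (S.dualCov ω) (lamHat ω) (uHat ω))
    (hsign : ∀ ω, 0 ≤ S.h j ⬝ᵥ S.pcDirection ω (lamHat ω) (uHat ω) j) :
    S.P {ω | M * Real.sqrt ((S.lam j)⁻¹ * (n : ℝ)⁻¹ * L) <
      |(⨆ a : Fin d, |S.nrDirection ω (lamHat ω) (uHat ω) j a - S.h j a|)|} ≤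
        ENNReal.ofReal (ε + d * η + d * ζ) := by
  have hU := measure_union_le_ofReal (by positivity) (by positivity)
    (measure_union_le_ofReal (by positivity) (by positivity) hgood
      (measure_biUnion_le_card_mul Finset.univ fun a _ => hcross a))
      (measure_biUnion_le_card_mul Finset.univ fun a _ => hnoise a)
  rw [Finset.card_univ, Fintype.card_fin] at hU
  refine (measure_mono fun ω hω => ?_).trans hU
  by_contra hcon
  simp only [Set.mem_union, Set.mem_iUnion, Set.mem_ofPred_eq, not_or, not_exists, not_le,
    not_not, Finset.mem_univ, forall_const] at hcon
  obtain ⟨⟨h1, h2⟩, h3⟩ := hcon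
  simp only [Set.mem_ofPred_eq] at hω
  refine absurd hω (not_lt.2 ?_)
  rw [abs_of_nonneg (Real.iSup_nonneg fun a => abs_nonneg _)]
  refine Real.iSup_le (fun a => ?_) (by positivity)
  refine (S.abs_nrDirection_sub_le hm hmd hmn h1 hc hδ hδ1 hpos hg0 hg1 hgap hQ0 hQ hsmall hsmall'
    (hB a) hK2 hL hj (h2 a).le (h3 a).le (hspec ω) (hsign ω)).trans ?_
  exact mul_le_mul_of_nonneg_right hMc (Real.sqrt_nonneg _)

/-- Together with λ_{m+1}²/tr(Σ₂²) → 0 this makes tr Σ₂⁴ negligible against (tr Σ₂²)², as the n⁴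
term of the moment bound requires. -/
lemma sum_lam_pow_four_le {m : ℕ} (hmd : m + 1 ≤ d) (hn : 0 < n) :
    ∑ s ∈ Finset.Icc (m + 1) d, S.lam s ^ 4 ≤
      S.lam (m + 1) ^ 2 * ∑ s ∈ Finset.Icc (m + 1) d, S.lam s ^ 2 := by
  rw [Finset.mul_sum]
  refine Finset.sum_le_sum fun s hs => ?_
  have h1 : S.lam s ≤ S.lam (m + 1) := by
    rw [Finset.mem_Icc] at hs
    exact S.spectral.1 ⟨by omega, hmd⟩ ⟨by omega, hs.2⟩ hs.1
  have h2 := pow_le_pow_left₀ (S.lam_nonneg hn (noise_mem hs)) h1 2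
  calc S.lam s ^ 4 = S.lam s ^ 2 * S.lam s ^ 2 := by ring
    _ ≤ _ := mul_le_mul_of_nonneg_right h2 (sq_nonneg _)

/-- λ_s h_s(a)² is one nonnegative summand of the coordinate variance. Thus the coefficients of the
spike sum stay bounded however large the spike is. -/
lemma abs_sqrt_lam_mul_le {m : ℕ} (hmd : m ≤ d) (i : Fin n) {a : Fin d} {V : ℝ}
    (hV : S.sigma i a ≤ V) {s : ℕ} (hs : s ∈ Finset.Icc 1 m) :
    |Real.sqrt (S.lam s) * S.h s a| ≤ Real.sqrt V := by
  have hsd : s ∈ Finset.Icc 1 d := Finset.Icc_subset_Icc le_rfl hmd hs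
  refine Real.abs_le_sqrt ?_
  rw [mul_pow, S.sq_sqrt_lam i.pos hsd]
  exact (S.lam_mul_sq_le_sigma i a hsd).trans hV

/-- The spikes dominate the Hilbert–Schmidt norm of the noise covariance. -/
lemma sqrt_sum_sq_le {m : ℕ} (hm : 1 ≤ m) (hmd : m ≤ d) (hn : 0 < n) {q : ℝ} (hq : 0 < q)
    (h : q ≤ S.lam m ^ 2 / (S.noiseCov m ^ 2).trace) :
    0 < ∑ s ∈ Finset.Icc (m + 1) d, S.lam s ^ 2 ∧ 0 < S.lam m ∧
      Real.sqrt (∑ s ∈ Finset.Icc (m + 1) d, S.lam s ^ 2) ≤ (Real.sqrt q)⁻¹ * S.lam m := by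
  rw [S.trace_noiseCov_sq] at h
  have h0 : 0 ≤ ∑ s ∈ Finset.Icc (m + 1) d, S.lam s ^ 2 := Finset.sum_nonneg fun s _ => sq_nonneg _
  have h1 : 0 < ∑ s ∈ Finset.Icc (m + 1) d, S.lam s ^ 2 := by
    refine lt_of_le_of_ne h0 fun h2 => ?_
    -- A vanishing trace would make the quotient 0 by the convention for division, contradicting q >
    -- 0; so (C-i) itself forces a nontrivial noise part.
    rw [← h2, div_zero] at h
    exact absurd h (not_le.2 hq)
  rw [le_div_iff₀ h1] at h
  have h2 : 0 ≤ S.lam m := S.lam_nonneg hn (Finset.mem_Icc.2 ⟨hm, hmd⟩)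
  refine ⟨h1, lt_of_le_of_ne h2 fun h3 => ?_, ?_⟩
  · rw [← h3] at h
    have := mul_pos hq h1
    simp only [ne_eq, OfNat.ofNat_ne_zero, not_false_eq_true, zero_pow] at h
    linarith
  · have hsq := Real.sqrt_pos.2 hq
    rw [inv_mul_eq_div, le_div_iff₀ hsq, ← Real.sqrt_mul h0]
    exact Real.sqrt_le_iff.2 ⟨h2, by linarith⟩

end SampleModel

/-- The eigenvalue gaps are uniform over the finitely many spikes. -/
lemma ConditionCI.exists_gap {d n : ℕ → ℕ} {S : ∀ k, SampleModel.{u} (d k) (n k)} {m : ℕ}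
    (h : ConditionCI S m) : ∃ g : ℝ, 0 < g ∧ g ≤ 1 ∧ ∀ᶠ k in atTop, ∀ j ∈ Finset.Icc 1 m,
      ∀ j' ∈ Finset.Icc 1 m, j < j' → g ≤ (S k).lam j / (S k).lam j' - 1 := by
  -- Asking for all sufficiently small positive g turns the minimum over the finitely many pairs
  -- into a finite intersection of filter sets.
  have h1 : ∀ᶠ g in nhdsWithin (0 : ℝ) (Set.Ioi 0), ∀ j ∈ Finset.Icc 1 m,
      ∀ j' ∈ Finset.Icc 1 m, j < j' →
        ∀ᶠ k in atTop, g ≤ (S k).lam j / (S k).lam j' - 1 := by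
    rw [Finset.eventually_all]
    intro j hj
    rw [Finset.eventually_all]
    intro j' hj'
    rw [eventually_imp_distrib_left]
    intro hjj'
    obtain ⟨c, hc, hce⟩ := h.1 j (by simpa using hj) j' (by simpa using hj') hjj'
    filter_upwards [Ioc_mem_nhdsGT hc] with g hg
    filter_upwards [hce] with k hk using hg.2.trans hk
  obtain ⟨g, hg, hg01⟩ := (h1.and (Ioc_mem_nhdsGT (zero_lt_one' ℝ))).exists
  refine ⟨g, hg01.1, hg01.2, ?_⟩
  rw [Finset.eventually_all]
  intro j hj
  rw [Finset.eventually_all]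
  intro j' hj'
  rw [eventually_imp_distrib_left]
  exact hg j hj j' hj'

end Asymptotics

/-! ### Choice of the constants and conclusion. -/

theorem lemma1 {d n : ℕ → ℕ} (S : ∀ k, SampleModel.{u} (d k) (n k)) (m : ℕ) (hm : 1 ≤ m)
    (hd : Tendsto d atTop atTop) (hn : Tendsto n atTop atTop)
    (hstar : Tendsto (fun k => Real.log (d k) / (n k : ℝ)) atTop (nhds 0))
    (hAI : ConditionAI S) (hAII : ConditionAII S m)
    (hCI : ConditionCI S m) (hCII : ConditionCII S m)
    (lamHat : ∀ k, (S k).Ω → ℕ → ℝ) (uHat : ∀ k, (S k).Ω → ℕ → Fin (n k) → ℝ)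
    (hspec : ∀ k ω, IsSpectralDecomp ((S k).dualCov ω) (lamHat k ω) (uHat k ω))
    (hsign : ∀ k ω, ∀ j ∈ Set.Icc 1 m,
      0 ≤ (S k).h j ⬝ᵥ (S k).pcDirection ω (lamHat k ω) (uHat k ω) j) :
    ∀ j ∈ Set.Icc 1 m,
      IsBigOP S
        (fun k ω => ⨆ a : Fin (d k),
          |(S k).nrDirection ω (lamHat k ω) (uHat k ω) j a - (S k).h j a|)
        (fun k => Real.sqrt (((S k).lam j)⁻¹ * (n k : ℝ)⁻¹ * Real.log (d k))) := by
  intro j hj ε hε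
  have hjF : j ∈ Finset.Icc 1 m := by simpa using hj
  obtain ⟨g, hg0, hg1, hgap⟩ := hCI.exists_gap
  obtain ⟨-, ⟨q, hq, hqe⟩, hto⟩ := hCI
  obtain ⟨hz4, hz22, -, hz0, Cz, hCz⟩ := hAI
  obtain ⟨t₁, ht₁, t₂, ht₂, C, hC⟩ := hAII
  obtain ⟨v, hv, V₀, hV₀⟩ := hCII
  have hm0 : (1 : ℝ) ≤ m := by exact_mod_cast hm
  set V := max V₀ 1 with hV
  have hVpos : 0 < V := lt_max_of_lt_right one_pos
  have hsV : 0 < Real.sqrt V := Real.sqrt_pos.2 hVpos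
  set K := |Cz| + 1 with hK
  have hK0 : 0 < K := by positivity
  -- W counts the events in the definition of a good sample, each given probability ε'. A third of ε
  -- goes to the bad samples and a third to each of the two unions over coordinates.
  set W : ℝ := (m : ℝ) * m + 2 * m + 2 with hW
  have hW0 : 0 < W := by positivity
  set ε' := ε / (3 * W) with hε'
  have hε'0 : 0 < ε' := by positivity
  have hWε : W * ε' = ε / 3 := by rw [hε']; field_simp
  set c := Real.sqrt (K / ε') with hc
  have hc0 : 0 < c := Real.sqrt_pos.2 (by positivity)
  have hKc : K ≤ ε' * c ^ 2 := by
    rw [hc, Real.sq_sqrt (by positivity)]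
    exact le_of_eq (by field_simp)
  set Q := (Real.sqrt q)⁻¹ with hQ
  have hQ0 : 0 ≤ Q := by positivity
  -- The factor 1200 m (Q + 1) makes the contribution of δ to the smallness condition at most g/2;
  -- the n^{-1/2} term takes the other half.
  set δ := min 1 (g / (1200 * m * (Q + 1))) with hδ
  have hδ0 : 0 < δ := lt_min one_pos (by positivity)
  have hδ1 : δ ≤ 1 := min_le_left _ _
  have hδg : 300 * m * (2 * Q * δ) ≤ g / 2 := by
    have h1 : δ * (1200 * m * (Q + 1)) ≤ g := by
      rw [← le_div_iff₀ (by positivity)]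
      exact min_le_right _ _
    nlinarith [mul_nonneg hδ0.le (zero_le_one.trans hm0)]
  set K₁ := 8 * |C| / (t₁ / Real.sqrt V) ^ 2 + 2 with hK₁
  set K₂ := (|C| + 2) / (t₂ / Real.sqrt V) with hK₂
  have hK₂0 : 0 ≤ K₂ := by positivity
  set M := |SampleModel.coordConst m g c Q (Real.sqrt V) K₁ K₂| + 1 with hM
  have hnR : Tendsto (fun k => (n k : ℝ)) atTop atTop := tendsto_natCast_atTop_atTop.comp hn
  have hdR : Tendsto (fun k => (d k : ℝ)) atTop atTop := tendsto_natCast_atTop_atTop.comp hd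
  have hsn : Tendsto (fun k => Real.sqrt (n k)) atTop atTop := Real.tendsto_sqrt_atTop.comp hnR
  have hlog : Tendsto (fun k => Real.log (d k)) atTop atTop := Real.tendsto_log_atTop.comp hdR
  have hsq0 : Tendsto (fun k => Real.sqrt (Real.log (d k) / (n k : ℝ))) atTop (nhds 0) := by
    simpa using hstar.sqrt
  have hdiv : ∀ x : ℝ, Tendsto (fun k => x / Real.sqrt (n k)) atTop (nhds 0) := fun x =>
    hsn.const_div_atTop x
  -- Half of the budget ε'δ⁴ for each of the two terms in the moment bound of the off-diagonal Gram
  -- matrix.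
  set β := ε' * δ ^ 4 / 2 with hβ
  have hβ0 : 0 < β := by positivity
  have e1 := (hdiv (300 * m * (12 * (1 + c) ^ 2 * (1 + Q)))).eventually_le_const (half_pos hg0)
  have e2 := (hdiv (13 * (12 * (1 + c) ^ 2 * (1 + Q)) +
    2 * (5 * m + (4 * c + 2) * Q))).eventually_le_const (one_half_pos (α := ℝ))
  have e3 := (hnR.const_div_atTop (6 * K ^ 2)).eventually_le_const hβ0
  have e4 := hto.eventually_le_const hβ0
  have e5 := hsq0.eventually_le_const (show 0 < t₁ / Real.sqrt V / 2 by positivity)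
  -- Eventually log d ≤ n, which lets exp(−2n) survive the union over d coordinates.
  have e6 := hstar.eventually_le_const one_pos
  have e7 := (hdR.const_div_atTop 2).eventually_le_const (show 0 < ε / 3 by positivity)
  have e8 := (Real.tendsto_exp_neg_atTop_nhds_zero.comp hnR).eventually_le_const
    (show 0 < ε / 3 by positivity)
  refine ⟨M, by positivity, ?_⟩
  filter_upwards [e1, e2, e3, e4, e5, e6, e7, e8, hgap, hqe, hCz, hC, hV₀,
    hlog.eventually_ge_atTop 1, hn.eventually_ge_atTop (4 * m + 4),
    hd.eventually_ge_atTop (m + 1)] with k e1 e2 e3 e4 e5 e6 e7 e8 hgap hqe hCz hC hV₀ hL hmn hmd1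
  have hmd : m ≤ d k := by omega
  have hnk : 0 < n k := by omega
  have hnk' : (0 : ℝ) < n k := by exact_mod_cast hnk
  have hdk' : (0 : ℝ) < d k := by
    have : 0 < d k := by omega
    exact_mod_cast this
  obtain ⟨hτ, hlm, hQm⟩ := (S k).sqrt_sum_sq_le hm hmd hnk hq hqe
  have hl : ∀ s ∈ Finset.Icc 1 m, 0 < (S k).lam s := fun s hs => by
    rw [Finset.mem_Icc] at hs
    exact hlm.trans_le ((S k).spectral.1 ⟨hs.1, by omega⟩ ⟨hm, hmd⟩ hs.2)
  have hgap' : ∀ j ∈ Finset.Icc 1 m, ∀ j' ∈ Finset.Icc 1 m, j < j' →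
      (1 + g) * (S k).lam j' ≤ (S k).lam j := fun i hi i' hi' hii' => by
    have h1 : 1 + g ≤ (S k).lam i / (S k).lam i' := by linarith [hgap i hi i' hi' hii']
    rwa [le_div_iff₀ (hl i' hi')] at h1
  have hvV : ∀ i a, (S k).sigma i a ≤ V := fun i a =>
    (hV₀ i a).2.1.trans (le_max_left _ _)
  have hscore := (S k).isScoreFamily hnk (hz4 k) (hz22 k) (hz0 k) hCz
  rw [(S k).trace_noiseCov_sq, div_le_iff₀ hτ] at e4
  rw [div_le_iff₀ hnk'] at e3 e6
  have hoff : (n k : ℝ) ^ 4 * ∑ s ∈ Finset.Icc (m + 1) (d k), (S k).lam s ^ 4 +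
      6 * K ^ 2 * (n k : ℝ) ^ 3 * (∑ s ∈ Finset.Icc (m + 1) (d k), (S k).lam s ^ 2) ^ 2 ≤
      ε' * (δ ^ 4 * (n k : ℝ) ^ 4 *
        (∑ s ∈ Finset.Icc (m + 1) (d k), (S k).lam s ^ 2) ^ 2) := by
    set τ := ∑ s ∈ Finset.Icc (m + 1) (d k), (S k).lam s ^ 2
    have h1 : ∑ s ∈ Finset.Icc (m + 1) (d k), (S k).lam s ^ 4 ≤ β * τ * τ :=
      ((S k).sum_lam_pow_four_le hmd1 hnk).trans (mul_le_mul_of_nonneg_right e4 hτ.le)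
    calc _ ≤ (n k : ℝ) ^ 4 * (β * τ * τ) + β * n k * (n k : ℝ) ^ 3 * τ ^ 2 := by gcongr
      _ = _ := by rw [hβ]; ring
  have hgood := hscore.measure_not_isGoodSample_le (N := Finset.Icc (m + 1) (d k)) (m := m)
    (fun s hs => SampleModel.noise_mem hs) (Finset.Icc_subset_Icc le_rfl hmd)
    (fun s hs hs' => by rw [Finset.mem_Icc] at hs hs'; omega) hnk hl hτ hc0 hδ0 hε'0.le hKc hoff
  rw [← hW, hWε] at hgood
  have hcross := fun a => (S k).measure_abs_sum_noise_mul_ge_le hmd hnk hjF (hl j hjF) a ht₁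
    (fun i => hv.trans_le (hV₀ i a).1)
    (fun i => ((S k).sigmaNoise_le hmd i a).trans (hvV i a))
    (fun i => ⟨((hC i a).1 j hj).1, ((hC i a).1 j hj).2.trans (le_abs_self C)⟩)
    (zero_le_one.trans hL) e5
  have hnoise := fun a => (S k).measure_sum_noise_sq_ge_le hnk a ht₂
    (fun i => hv.trans_le (hV₀ i a).2.2.1)
    (fun i => (hV₀ i a).2.2.2.trans (le_max_left V₀ 1))
    (fun i => ⟨(hC i a).2.1, (hC i a).2.2.trans (le_abs_self C)⟩)
  have hsmall : 300 * m * (2 * Q * δ + 12 * (1 + c) ^ 2 * (1 + Q) / Real.sqrt (n k)) ≤ g := by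
    have : 300 * m * (2 * Q * δ + 12 * (1 + c) ^ 2 * (1 + Q) / Real.sqrt (n k)) =
        300 * m * (2 * Q * δ) +
          300 * m * (12 * (1 + c) ^ 2 * (1 + Q)) / Real.sqrt (n k) := by ring
    linarith
  refine ((S k).measure_iSup_abs_nrDirection_sub_le hm hmd hmn hc0.le hδ0.le hδ1 hlm hg0 hg1 hgap'
    hQ0 hQm hsmall e2 (fun a s hs => (S k).abs_sqrt_lam_mul_le hmd ⟨0, hnk⟩ (hvV _ a) hs) hK₂0 hL
    (by positivity) ((le_abs_self _).trans (by linarith)) hjF (by positivity) (by positivity)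
    (by positivity) hgood hcross hnoise (hspec k) (fun ω => hsign k ω j hj)).trans
    (ENNReal.ofReal_le_ofReal ?_)
  have hexp : Real.exp (Real.log (d k)) = d k := Real.exp_log hdk'
  -- The union of Bernstein events costs d·2d⁻² = 2/d.
  have h1 : (d k : ℝ) * (2 * Real.exp (-(2 * Real.log (d k)))) ≤ ε / 3 := by
    refine le_trans (le_of_eq ?_) e7
    rw [two_mul (Real.log _), neg_add, Real.exp_add, Real.exp_neg, hexp]
    field_simp
  -- Writing d = exp(log d) with log d ≤ n bounds this by exp(−n).
  have h2 : (d k : ℝ) * Real.exp (-(2 * n k)) ≤ ε / 3 := by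
    refine le_trans ?_ e8
    nth_rw 1 [← hexp]
    rw [← Real.exp_add]
    exact Real.exp_le_exp.2 (by linarith)
  linarith
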